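/- Let $k$ be an algebraically closed field of characteristic $0$. A \emph{ribbon} over $k$ is a $k$-scheme $C$ together with a closed immersion $i:\mathbb P^1_k\hookrightarrow C$ over $k$ identifying $\mathbb P^1_k$ with $C_{\mathrm{red}}$, such that the ideal sheaf $\mathscr L$ of $\mathbb P^1_k$ in $C$ satisfies $\mathscr L^2=0$ and is a line bundle on $\mathbb P^1_k$. For an $\mathcal O_C$-module $M$ let $\chi(M)=h^0(M)-h^1(M)$; the genus of $C$ is $g=1-\chi(\mathcal O_C)$, and the degree of a line bundle $L$ on $C$ is $\deg L=\chi(L)-\chi(\mathcal O_C)$. The ribbon $C$ is called \emph{hyperelliptic} (or \emph{split}) if there is a $k$-morphism $\pi:C\to\mathbb P^1_k$ with $\pi\circ i=\mathrm{id}$. \textbf{Theorem.} Let $C$ be a ribbon of genus $g$ over $k$, and let $L$ be a line bundle on $C$ of degree $2n$, where $n$ is an integer with $1\le n\le g-2$. Then $H^0(C,L)$ is a finite-dimensional $k$-vector space and $h^0(C,L)\le n+1$. Equality holds if and only if $C$ is hyperelliptic and $L\cong\pi^*\mathcal O_{\mathbb P^1}(n)$ for some $k$-morphism $\pi:C\to\mathbb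 P^1_k$ with $\pi\circ i=\mathrm{id}$. -/

import Mathlib

open AlgebraicGeometry CategoryTheory TopologicalSpace Opposite

universe u

noncomputable section

namespace RibbonCurve

/-! ### Restriction of functions, and line bundles glued from two trivial pieces -/

/-- The restriction map `Γ(X, V) → Γ(X, W)` for open sets `W ≤ V`. -/
def resO {X : Scheme.{u}} {W V : X.Opens} (h : W ≤ V) : Γ(X, V) →+* Γ(X, W) :=
  (X.presheaf.map (homOfLE h).op).hom

theorem resO_resO {X : Scheme.{u}} {W V T : X.Opens} (h : W ≤ V) (h' : V ≤ T) (x : Γ(X, T)) :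
    resO h (resO h' x) = resO (h.trans h') x := by
  have := congr($(X.presheaf.map_comp (homOfLE h').op (homOfLE h).op) x)
  exact this.symm

theorem resO_self {X : Scheme.{u}} {W : X.Opens} (h : W ≤ W) (x : Γ(X, W)) :
    resO h x = x := by
  have := congr($(X.presheaf.map_id (op W)) x)
  exact this

/-- Sections over `W` of the sheaf obtained by gluing `𝒪_U` and `𝒪_V` along `U ⊓ V` by means of
the function `t`: pairs `(a, b)` of functions on `W ⊓ U` and on `W ⊓ V` with `a = t * b` on
`W ⊓ (U ⊓ V)`. -/
def gluedSections {X : Scheme.{u}} (U V : X.Opens) (t : Γ(X, U ⊓ V)) (W : X.Opens) :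
    AddSubgroup (Γ(X, W ⊓ U) × Γ(X, W ⊓ V)) where
  carrier := {s | resO (inf_le_inf_left W inf_le_left : W ⊓ (U ⊓ V) ≤ W ⊓ U) s.1 =
    resO (inf_le_right : W ⊓ (U ⊓ V) ≤ U ⊓ V) t *
      resO (inf_le_inf_left W inf_le_right : W ⊓ (U ⊓ V) ≤ W ⊓ V) s.2}
  add_mem' {a b} ha hb := by
    simp only [Set.mem_ofPred_eq, Prod.fst_add, Prod.snd_add, map_add] at *
    rw [ha, hb, mul_add]
  zero_mem' := by simp
  neg_mem' {a} ha := by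
    simp only [Set.mem_ofPred_eq, Prod.fst_neg, Prod.snd_neg, map_neg] at *
    rw [ha, mul_neg]

theorem mem_gluedSections {X : Scheme.{u}} {U V : X.Opens} {t : Γ(X, U ⊓ V)} {W : X.Opens}
    {s : Γ(X, W ⊓ U) × Γ(X, W ⊓ V)} :
    s ∈ gluedSections U V t W ↔
      resO (inf_le_inf_left W inf_le_left : W ⊓ (U ⊓ V) ≤ W ⊓ U) s.1 =
        resO (inf_le_right : W ⊓ (U ⊓ V) ≤ U ⊓ V) t *
          resO (inf_le_inf_left W inf_le_right : W ⊓ (U ⊓ V) ≤ W ⊓ V) s.2 :=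
  Iff.rfl

/-- Functions on `W` act on glued sections componentwise. -/
instance gluedSectionsModule {X : Scheme.{u}} (U V : X.Opens) (t : Γ(X, U ⊓ V)) (W : X.Opens) :
    Module Γ(X, W) (gluedSections U V t W) where
  smul r s := ⟨(resO inf_le_left r * s.1.1, resO inf_le_left r * s.1.2), by
    have h := mem_gluedSections.mp s.2
    rw [mem_gluedSections]
    simp only [map_mul, resO_resO, h]
    ring⟩
  one_smul s := Subtype.ext (Prod.ext (by change resO _ 1 * _ = _; simp)
    (by change resO _ 1 * _ = _; simp))
  mul_smul r r' s := Subtype.ext (Prod.ext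
    (by change resO _ (r * r') * _ = resO _ r * (resO _ r' * _); rw [map_mul, mul_assoc])
    (by change resO _ (r * r') * _ = resO _ r * (resO _ r' * _); rw [map_mul, mul_assoc]))
  smul_zero r := Subtype.ext (Prod.ext (mul_zero _) (mul_zero _))
  smul_add r s s' := Subtype.ext (Prod.ext (mul_add _ _ _) (mul_add _ _ _))
  add_smul r r' s := Subtype.ext (Prod.ext
    (by change resO _ (r + r') * _ = resO _ r * _ + resO _ r' * _; rw [map_add, add_mul])
    (by change resO _ (r + r') * _ = resO _ r * _ + resO _ r' * _; rw [map_add, add_mul]))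
  zero_smul s := Subtype.ext (Prod.ext (by change resO _ 0 * _ = _; rw [map_zero, zero_mul]; rfl)
    (by change resO _ 0 * _ = _; rw [map_zero, zero_mul]; rfl))

/-- Restriction of glued sections. -/
def gluedRes {X : Scheme.{u}} (U V : X.Opens) (t : Γ(X, U ⊓ V)) {W W' : X.Opens} (h : W' ≤ W) :
    gluedSections U V t W →+ gluedSections U V t W' where
  toFun s := ⟨(resO (inf_le_inf_right U h) s.1.1, resO (inf_le_inf_right V h) s.1.2), by
    have hs := congr(resO (inf_le_inf_right (U ⊓ V) h) $(mem_gluedSections.mp s.2))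
    rw [mem_gluedSections]
    simpa only [map_mul, resO_resO] using hs⟩
  map_zero' := Subtype.ext (Prod.ext (map_zero _) (map_zero _))
  map_add' _ _ := Subtype.ext (Prod.ext (map_add _ _ _) (map_add _ _ _))

/-- The presheaf of abelian groups of glued sections. -/
def gluedPresheaf {X : Scheme.{u}} (U V : X.Opens) (t : Γ(X, U ⊓ V)) : TopCat.Presheaf Ab.{u} X where
  obj W := AddCommGrpCat.of (gluedSections U V t W.unop)
  map f := AddCommGrpCat.ofHom (gluedRes U V t f.unop.le)
  map_id W := by
    refine AddCommGrpCat.hom_ext (AddMonoidHom.ext fun s => Subtype.ext (Prod.ext ?_ ?_))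
    · exact resO_self _ _
    · exact resO_self _ _
  map_comp f g := by
    refine AddCommGrpCat.hom_ext (AddMonoidHom.ext fun s => Subtype.ext (Prod.ext ?_ ?_))
    · exact (resO_resO _ _ _).symm
    · exact (resO_resO _ _ _).symm

instance gluedPresheafModule {X : Scheme.{u}} (U V : X.Opens) (t : Γ(X, U ⊓ V)) (W : X.Opensᵒᵖ) :
    Module (X.ringCatSheaf.obj.obj W) ((gluedPresheaf U V t).obj W) :=
  gluedSectionsModule U V t W.unop

/-- Functions on open sets, given on a cover and agreeing on overlaps, glue uniquely. -/
theorem resO_glue {X : Scheme.{u}} {ι : Type u} (W : ι → X.Opens) (T : X.Opens)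
    (a : ∀ i, Γ(X, W i ⊓ T))
    (h : ∀ i j, resO (inf_le_inf_right T inf_le_left : (W i ⊓ W j) ⊓ T ≤ W i ⊓ T) (a i) =
      resO (inf_le_inf_right T inf_le_right : (W i ⊓ W j) ⊓ T ≤ W j ⊓ T) (a j)) :
    ∃! s : Γ(X, iSup W ⊓ T), ∀ i, resO (inf_le_inf_right T (le_iSup W i)) s = a i := by
  refine X.sheaf.existsUnique_gluing' (fun i => W i ⊓ T) (iSup W ⊓ T)
    (fun i => homOfLE (inf_le_inf_right T (le_iSup W i))) (by rw [iSup_inf_eq]) a ?_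
  intro i j
  have hle : (W i ⊓ T) ⊓ (W j ⊓ T) ≤ (W i ⊓ W j) ⊓ T :=
    le_inf (inf_le_inf inf_le_left inf_le_left) (inf_le_left.trans inf_le_right)
  have := congr(resO hle $(h i j))
  simp only [resO_resO] at this
  exact this

theorem gluedPresheaf_isSheaf {X : Scheme.{u}} (U V : X.Opens) (t : Γ(X, U ⊓ V)) :
    (gluedPresheaf U V t).IsSheaf := by
  rw [TopCat.Presheaf.isSheaf_iff_isSheafUniqueGluing]
  intro ι W s hs
  have hs' : ∀ i j, gluedRes U V t (inf_le_left : W i ⊓ W j ≤ W i) (s i) =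
      gluedRes U V t (inf_le_right : W i ⊓ W j ≤ W j) (s j) := hs
  obtain ⟨a, ha, ha'⟩ := resO_glue W U (fun i => (s i).1.1)
    (fun i j => congr(($(hs' i j)).1.1))
  obtain ⟨b, hb, hb'⟩ := resO_glue W V (fun i => (s i).1.2)
    (fun i j => congr(($(hs' i j)).1.2))
  have hab : (a, b) ∈ gluedSections U V t (iSup W) := by
    rw [mem_gluedSections]
    refine (resO_glue W (U ⊓ V) (fun i => resO (inf_le_inf_left (W i) inf_le_left) (s i).1.1)
      ?_).unique ?_ ?_
    · intro i j
      have := congr(resO (inf_le_inf_left (W i ⊓ W j) inf_le_left :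
        (W i ⊓ W j) ⊓ (U ⊓ V) ≤ (W i ⊓ W j) ⊓ U) ($(hs' i j)).1.1)
      simp only [gluedRes, AddMonoidHom.coe_mk, ZeroHom.coe_mk, resO_resO] at this
      simpa only [resO_resO] using this
    · intro i
      simp only [← ha i, resO_resO]
    · intro i
      have h := mem_gluedSections.mp (s i).2
      rw [h, ← hb i]
      simp only [map_mul, resO_resO]
  refine ⟨⟨(a, b), hab⟩, fun i => Subtype.ext (Prod.ext (ha i) (hb i)), fun s' hs' => ?_⟩
  have h' : ∀ i, gluedRes U V t (le_iSup W i) s' = s i := hs'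
  exact Subtype.ext (Prod.ext (ha' _ fun i => congr(($(h' i)).1.1))
    (hb' _ fun i => congr(($(h' i)).1.2)))

/-- The sheaf of `𝒪_X`-modules obtained by gluing `𝒪_U` and `𝒪_V` along `U ⊓ V` by means of `t`.
When `U` and `V` cover `X` and `t` is invertible, it is the line bundle with generators `e` on `U`
and `e'` on `V` such that `e' = t e`. -/
def gluedModule {X : Scheme.{u}} (U V : X.Opens) (t : Γ(X, U ⊓ V)) : X.Modules where
  val := PresheafOfModules.ofPresheaf (R := X.ringCatSheaf.obj) (gluedPresheaf U V t) (by
    intro W W' f r s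
    refine Subtype.ext (Prod.ext ?_ ?_)
    · change resO _ (resO _ r * _) = resO inf_le_left (resO f.unop.le r) * resO _ _
      rw [map_mul]
      exact congr_arg₂ _ ((resO_resO _ _ _).trans (resO_resO _ _ _).symm) rfl
    · change resO _ (resO _ r * _) = resO inf_le_left (resO f.unop.le r) * resO _ _
      rw [map_mul]
      exact congr_arg₂ _ ((resO_resO _ _ _).trans (resO_resO _ _ _).symm) rfl)
  isSheaf := gluedPresheaf_isSheaf U V t

/-- An `𝒪_X`-module is a line bundle if it is locally isomorphic to `𝒪_X`. -/
def IsLineBundle {X : Scheme.{u}} (M : X.Modules) : Prop :=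
  ∀ x : X, ∃ U : X.Opens, x ∈ U ∧
    Nonempty (M.restrict U.ι ≅ SheafOfModules.unit (U : Scheme.{u}).ringCatSheaf)

/-! ### The projective line and its line bundles `𝒪(n)` -/

/-- The grading of `k[x₀, x₁]` by degree. -/
abbrev grading (k : Type u) [Field k] : ℕ → Submodule k (MvPolynomial (Fin 2) k) :=
  MvPolynomial.homogeneousSubmodule (Fin 2) k

instance (k : Type u) [Field k] : GradedAlgebra (grading k) :=
  MvPolynomial.gradedAlgebra

/-- The projective line `ℙ¹ = Proj k[x₀, x₁]`. -/
def P1 (k : Type u) [Field k] : Scheme.{u} := Proj (grading k)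

/-- The structure morphism `ℙ¹ ⟶ Spec k`. -/
def P1.toSpec (k : Type u) [Field k] : P1 k ⟶ Spec (.of k) :=
  Proj.toSpecZero (grading k) ≫ Spec.map (CommRingCat.ofHom (algebraMap k (grading k 0)))

/-- The standard affine open set `x_j ≠ 0` of `ℙ¹`. -/
def P1.chart (k : Type u) [Field k] (j : Fin 2) : (P1 k).Opens :=
  Proj.basicOpen (grading k) (MvPolynomial.X j)

/-- The coordinate `x₁ / x₀` on the chart `x₀ ≠ 0`. -/
def P1.coord (k : Type u) [Field k] : Γ(P1 k, P1.chart k 0) :=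
  (Proj.awayToSection (grading k) (MvPolynomial.X 0)).hom
    (HomogeneousLocalization.Away.mk (grading k) (d := 1)
      (MvPolynomial.isHomogeneous_X k (0 : Fin 2)) 1 (MvPolynomial.X 1)
      (MvPolynomial.isHomogeneous_X k (1 : Fin 2)))

/-- The line bundle `𝒪(n)` on `ℙ¹`: it has generators `x₀ ^ n` and `x₁ ^ n` on the two standard
charts, so a section is `a x₀ ^ n = b x₁ ^ n` with `a = (x₁ / x₀) ^ n b`. -/
def P1.twist (k : Type u) [Field k] (n : ℕ) : (P1 k).Modules :=
  gluedModule (P1.chart k 0) (P1.chart k 1) (resO inf_le_left (P1.coord k) ^ n)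

/-! ### Cohomology of modules on schemes over a field -/

/-- The ring homomorphism `k → Γ(X, U)` for a scheme `X` over `Spec k`. -/
def scalars {k : Type u} [Field k] {X : Scheme.{u}} (p : X ⟶ Spec (.of k)) (U : X.Opens) :
    k →+* Γ(X, U) :=
  (resO le_top).comp ((Scheme.ΓSpecIso (.of k)).inv ≫ p.appTop).hom

/-- The sections of the `𝒪_X`-module `M` over `U`, as a vector space over `k`. -/
def Sections {k : Type u} [Field k] {X : Scheme.{u}} (_p : X ⟶ Spec (.of k)) (M : X.Modules)
    (U : X.Opens) : Type u :=
  Γ(M, U)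

instance {k : Type u} [Field k] {X : Scheme.{u}} (p : X ⟶ Spec (.of k)) (M : X.Modules)
    (U : X.Opens) : AddCommGroup (Sections p M U) :=
  inferInstanceAs (AddCommGroup Γ(M, U))

instance {k : Type u} [Field k] {X : Scheme.{u}} (p : X ⟶ Spec (.of k)) (M : X.Modules)
    (U : X.Opens) : Module k (Sections p M U) :=
  Module.compHom Γ(M, U) (scalars p U)

/-- Restriction of sections, as a linear map. -/
def Sections.res {k : Type u} [Field k] {X : Scheme.{u}} (p : X ⟶ Spec (.of k)) (M : X.Modules)
    {U V : X.Opens} (h : U ≤ V) : Sections p M V →ₗ[k] Sections p M U where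
  toFun s := M.presheaf.map (homOfLE h).op s
  map_add' s s' := map_add (M.presheaf.map (homOfLE h).op).hom s s'
  map_smul' c s := by
    have h1 := Scheme.Modules.map_smul M (homOfLE h) (scalars p V c) s
    have h2 : X.presheaf.map (homOfLE h).op (scalars p V c) = scalars p U c :=
      resO_resO h le_top _
    rw [h2] at h1
    exact h1

/-- `H⁰(X, M)`. -/
abbrev H0 {k : Type u} [Field k] {X : Scheme.{u}} (p : X ⟶ Spec (.of k)) (M : X.Modules) :
    Type u :=
  Sections p M ⊤

/-- The differential `(a, b) ↦ a - b` of the Čech complex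
`M(U) × M(V) → M(U ⊓ V)` of the pair of open sets `U`, `V`. -/
def cechDiff {k : Type u} [Field k] {X : Scheme.{u}} (p : X ⟶ Spec (.of k)) (M : X.Modules)
    (U V : X.Opens) : (Sections p M U × Sections p M V) →ₗ[k] Sections p M (U ⊓ V) :=
  (Sections.res p M inf_le_left).comp (LinearMap.fst k _ _) -
    (Sections.res p M inf_le_right).comp (LinearMap.snd k _ _)

/-- `H¹(X, M)`, computed by the Čech complex of the cover of `X` by `U` and `V`. For a quasi-coherent
`M` on a separated scheme covered by the affine open sets `U` and `V`, this is the cohomology of `M`,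
and all higher cohomology of `M` vanishes. -/
abbrev H1 {k : Type u} [Field k] {X : Scheme.{u}} (p : X ⟶ Spec (.of k)) (M : X.Modules)
    (U V : X.Opens) : Type u :=
  Sections p M (U ⊓ V) ⧸ LinearMap.range (cechDiff p M U V)

/-- The Euler characteristic `dim H⁰ - dim H¹`, computed with the cover of `X` by `U` and `V`. -/
def eulerChar {k : Type u} [Field k] {X : Scheme.{u}} (p : X ⟶ Spec (.of k)) (M : X.Modules)
    (U V : X.Opens) : ℤ :=
  (Module.finrank k (H0 p M) : ℤ) - (Module.finrank k (H1 p M U V) : ℤ)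

end RibbonCurve

open RibbonCurve

/-- A ribbon on `ℙ¹` over `k`: a `k`-scheme together with a closed immersion of `ℙ¹` over `k` which
identifies `ℙ¹` with the reduced subscheme, whose ideal sheaf `ℒ` has square zero and is a line bundle
on `ℙ¹`. -/
structure Ribbon (k : Type u) [Field k] where
  /-- the underlying scheme -/
  scheme : Scheme.{u}
  /-- the structure morphism -/
  toSpec : scheme ⟶ Spec (.of k)
  /-- the inclusion of the projective line -/
  incl : P1 k ⟶ scheme
  incl_toSpec : incl ≫ toSpec = P1.toSpec k
  isClosedImmersion : IsClosedImmersion incl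
  /-- `ℙ¹` is the reduced subscheme: its ideal sheaf is the sheaf of nilpotent functions. -/
  ker_eq_nilradical : incl.ker = scheme.nilradical
  ker_sq : incl.ker ^ 2 = ⊥
  /-- The conormal sheaf `ℒ = ℒ / ℒ ^ 2` is a line bundle on `ℙ¹`: over each affine open set `U` it
  is an invertible module over `𝒪(U) / ℒ(U)`. -/
  conormal_invertible : ∀ U : scheme.affineOpens,
    Module.Invertible (Γ(scheme, U) ⧸ incl.ker.ideal U) (incl.ker.ideal U).Cotangent

namespace Ribbon

/-- The open subset of the ribbon `C` which has the same points as the standard affine open set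
`x_j ≠ 0` of `ℙ¹`. These two open sets are affine and cover `C`, because `ℙ¹ → C` is a
homeomorphism and is defined by a nilpotent ideal. -/
def chart {k : Type u} [Field k] (C : Ribbon k) (j : Fin 2) : C.scheme.Opens where
  carrier := (C.incl '' ((P1.chart k j : Set (P1 k))ᶜ))ᶜ
  is_open' := by
    have := C.isClosedImmersion
    exact (C.incl.isClosedEmbedding.isClosedMap _ (P1.chart k j).isOpen.isClosed_compl).isOpen_compl

/-- `H⁰(C, M)` as a vector space over `k`. -/
abbrev H0 {k : Type u} [Field k] (C : Ribbon k) (M : C.scheme.Modules) : Type u :=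
  RibbonCurve.H0 C.toSpec M

/-- The Euler characteristic `χ(M)`. -/
def chi {k : Type u} [Field k] (C : Ribbon k) (M : C.scheme.Modules) : ℤ :=
  eulerChar C.toSpec M (C.chart 0) (C.chart 1)

/-- The structure sheaf of `C`. -/
def structureModule {k : Type u} [Field k] (C : Ribbon k) : C.scheme.Modules :=
  SheafOfModules.unit C.scheme.ringCatSheaf

/-- The arithmetic genus `g = 1 - χ(𝒪_C)`. -/
def genus {k : Type u} [Field k] (C : Ribbon k) : ℤ := 1 - C.chi C.structureModule

/-- The degree `χ(L) - χ(𝒪_C)` of a line bundle. -/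
def degree {k : Type u} [Field k] (C : Ribbon k) (L : C.scheme.Modules) : ℤ :=
  C.chi L - C.chi C.structureModule

/-- A morphism `π : C ⟶ ℙ¹` over `k` is a splitting if it restricts to the identity of `ℙ¹`. A ribbon
is split, or hyperelliptic, if such a morphism exists. -/
structure IsSplitting {k : Type u} [Field k] (C : Ribbon k) (π : C.scheme ⟶ P1 k) : Prop where
  incl_comp : C.incl ≫ π = 𝟙 (P1 k)
  comp_toSpec : π ≫ P1.toSpec k = C.toSpec

/-- `C` is hyperelliptic (that is, split). -/
def IsHyperelliptic {k : Type u} [Field k] (C : Ribbon k) : Prop :=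
  ∃ π : C.scheme ⟶ P1 k, C.IsSplitting π

end Ribbon

end

open RibbonCurve

/-! Let `e` be the degree of the conormal bundle, so that `g = -1 - e`. If `L` restricts to `𝒪(d)`
on `ℙ¹`, the exact sequence `0 → 𝒪(d + e) → L → 𝒪(d) → 0` gives `χ(L) = (d + e + 1) + (d + 1)`,
hence `deg L = 2d` and `d = n`. Since `n ≤ g - 2` means `n + e ≤ -3`, the sheaf `𝒪(n + e)` has no
sections, so `H⁰(L)` embeds into `H⁰(𝒪(n))`, of dimension `n + 1`. This is the bound (`index_diff`,
`kerMap_injective`).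

If equality holds, every monomial of degree `n` lifts to a section of `L`, written `a_j = u b_j` on
the two charts, where `u` is the transition function and `a_j`, `b_j` reduce to `X ^ j`, `X ^ (n -
j)`. After changing the generators of `L` one has `a_0 = 1` and `b_n = 1`. Then `t = a_1` and `s =
b_{n-1}` lift the two coordinates. The failures of `t s = 1` and of `u = t ^ n` are Laurent
polynomials `h` and `φ`, and the gluing relations say that `T ^ j (φ + (n - j) h)` is a Čech
coboundary for `𝒪(n + e)`. Coboundaries have no coefficients at exponents strictly between `n + e`
and `0`, a gap which contains `-2` and `-1`. Each exponent of `φ + (n - j) h` can thus be tested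
with two consecutive values of `j`, which forces `h = φ = 0` (`eq_zero_of_tails`). So `t` and `s`
glue to a splitting `π` (`exists_isSplitting`), and the transition function `t ^ n` exhibits `L` as
`π^* 𝒪(n)` (`IsSplitting.nonempty_iso`).

Conversely, a splitting has `ℙ¹ → C` as a section, so pulling back sections of `𝒪(n)` is injective
and gives `n + 1` independent sections (`IsSplitting.le_finrank`).

What remains is to reduce sheaves to this algebra. The two charts of `C` are square-zero thickenings
of affine lines. Over them `C` is affine, line bundles are free and the ideal has one generator; the
first two facts come from an induction on divisors in a principal ideal domain
(`induction_of_isPrincipalIdealRing`), the third from the freeness of invertible modules over it.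
The resulting data form a `RibbonAlgebra`. -/

noncomputable section

namespace RibbonCurve
open Polynomial LaurentPolynomial Function

/-! ### Additivity of the index in short exact sequences. -/

section ExactSequences

variable {k : Type*} [Field k]

theorem finite_of_exact {A B C : Type*} [AddCommGroup A] [Module k A] [AddCommGroup B] [Module k B]
    [AddCommGroup C] [Module k C] [Module.Finite k A] [Module.Finite k C]
    (f : A →ₗ[k] B) (g : B →ₗ[k] C) (h : Exact f g) : Module.Finite k B := by
  have h1 : Module.Finite k (LinearMap.ker g) := by
    rw [LinearMap.exact_iff.mp h]; infer_instance
  have h2 : Module.Finite k (B ⧸ LinearMap.ker g) :=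
    Module.Finite.equiv g.quotKerEquivRange.symm
  exact Module.Finite.of_submodule_quotient (LinearMap.ker g)

theorem finrank_eq_of_exact {A B C : Type*} [AddCommGroup A] [Module k A] [AddCommGroup B]
    [Module k B] [AddCommGroup C] [Module k C] [Module.Finite k B]
    (f : A →ₗ[k] B) (g : B →ₗ[k] C) (h : Exact f g) :
    Module.finrank k B =
      Module.finrank k (LinearMap.range f) + Module.finrank k (LinearMap.range g) := by
  rw [← LinearMap.exact_iff.mp h, add_comm, LinearMap.finrank_range_add_finrank_ker]

/-- The index of a linear map with finite-dimensional kernel and cokernel. -/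
def index {E F : Type*} [AddCommGroup E] [Module k E] [AddCommGroup F] [Module k F]
    (δ : E →ₗ[k] F) : ℤ :=
  (Module.finrank k (LinearMap.ker δ) : ℤ) - Module.finrank k (F ⧸ LinearMap.range δ)

/-- A linear map is Fredholm if its kernel and its cokernel are finite-dimensional. -/
structure IsFredholm {E F : Type*} [AddCommGroup E] [Module k E] [AddCommGroup F] [Module k F]
    (δ : E →ₗ[k] F) : Prop where
  finite_ker : Module.Finite k (LinearMap.ker δ)
  finite_coker : Module.Finite k (F ⧸ LinearMap.range δ)

variable {M₁ M₂ M₃ N₁ N₂ N₃ : Type*}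
  [AddCommGroup M₁] [Module k M₁] [AddCommGroup M₂] [Module k M₂] [AddCommGroup M₃] [Module k M₃]
  [AddCommGroup N₁] [Module k N₁] [AddCommGroup N₂] [Module k N₂] [AddCommGroup N₃] [Module k N₃]

/-- This is the snake lemma followed by rank-nullity. The spaces themselves are infinite-dimensional
Čech groups, so only kernels and cokernels can be counted. -/
theorem index_eq_of_exact
    (i₁ : M₁ →ₗ[k] N₁) (i₂ : M₂ →ₗ[k] N₂) (i₃ : M₃ →ₗ[k] N₃)
    (f₁ : M₁ →ₗ[k] M₂) (f₂ : M₂ →ₗ[k] M₃) (hf₁ : Injective f₁) (hf : Exact f₁ f₂)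
    (hf₂ : Surjective f₂)
    (g₁ : N₁ →ₗ[k] N₂) (g₂ : N₂ →ₗ[k] N₃) (hg₁ : Injective g₁) (hg : Exact g₁ g₂)
    (hg₂ : Surjective g₂)
    (h₁ : g₁.comp i₁ = i₂.comp f₁) (h₂ : g₂.comp i₂ = i₃.comp f₂)
    (F₁ : IsFredholm i₁) (F₃ : IsFredholm i₃) :
    IsFredholm i₂ ∧ index i₂ = index i₁ + index i₃ := by
  have e1 (x) : g₁ (i₁ x) = i₂ (f₁ x) := congr($h₁ x)
  have e2 (x) : g₂ (i₂ x) = i₃ (f₂ x) := congr($h₂ x)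
  have := F₁.finite_ker
  have := F₃.finite_ker
  have := F₁.finite_coker
  have := F₃.finite_coker
  let a : LinearMap.ker i₁ →ₗ[k] LinearMap.ker i₂ := f₁.restrict (fun x hx => by
    rw [LinearMap.mem_ker] at *; rw [← e1, hx, map_zero])
  let b : LinearMap.ker i₂ →ₗ[k] LinearMap.ker i₃ := f₂.restrict (fun x hx => by
    rw [LinearMap.mem_ker] at *; rw [← e2, hx, map_zero])
  let c : (N₁ ⧸ LinearMap.range i₁) →ₗ[k] (N₂ ⧸ LinearMap.range i₂) :=
    Submodule.mapQ _ _ g₁ (by rintro _ ⟨x, rfl⟩; exact ⟨f₁ x, (e1 x).symm⟩)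
  let d : (N₂ ⧸ LinearMap.range i₂) →ₗ[k] (N₃ ⧸ LinearMap.range i₃) :=
    Submodule.mapQ _ _ g₂ (by rintro _ ⟨x, rfl⟩; exact ⟨f₂ x, (e2 x).symm⟩)
  -- The connecting map `ker i₃ → coker i₁`, which joins the kernels and cokernels into a six-term
  -- exact sequence `a, b, δ, c, d`.
  let δ := SnakeLemma.δ' i₁ i₂ i₃ f₁ f₂ hf g₁ g₂ hg h₁ h₂ (LinearMap.ker i₃).subtype
    (LinearMap.exact_subtype_ker_map i₃) (LinearMap.range i₁).mkQ
    (LinearMap.exact_map_mkQ_range i₁) hf₂ hg₁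
  have ha : Injective a := fun x y hxy => Subtype.ext (hf₁ congr(($hxy).1))
  have hab : Exact a b := by
    intro x
    constructor
    · intro hx
      obtain ⟨y, hy⟩ := (hf x.1).mp congr(($hx).1)
      refine ⟨⟨y, ?_⟩, Subtype.ext hy⟩
      rw [LinearMap.mem_ker]
      apply hg₁
      rw [e1, hy, map_zero]
      exact x.2
    · rintro ⟨y, rfl⟩
      exact Subtype.ext (hf.apply_apply_eq_zero y.1)
  have hbδ : Exact b δ := SnakeLemma.exact_δ'_right i₁ i₂ i₃ f₁ f₂ hf g₁ g₂ hg h₁ h₂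
    (LinearMap.ker i₂).subtype (LinearMap.exact_subtype_ker_map i₂) _ _ _ _ hf₂ hg₁ b rfl
    Subtype.val_injective
  have hδc : Exact δ c := SnakeLemma.exact_δ'_left i₁ i₂ i₃ f₁ f₂ hf g₁ g₂ hg h₁ h₂
    _ _ _ _ (LinearMap.range i₂).mkQ (LinearMap.exact_map_mkQ_range i₂) hf₂ hg₁ c rfl
    (Submodule.mkQ_surjective _)
  have hcd : Exact c d := by
    intro x
    constructor
    · obtain ⟨y, rfl⟩ := Submodule.mkQ_surjective _ x
      intro hx
      have hx' : (LinearMap.range i₃).mkQ (g₂ y) = 0 := hx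
      rw [Submodule.mkQ_apply, Submodule.Quotient.mk_eq_zero] at hx'
      obtain ⟨z, hz⟩ := hx'
      obtain ⟨w, rfl⟩ := hf₂ z
      rw [← e2] at hz
      obtain ⟨v, hv⟩ := (hg (y - i₂ w)).mp (by rw [map_sub, hz, sub_self])
      refine ⟨(LinearMap.range i₁).mkQ v, ?_⟩
      change (LinearMap.range i₂).mkQ (g₁ v) = _
      rw [hv, map_sub, sub_eq_self, Submodule.mkQ_apply, Submodule.Quotient.mk_eq_zero]
      exact ⟨w, rfl⟩
    · rintro ⟨y, rfl⟩
      obtain ⟨y, rfl⟩ := Submodule.mkQ_surjective _ y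
      change (LinearMap.range i₃).mkQ (g₂ (g₁ y)) = 0
      rw [hg.apply_apply_eq_zero, map_zero]
  have hd : Surjective d := by
    intro x
    obtain ⟨y, rfl⟩ := Submodule.mkQ_surjective _ x
    obtain ⟨z, rfl⟩ := hg₂ y
    exact ⟨(LinearMap.range i₂).mkQ z, rfl⟩
  have fk : Module.Finite k (LinearMap.ker i₂) := finite_of_exact a b hab
  have fc : Module.Finite k (N₂ ⧸ LinearMap.range i₂) := finite_of_exact c d hcd
  refine ⟨⟨fk, fc⟩, ?_⟩
  -- Each dimension is the sum of the ranks of the incoming and outgoing maps; the ranks cancel in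
  -- the alternating sum.
  have r1 := LinearMap.finrank_range_of_inj ha
  have r2 := finrank_eq_of_exact a b hab
  have r3 := finrank_eq_of_exact b δ hbδ
  have r4 := finrank_eq_of_exact δ c hδc
  have r5 := finrank_eq_of_exact c d hcd
  have r6 : Module.finrank k (LinearMap.range d) =
    Module.finrank k (N₃ ⧸ LinearMap.range i₃) :=
    by
    rw [LinearMap.range_eq_top.mpr hd, finrank_top]
  simp only [index]
  omega

end ExactSequences

/-! ### The cohomology of `𝒪(d)` on the projective line by Laurent polynomials. -/

section LaurentIndex

variable {k : Type*} [Field k]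

theorem coeff_C_mul_T (a : k) (m x : ℤ) :
    (LaurentPolynomial.C a * T m : k[T;T⁻¹]).coeff x = if m = x then a else 0 := by
  classical
  rw [← LaurentPolynomial.single_eq_C_mul_T, AddMonoidAlgebra.coeff_single, Finsupp.single_apply]

theorem coeff_T_mul (f : k[T;T⁻¹]) (m x : ℤ) : (T m * f).coeff x = f.coeff (x - m) := by
  induction f using LaurentPolynomial.induction_on' with
  | add p q hp hq => simp only [mul_add, AddMonoidAlgebra.coeff_add, Finsupp.add_apply, hp, hq]
  | C_mul_T n a =>
    rw [mul_left_comm, ← T_add, coeff_C_mul_T, coeff_C_mul_T]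
    split_ifs <;> first | rfl | omega

theorem coeff_toLaurent_apply (p : k[X]) (x : ℤ) :
    (toLaurent p).coeff x = if 0 ≤ x then p.coeff x.toNat else 0 := by
  induction p using Polynomial.induction_on' with
  | add p q hp hq =>
    simp only [map_add, AddMonoidAlgebra.coeff_add, Finsupp.add_apply, hp, hq, Polynomial.coeff_add]
    split_ifs <;> simp
  | monomial n a =>
    rw [← Polynomial.C_mul_X_pow_eq_monomial, toLaurent_C_mul_X_pow, coeff_C_mul_T,
      Polynomial.coeff_C_mul_X_pow]
    split_ifs <;> first | rfl | omega

theorem coeff_trunc (f : k[T;T⁻¹]) (n : ℕ) : (LaurentPolynomial.trunc f).coeff n = f.coeff n := by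
  induction f using LaurentPolynomial.induction_on' with
  | add p q hp hq => simp [hp, hq]
  | C_mul_T m a =>
    rw [LaurentPolynomial.trunc_C_mul_T, coeff_C_mul_T, apply_ite (fun p => Polynomial.coeff p n),
      Polynomial.coeff_monomial, Polynomial.coeff_zero]
    split_ifs <;> first | rfl | omega

theorem mem_range_toLaurent {f : k[T;T⁻¹]} (hf : ∀ x < 0, f.coeff x = 0) :
    toLaurent (LaurentPolynomial.trunc f) = f := by
  ext x
  rw [coeff_toLaurent_apply, coeff_trunc]
  split_ifs with h
  · rw [Int.toNat_of_nonneg h]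
  · exact (hf x (not_le.mp h)).symm

/-- The Čech differential of `𝒪(d)` on the projective line. -/
def lineDiff (k : Type*) [Field k] (d : ℤ) : (k[X] × k[X]) →ₗ[k] k[T;T⁻¹] :=
  toLaurentAlg.toLinearMap ∘ₗ LinearMap.fst k _ _ -
    LinearMap.mulLeft k (T d) ∘ₗ (LaurentPolynomial.invert (R := k)).toLinearMap ∘ₗ
      toLaurentAlg.toLinearMap ∘ₗ LinearMap.snd k _ _

theorem lineDiff_apply (d : ℤ) (p q : k[X]) :
    lineDiff k d (p, q) = toLaurent p - T d * LaurentPolynomial.invert (toLaurent q) := by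
  simp [lineDiff]

theorem coeff_lineDiff (d : ℤ) (p q : k[X]) (x : ℤ) :
    (lineDiff k d (p, q)).coeff x = (if 0 ≤ x then p.coeff x.toNat else 0) -
      (if x ≤ d then q.coeff (d - x).toNat else 0) := by
  rw [lineDiff_apply, AddMonoidAlgebra.coeff_sub, Finsupp.sub_apply, coeff_T_mul, invert_apply,
    coeff_toLaurent_apply, coeff_toLaurent_apply, neg_sub]
  simp only [sub_nonneg]

/-- Negative powers up to `T ^ d` are hit by the second chart. -/
theorem exists_invert_eq {d : ℤ} {f : k[T;T⁻¹]} (hf : ∀ x > d, f.coeff x = 0) :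
    ∃ q : k[X], T d * LaurentPolynomial.invert (toLaurent q) = f := by
  refine ⟨LaurentPolynomial.trunc (LaurentPolynomial.invert (T (-d) * f)), ?_⟩
  rw [mem_range_toLaurent, LaurentPolynomial.involutive_invert, ← mul_assoc, ← T_add, add_neg_cancel,
    T_zero, one_mul]
  intro x hx
  rw [invert_apply, coeff_T_mul]
  exact hf _ (by omega)

/-- In a cocycle `(p, q)` the polynomial `q` is `p` with its coefficients reversed, so the pair is
determined by `p`, which may be any polynomial of degree at most `d`. Truncation by `toNat` gives
the value `0` for negative `d`. -/
theorem finrank_ker_lineDiff (d : ℤ) : Module.Finite k (LinearMap.ker (lineDiff k d)) ∧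
    Module.finrank k (LinearMap.ker (lineDiff k d)) = (d + 1).toNat := by
  let φ : LinearMap.ker (lineDiff k d) →ₗ[k] Polynomial.degreeLT k (d + 1).toNat :=
    ((LinearMap.fst k _ _) ∘ₗ Submodule.subtype _).codRestrict _ (by
      rintro ⟨⟨p, q⟩, h⟩
      rw [Polynomial.mem_degreeLT, Polynomial.degree_lt_iff_coeff_zero]
      intro m hm
      have := coeff_lineDiff d p q m
      rw [LinearMap.mem_ker.mp h, if_pos (by omega), if_neg (by omega)] at this
      simpa using this.symm)
  have hφ : Bijective φ := by
    constructor
    · rw [injective_iff_map_eq_zero]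
      rintro ⟨⟨p, q⟩, h⟩ h0
      have hp : p = 0 := congr(($h0).1)
      subst hp
      have h1 : lineDiff k d (0, q) = 0 := h
      have : q = 0 := by
        ext m
        have := coeff_lineDiff d 0 q (d - m)
        rw [h1, if_pos (show d - (m : ℤ) ≤ d by omega)] at this
        simpa using this.symm
      simp [this]
    · rintro ⟨p, hp⟩
      rw [Polynomial.mem_degreeLT, Polynomial.degree_lt_iff_coeff_zero] at hp
      obtain ⟨q, hq⟩ := exists_invert_eq (d := d) (f := toLaurent p) (fun x hx => by
        rw [coeff_toLaurent_apply]
        split_ifs with h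
        · exact hp _ (by omega)
        · rfl)
      exact ⟨⟨(p, q), by rw [LinearMap.mem_ker, lineDiff_apply, hq, sub_self]⟩, rfl⟩
  let e := LinearEquiv.ofBijective φ hφ
  let e' := e.trans (Polynomial.degreeLTEquiv k _)
  exact ⟨Module.Finite.equiv e'.symm, by rw [e'.finrank_eq, Module.finrank_fin_fun]⟩

/-- The first chart produces the exponents `≥ 0` and the second the exponents `≤ d`. The cokernel
therefore records the `-d - 1` coefficients strictly in between, which the map `φ` reads off. -/
theorem finrank_coker_lineDiff (d : ℤ) :
    Module.Finite k (k[T;T⁻¹] ⧸ LinearMap.range (lineDiff k d)) ∧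
    Module.finrank k (k[T;T⁻¹] ⧸ LinearMap.range (lineDiff k d)) = (- d - 1).toNat := by
  let φ : k[T;T⁻¹] →ₗ[k] (Fin (- d - 1).toNat → k) := LinearMap.pi fun i =>
    { toFun := fun f => f.coeff (d + 1 + i)
      map_add' := fun _ _ => rfl
      map_smul' := fun _ _ => rfl }
  have hφ : Surjective φ := by
    intro v
    refine ⟨∑ i, LaurentPolynomial.C (v i) * T (d + 1 + i), ?_⟩
    ext j
    change (∑ i, LaurentPolynomial.C (v i) * T (d + 1 + i) : k[T;T⁻¹]).coeff (d + 1 + j) = v j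
    rw [AddMonoidAlgebra.coeff_sum, Finsupp.finsetSum_apply, Finset.sum_eq_single j]
    · rw [coeff_C_mul_T, if_pos rfl]
    · intro i _ hij
      rw [coeff_C_mul_T, if_neg]
      intro h
      exact hij (Fin.ext (by omega))
    · simp
  have hker : LinearMap.range (lineDiff k d) = LinearMap.ker φ := by
    apply le_antisymm
    · rintro _ ⟨⟨p, q⟩, rfl⟩
      ext i
      change (lineDiff k d (p, q)).coeff (d + 1 + i) = 0
      rw [coeff_lineDiff, if_neg (by omega), if_neg (by omega), sub_zero]
    · intro f hf
      have hf' (x : ℤ) (h1 : d < x) (h2 : x < 0) : f.coeff x = 0 := by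
        have := congr_fun hf ⟨(x - d - 1).toNat, by omega⟩
        change f.coeff (d + 1 + ((x - d - 1).toNat : ℤ)) = 0 at this
        rwa [show d + 1 + ((x - d - 1).toNat : ℤ) = x by omega] at this
      -- When the coefficients in the gap vanish, removing the part with nonnegative exponents
      -- leaves only exponents `≤ d`, all reached from the second chart.
      obtain ⟨q, hq⟩ := exists_invert_eq (d := d)
        (f := toLaurent (LaurentPolynomial.trunc f) - f) (fun x hx => by
          rw [AddMonoidAlgebra.coeff_sub, Finsupp.sub_apply, coeff_toLaurent_apply, coeff_trunc]
          split_ifs with h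
          · rw [Int.toNat_of_nonneg h, sub_self]
          · rw [hf' x hx (not_le.mp h), sub_zero])
      exact ⟨(LaurentPolynomial.trunc f, q), by rw [lineDiff_apply, hq, sub_sub_cancel]⟩
  rw [hker]
  let e := φ.quotKerEquivOfSurjective hφ
  exact ⟨Module.Finite.equiv e.symm, by rw [e.finrank_eq, Module.finrank_fin_fun]⟩

theorem isFredholm_lineDiff (d : ℤ) : IsFredholm (lineDiff k d) :=
  ⟨(finrank_ker_lineDiff d).1, (finrank_coker_lineDiff d).1⟩

theorem index_lineDiff (d : ℤ) : index (lineDiff k d) = d + 1 := by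
  rw [index, (finrank_ker_lineDiff d).2, (finrank_coker_lineDiff d).2]
  omega

end LaurentIndex

end RibbonCurve

/-! ### The algebra of a ribbon: square-zero thickenings of polynomial rings. -/

namespace RibbonCurve
open Polynomial LaurentPolynomial Function

/-- A surjection of `k`-algebras `ρ : A → B` whose kernel is a square-zero ideal which is free of
rank one over `B`, with a chosen basis: `ν p` is the multiple by `p` of the basis element. -/
structure FreeThickening (k A B : Type*) [Field k] [CommRing A] [CommRing B] [Algebra k A]
    [Algebra k B] where
  /-- the surjection -/
  ρ : A →ₐ[k] B
  /-- the parametrization of the kernel -/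
  ν : B →ₗ[k] A
  surjective : Surjective ρ
  injective : Injective ν
  exact : Exact ν ρ
  mul_ν : ∀ a p, a * ν p = ν (ρ a * p)

namespace FreeThickening

variable {k A B : Type*} [Field k] [CommRing A] [CommRing B] [Algebra k A] [Algebra k B]
  (F : FreeThickening k A B)

@[simp]
theorem ρ_ν (p : B) : F.ρ (F.ν p) = 0 := F.exact.apply_apply_eq_zero p

theorem exists_ν {a : A} (h : F.ρ a = 0) : ∃ p, F.ν p = a := (F.exact a).mp h

@[simp]
theorem ν_mul_ν (p q : B) : F.ν p * F.ν q = 0 := by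
  rw [F.mul_ν, F.ρ_ν, zero_mul, map_zero]

/-- Lifting the inverse gives `a b = 1 + ν p`, and `(1 + ν p)(1 - ν p) = 1` because the kernel has
square zero. -/
theorem isUnit_of_isUnit {a : A} (h : IsUnit (F.ρ a)) : IsUnit a := by
  obtain ⟨v, hv⟩ := h
  obtain ⟨b, hb⟩ := F.surjective (v⁻¹ : Bˣ)
  obtain ⟨p, hp⟩ := F.exists_ν (a := a * b - 1) (by
    rw [map_sub, map_mul, ← hv, hb, Units.mul_inv, map_one, sub_self])
  have : a * (b * (1 - F.ν p)) = 1 := by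
    have h1 : a * b = 1 + F.ν p := by rw [hp]; ring
    rw [← mul_assoc, h1]
    have := F.ν_mul_ν p p
    linear_combination - this
  exact IsUnit.of_mul_eq_one _ this

end FreeThickening

/-- The algebra underlying a ribbon: functions on the two charts and on their intersection. -/
structure RibbonAlgebra (k A₀ A₁ R : Type*) [Field k] [CommRing A₀] [CommRing A₁] [CommRing R]
    [Algebra k A₀] [Algebra k A₁] [Algebra k R] where
  F₀ : FreeThickening k A₀ k[X]
  F₁ : FreeThickening k A₁ k[X]
  F : FreeThickening k R k[T;T⁻¹]
  r₀ : A₀ →ₐ[k] R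
  r₁ : A₁ →ₐ[k] R
  /-- the degree of the conormal line bundle -/
  e : ℤ
  ρ_r₀ : ∀ a, F.ρ (r₀ a) = toLaurent (F₀.ρ a)
  ρ_r₁ : ∀ a, F.ρ (r₁ a) = LaurentPolynomial.invert (toLaurent (F₁.ρ a))
  r₀_ν : ∀ p, r₀ (F₀.ν p) = F.ν (toLaurent p)
  r₁_ν : ∀ p, r₁ (F₁.ν p) = F.ν (T e * LaurentPolynomial.invert (toLaurent p))

/-! ### Line bundles on a ribbon: the dimension bound and the case of equality. -/

namespace RibbonAlgebra

variable {k A₀ A₁ R : Type*} [Field k] [CommRing A₀] [CommRing A₁] [CommRing R]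
  [Algebra k A₀] [Algebra k A₁] [Algebra k R] (D : RibbonAlgebra k A₀ A₁ R)

/-- The Čech differential of the line bundle with transition function `u`. -/
def diff (u : R) : (A₀ × A₁) →ₗ[k] R :=
  D.r₀.toLinearMap ∘ₗ LinearMap.fst k _ _ -
    LinearMap.mulLeft k u ∘ₗ D.r₁.toLinearMap ∘ₗ LinearMap.snd k _ _

theorem diff_apply (u : R) (a : A₀) (b : A₁) : D.diff u (a, b) = D.r₀ a - u * D.r₁ b := by
  simp [diff]

theorem ρ_diff {u : R} {d : ℤ} (hu : D.F.ρ u = T d) (a : A₀) (b : A₁) :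
    D.F.ρ (D.diff u (a, b)) = lineDiff k d (D.F₀.ρ a, D.F₁.ρ b) := by
  rw [diff_apply, map_sub, map_mul, hu, D.ρ_r₀, D.ρ_r₁, lineDiff_apply]

/-- Multiplication by `u` on the kernel depends only on its reduction `T d`, and the generators of
the kernel contribute a further `T e`. So the subcomplex is that of `𝒪(d + e)`. -/
theorem diff_ν {u : R} {d : ℤ} (hu : D.F.ρ u = T d) (p q : k[X]) :
    D.diff u (D.F₀.ν p, D.F₁.ν q) = D.F.ν (lineDiff k (d + D.e) (p, q)) := by
  rw [diff_apply, D.r₀_ν, D.r₁_ν, D.F.mul_ν, hu, lineDiff_apply, map_sub, T_add, mul_assoc]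

/-- Riemann-Roch on the ribbon: the Čech complex is an extension of that of `𝒪(d)` by that of `𝒪(d +
e)`. -/
theorem index_diff {u : R} {d : ℤ} (hu : D.F.ρ u = T d) :
    IsFredholm (D.diff u) ∧ index (D.diff u) = (d + D.e + 1) + (d + 1) := by
  rw [← index_lineDiff (k := k) d, ← index_lineDiff (k := k) (d + D.e)]
  refine index_eq_of_exact (lineDiff k (d + D.e)) (D.diff u) (lineDiff k d)
    (D.F₀.ν.prodMap D.F₁.ν) (D.F₀.ρ.toLinearMap.prodMap D.F₁.ρ.toLinearMap)
    ?_ ?_ ?_ D.F.ν D.F.ρ.toLinearMap D.F.injective D.F.exact D.F.surjective ?_ ?_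
    (isFredholm_lineDiff _) (isFredholm_lineDiff _)
  · exact D.F₀.injective.prodMap D.F₁.injective
  · rintro ⟨a, b⟩
    constructor
    · intro h
      obtain ⟨p, hp⟩ := D.F₀.exists_ν congr(($h).1)
      obtain ⟨q, hq⟩ := D.F₁.exists_ν congr(($h).2)
      exact ⟨(p, q), Prod.ext hp hq⟩
    · rintro ⟨⟨p, q⟩, h⟩
      rw [← h]
      exact Prod.ext (D.F₀.ρ_ν p) (D.F₁.ρ_ν q)
  · exact D.F₀.surjective.prodMap D.F₁.surjective
  · exact LinearMap.ext fun ⟨p, q⟩ => (D.diff_ν hu p q).symm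
  · exact LinearMap.ext fun ⟨a, b⟩ => D.ρ_diff hu a b

/-- Restriction of global sections to the reduced curve. -/
def kerMap {u : R} {d : ℤ} (hu : D.F.ρ u = T d) :
    LinearMap.ker (D.diff u) →ₗ[k] LinearMap.ker (lineDiff k d) :=
  (D.F₀.ρ.toLinearMap.prodMap D.F₁.ρ.toLinearMap).restrict (by
    rintro ⟨a, b⟩ h
    have := D.ρ_diff hu a b
    rw [LinearMap.mem_ker.mp h, map_zero] at this
    exact this.symm)

/-- A section vanishing on the reduced curve comes from `H⁰(𝒪(d + e))`, which is zero in negative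
degree. -/
theorem kerMap_injective {u : R} {d : ℤ} (hu : D.F.ρ u = T d) (hd : d + D.e < 0) :
    Injective (D.kerMap hu) := by
  rw [injective_iff_map_eq_zero]
  rintro ⟨⟨a, b⟩, hab⟩ h
  obtain ⟨p, rfl⟩ := D.F₀.exists_ν congr(($h).1.1)
  obtain ⟨q, rfl⟩ := D.F₁.exists_ν congr(($h).1.2)
  have h1 := D.diff_ν hu p q
  rw [LinearMap.mem_ker.mp hab, eq_comm, map_eq_zero_iff _ D.F.injective] at h1
  have h2 := finrank_ker_lineDiff (k := k) (d + D.e)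
  rw [show (d + D.e + 1).toNat = 0 by omega] at h2
  have := h2.1
  have h3 := Module.finrank_zero_iff.mp h2.2
  have h4 := congr(($(h3.elim ⟨(p, q), h1⟩ 0)).1)
  obtain ⟨rfl, rfl⟩ := Prod.mk.inj h4
  simp

theorem finrank_ker_diff_le {u : R} {n : ℕ} (hu : D.F.ρ u = T n) (hd : n + D.e < 0) :
    Module.finrank k (LinearMap.ker (D.diff u)) ≤ n + 1 := by
  have h := finrank_ker_lineDiff (k := k) n
  have := h.1
  have h1 := LinearMap.finrank_le_finrank_of_injective (D.kerMap_injective hu hd)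
  rw [h.2] at h1
  omega

/-- With equal dimensions the injective restriction to the reduced curve is surjective, so every
monomial of degree `n` lifts to a section. -/
theorem exists_sections {u : R} {n : ℕ} (hu : D.F.ρ u = T n) (hd : n + D.e < 0)
    (h : Module.finrank k (LinearMap.ker (D.diff u)) = n + 1) (j : ℕ) (hj : j ≤ n) :
    ∃ a b, D.r₀ a = u * D.r₁ b ∧ D.F₀.ρ a = X ^ j ∧ D.F₁.ρ b = X ^ (n - j) := by
  have hl := finrank_ker_lineDiff (k := k) n
  have := hl.1
  have := (D.index_diff hu).1.finite_ker
  have hsurj : Surjective (D.kerMap hu) := by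
    rw [← LinearMap.injective_iff_surjective_of_finrank_eq_finrank]
    · exact D.kerMap_injective hu hd
    · rw [h, hl.2]; omega
  -- The two local expressions of the monomial `x₀ ^ (n - j) x₁ ^ j`.
  obtain ⟨⟨⟨a, b⟩, hab⟩, h2⟩ := hsurj ⟨(X ^ j, X ^ (n - j)), by
    rw [LinearMap.mem_ker, lineDiff_apply, toLaurent_X_pow, toLaurent_X_pow, invert_T, ← T_add,
      sub_eq_zero]
    congr 1
    omega⟩
  refine ⟨a, b, ?_, congr(($h2).1.1), congr(($h2).1.2)⟩
  rw [LinearMap.mem_ker, diff_apply, sub_eq_zero] at hab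
  exact hab

/-- If enough consecutive Laurent tails vanish, both coefficient series vanish. -/
theorem eq_zero_of_tails {n : ℕ} (hn : 1 ≤ n) {e : ℤ} (he : n + e ≤ -3) {φ h : k[T;T⁻¹]}
    (p q : ℕ → k[X]) (hp₀ : p 0 = 0) (hp₁ : p 1 = 0) (hq₀ : q n = 0) (hq₁ : q (n - 1) = 0)
    (H : ∀ j ≤ n, T j * (φ + ((n - j : ℕ) : k[T;T⁻¹]) * h) = lineDiff k (n + e) (p j, q j)) :
    φ = 0 ∧ h = 0 := by
  -- Compare coefficients at `f + j`, so that the same coefficients of `φ` and `h` occur for every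
  -- `j`.
  have key (f : ℤ) (j : ℕ) (hj : j ≤ n) :
      φ.coeff f + ((n - j : ℕ) : k) * h.coeff f =
        (if 0 ≤ f + j then (p j).coeff (f + j).toNat else 0) -
        (if f + j ≤ n + e then (q j).coeff (n + e - (f + j)).toNat else 0) := by
    have := congr(($(H j hj)).coeff (f + j))
    rw [coeff_T_mul, coeff_lineDiff, add_sub_cancel_right, AddMonoidAlgebra.coeff_add,
      Finsupp.add_apply, ← nsmul_eq_mul, AddMonoidAlgebra.coeff_smul, Finsupp.smul_apply,
      nsmul_eq_mul] at this
    exact this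
  -- For each exponent it suffices to find two consecutive `j` with vanishing right-hand side: the
  -- two linear equations then determine `φ.coeff f` and `h.coeff f`.
  have main (f : ℤ) : φ.coeff f = 0 ∧ h.coeff f = 0 := by
    obtain ⟨j, hj, h1, h2⟩ : ∃ j : ℕ, j + 1 ≤ n ∧
        φ.coeff f + ((n - j : ℕ) : k) * h.coeff f = 0 ∧
        φ.coeff f + ((n - (j + 1) : ℕ) : k) * h.coeff f = 0 := by
      rcases lt_or_ge (n + e) f with hf | hf
      -- Large exponents: take `j = 0, 1`, where `p` vanishes by hypothesis and `q` does not reach.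
      · refine ⟨0, by omega, ?_, ?_⟩
        · rw [key f 0 (by omega), hp₀, if_neg (show ¬ (f + (0 : ℕ) ≤ n + e) by omega)]
          simp
        · rw [key f (0 + 1) (by omega), zero_add, hp₁,
            if_neg (show ¬ (f + (1 : ℕ) ≤ n + e) by omega)]
          simp
      · rcases lt_or_ge f (-n) with hf' | hf'
        -- Small exponents: take `j = n - 1, n`, where `q` vanishes by hypothesis and `p` does not
        -- reach.
        · refine ⟨n - 1, by omega, ?_, ?_⟩
          · rw [key f (n - 1) (by omega), hq₁, if_neg (by omega)]
            simp
          · rw [show n - 1 + 1 = n by omega, key f n (by omega), hq₀, if_neg (by omega)]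
            simp
        -- Middle exponents: `j = -f - 2` and `j = -f - 1` move `f` to `-2` and `-1`. Both lie in
        -- the gap between `n + e` and `0` exactly because `n + e ≤ -3`.
        · refine ⟨(- f - 2).toNat, by omega, ?_, ?_⟩
          · rw [key f _ (by omega), if_neg (by omega), if_neg (by omega), sub_zero]
          · rw [key f _ (by omega), if_neg (by omega), if_neg (by omega), sub_zero]
    -- Consecutive weights of `h` differ by `1`, so subtracting the two equations isolates `h.coeff
    -- f`.
    have h3 : ((n - j : ℕ) : k) = ((n - (j + 1) : ℕ) : k) + 1 := by
      rw [show n - j = (n - (j + 1)) + 1 by omega]; push_cast; rfl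
    have h4 : h.coeff f = 0 := by
      rw [h3] at h1
      linear_combination h1 - h2
    rw [h4, mul_zero, add_zero] at h1
    exact ⟨h1, h4⟩
  exact ⟨LaurentPolynomial.ext fun f => (main f).1, LaurentPolynomial.ext fun f => (main f).2⟩

theorem one_add_ν_pow {A B : Type*} [CommRing A] [CommRing B] [Algebra k A] [Algebra k B]
    (F : FreeThickening k A B) (p : B) (m : ℕ) :
    (1 + F.ν p) ^ m = 1 + F.ν ((m : B) * p) := by
  induction m with
  | zero => simp
  | succ m ih =>
    rw [pow_succ, ih]
    have := F.ν_mul_ν ((m : B) * p) p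
    push_cast
    rw [add_mul (m : B), one_mul, map_add]
    linear_combination this

/-- The lift `t = a 1` is compared with the other sections to first order. All deviations lie in the
square-zero kernel, so the multiplicative gluing relations become the linear ones of
`eq_zero_of_tails`. -/
theorem splitting_of_normalized_sections {u : R} {n : ℕ} (hn : 1 ≤ n) (hu : D.F.ρ u = T n)
    (he : n + D.e ≤ -3) (a : ℕ → A₀) (b : ℕ → A₁)
    (hab : ∀ j ≤ n, D.r₀ (a j) = u * D.r₁ (b j)) (ha : ∀ j ≤ n, D.F₀.ρ (a j) = X ^ j)
    (hb : ∀ j ≤ n, D.F₁.ρ (b j) = X ^ (n - j)) (ha₀ : a 0 = 1) (hbn : b n = 1) :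
    D.r₀ (a 1) * D.r₁ (b (n - 1)) = 1 ∧ u = D.r₀ (a 1) ^ n := by
  set t := a 1 with ht
  set s := b (n - 1) with hs
  have hρt : D.F.ρ (D.r₀ t) = T 1 := by
    rw [D.ρ_r₀, ht, ha 1 hn, pow_one, toLaurent_X]
  have hρs : D.F.ρ (D.r₁ s) = T (-1) := by
    rw [D.ρ_r₁, hs, hb _ (by omega), show n - (n - 1) = 1 by omega, pow_one, toLaurent_X, invert_T]
  obtain ⟨τ, hτ⟩ : IsUnit (D.r₀ t) := D.F.isUnit_of_isUnit (by rw [hρt]; exact isUnit_T 1)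
  have hτi : D.F.ρ (τ⁻¹ : Rˣ) = T (-1) := by
    have h1 : D.F.ρ (τ⁻¹ : Rˣ) * T 1 = 1 := by
      rw [← hρt, ← hτ, ← map_mul, Units.inv_mul, map_one]
    calc D.F.ρ (τ⁻¹ : Rˣ) = D.F.ρ (τ⁻¹ : Rˣ) * T 1 * T (-1) := by rw [mul_T_assoc]; simp
      _ = _ := by rw [h1, one_mul]
  have hρτ : D.F.ρ (τ : R) = T 1 := by rw [hτ, hρt]
  -- Here `1 + ν h` measures the failure of `t s = 1`, and `1 + ν φ` below the failure of `u = t ^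
  -- n`; both must be shown trivial.
  obtain ⟨h, hh⟩ := D.F.exists_ν (a := τ * D.r₁ s - 1) (by
    rw [map_sub, map_mul, hρs, hρτ, ← T_add]; simp)
  obtain ⟨φ, hφ⟩ := D.F.exists_ν (a := (τ⁻¹ : Rˣ) ^ n * u - 1) (by
    rw [map_sub, map_mul, hu, map_pow, hτi, T_pow, ← T_add]; simp)
  have hs' : D.r₁ s = (τ⁻¹ : Rˣ) * (1 + D.F.ν h) := by
    rw [hh, add_sub_cancel, Units.inv_mul_cancel_left]
  have hinv (m : ℕ) : (τ : R) ^ m * ((τ⁻¹ : Rˣ) : R) ^ m = 1 := by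
    rw [← mul_pow, Units.mul_inv, one_pow]
  have hu' : u = (τ : R) ^ n * (1 + D.F.ν φ) := by
    rw [hφ, add_sub_cancel, ← mul_assoc, hinv, one_mul]
  -- The guard `j ≤ n` is inside the existential so that `choose` yields a function on all of `ℕ`;
  -- beyond `n` the value `0` is arbitrary.
  have hp (j : ℕ) : ∃ p, j ≤ n → D.F₀.ν p = a j - t ^ j := by
    by_cases hj : j ≤ n
    · obtain ⟨p, hp⟩ := D.F₀.exists_ν (a := a j - t ^ j) (by
        rw [map_sub, map_pow, ha j hj, ht, ha 1 hn, pow_one, sub_self])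
      exact ⟨p, fun _ => hp⟩
    · exact ⟨0, fun h => absurd h hj⟩
  have hq (j : ℕ) : ∃ q, j ≤ n → D.F₁.ν q = b j - s ^ (n - j) := by
    by_cases hj : j ≤ n
    · obtain ⟨q, hq⟩ := D.F₁.exists_ν (a := b j - s ^ (n - j)) (by
        rw [map_sub, map_pow, hb j hj, hs, hb _ (by omega), show n - (n - 1) = 1 by omega, pow_one,
          sub_self])
      exact ⟨q, fun _ => hq⟩
    · exact ⟨0, fun h => absurd h hj⟩
  choose p hp using hp
  choose q hq using hq
  have z₀ {x : k[X]} (hx : D.F₀.ν x = 0) : x = 0 := (map_eq_zero_iff _ D.F₀.injective).mp hx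
  have z₁ {x : k[X]} (hx : D.F₁.ν x = 0) : x = 0 := (map_eq_zero_iff _ D.F₁.injective).mp hx
  -- The four required vanishings come from `a 0 = 1`, `a 1 = t`, `b n = 1` and `b (n - 1) = s`.
  obtain ⟨rfl, rfl⟩ := eq_zero_of_tails hn he (φ := φ) (h := h) p q
    (z₀ (by rw [hp 0 (by omega), ha₀, pow_zero, sub_self]))
    (z₀ (by rw [hp 1 hn, pow_one, sub_self]))
    (z₁ (by rw [hq n le_rfl, hbn, Nat.sub_self, pow_zero, sub_self]))
    (z₁ (by rw [hq _ (by omega), show n - (n - 1) = 1 by omega, pow_one, sub_self]))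
    (by
      intro j hj
      apply D.F.injective
      have e1 := hab j hj
      -- Expand `a j = u * b j` in terms of `τ`. The leading terms are both `τ ^ j`, and products of
      -- two elements of the kernel vanish.
      rw [show a j = t ^ j + D.F₀.ν (p j) by rw [hp j hj]; ring,
        show b j = s ^ (n - j) + D.F₁.ν (q j) by rw [hq j hj]; ring, map_add, map_add, map_pow,
        map_pow, D.r₀_ν, D.r₁_ν, mul_add, D.F.mul_ν, hu, hs', mul_pow, one_add_ν_pow, ← hτ,
        hu'] at e1
      have e2 : (τ : R) ^ n * ((τ⁻¹ : Rˣ) : R) ^ (n - j) = τ ^ j := by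
        have h3 : (τ : R) ^ n = τ ^ j * τ ^ (n - j) := by rw [← pow_add]; congr 1; omega
        rw [h3, mul_assoc, hinv, mul_one]
      have e3 : D.F.ν (T j * (φ + ((n - j : ℕ) : k[T;T⁻¹]) * h)) =
          (τ : R) ^ j * D.F.ν (φ + ((n - j : ℕ) : k[T;T⁻¹]) * h) := by
        rw [D.F.mul_ν, map_pow, hρτ, T_pow, mul_one]
      rw [e3, lineDiff_apply, map_sub, T_add, mul_assoc, map_add]
      have e4 := D.F.ν_mul_ν φ (((n - j : ℕ) : k[T;T⁻¹]) * h)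
      linear_combination -e1 - (1 + D.F.ν φ) * (1 + D.F.ν (((n - j : ℕ) : k[T;T⁻¹]) * h)) * e2 -
        (τ : R) ^ j * e4)
  constructor
  · rw [← hτ, ← sub_eq_zero, ← hh, map_zero]
  · rw [hu', map_zero, add_zero, mul_one, hτ]

/-- The sections lifting `x₀ ^ n` and `x₁ ^ n` generate the bundle on the first and second chart
respectively. Using them as generators reduces to the normalized case; `v₀` and `v₁` record this
change. -/
theorem exists_splitting {u : R} {n : ℕ} (hn : 1 ≤ n) (hu : D.F.ρ u = T n)
    (he : n + D.e ≤ -3) (h : Module.finrank k (LinearMap.ker (D.diff u)) = n + 1) :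
    ∃ (t : A₀) (s : A₁) (v₀ : A₀ˣ) (v₁ : A₁ˣ), D.F₀.ρ t = X ∧ D.F₁.ρ s = X ∧
      D.r₀ t * D.r₁ s = 1 ∧ u * D.r₁ v₁ = D.r₀ t ^ n * D.r₀ v₀ := by
  have hex (j : ℕ) : ∃ a b, j ≤ n →
      D.r₀ a = u * D.r₁ b ∧ D.F₀.ρ a = X ^ j ∧ D.F₁.ρ b = X ^ (n - j) := by
    by_cases hj : j ≤ n
    · obtain ⟨a, b, hab⟩ := D.exists_sections hu (by omega) h j hj
      exact ⟨a, b, fun _ => hab⟩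
    · exact ⟨0, 0, fun h => absurd h hj⟩
  choose a b hab using hex
  obtain ⟨v₀, hv₀⟩ : IsUnit (a 0) := D.F₀.isUnit_of_isUnit (by
    rw [(hab 0 (by omega)).2.1, pow_zero]; exact isUnit_one)
  obtain ⟨v₁, hv₁⟩ : IsUnit (b n) := D.F₁.isUnit_of_isUnit (by
    rw [(hab n (by omega)).2.2, Nat.sub_self, pow_zero]; exact isUnit_one)
  have i₀ : D.F₀.ρ (v₀⁻¹ : A₀ˣ) = 1 := by
    have h1 : D.F₀.ρ (v₀⁻¹ : A₀ˣ) * D.F₀.ρ v₀ = 1 := by rw [← map_mul, Units.inv_mul, map_one]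
    rwa [hv₀, (hab 0 (by omega)).2.1, pow_zero, mul_one] at h1
  have i₁ : D.F₁.ρ (v₁⁻¹ : A₁ˣ) = 1 := by
    have h1 : D.F₁.ρ (v₁⁻¹ : A₁ˣ) * D.F₁.ρ v₁ = 1 := by rw [← map_mul, Units.inv_mul, map_one]
    rwa [hv₁, (hab n (by omega)).2.2, Nat.sub_self, pow_zero, mul_one] at h1
  have j₀ : D.r₀ v₀ * D.r₀ (v₀⁻¹ : A₀ˣ) = 1 := by rw [← map_mul, Units.mul_inv, map_one]
  have j₁ : D.r₁ v₁ * D.r₁ (v₁⁻¹ : A₁ˣ) = 1 := by rw [← map_mul, Units.mul_inv, map_one]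
  have k₀ : D.F.ρ (D.r₀ (v₀⁻¹ : A₀ˣ)) = 1 := by rw [D.ρ_r₀, i₀, map_one]
  have k₁ : D.F.ρ (D.r₁ v₁) = 1 := by
    rw [D.ρ_r₁, hv₁, (hab n (by omega)).2.2, Nat.sub_self, pow_zero, map_one, map_one]
  -- The transition function for the new generators. Both units reduce to `1`, so it still reduces
  -- to `T n`.
  obtain ⟨h1, h2⟩ := D.splitting_of_normalized_sections (u := u * D.r₁ v₁ * D.r₀ (v₀⁻¹ : A₀ˣ)) hn
    (by rw [map_mul, map_mul, hu, k₀, k₁, mul_one, mul_one]) he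
    (fun j => a j * (v₀⁻¹ : A₀ˣ)) (fun j => b j * (v₁⁻¹ : A₁ˣ))
    (fun j hj => by
      rw [map_mul, map_mul, (hab j hj).1]
      linear_combination -(u * D.r₁ (b j) * D.r₀ (v₀⁻¹ : A₀ˣ)) * j₁)
    (fun j hj => by rw [map_mul, i₀, (hab j hj).2.1, mul_one])
    (fun j hj => by rw [map_mul, i₁, (hab j hj).2.2, mul_one])
    (by simp only [← hv₀, Units.mul_inv]) (by simp only [← hv₁, Units.mul_inv])
  refine ⟨_, _, v₀, v₁, ?_, ?_, h1, ?_⟩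
  · rw [map_mul, i₀, (hab 1 hn).2.1, mul_one, pow_one]
  · rw [map_mul, i₁, (hab _ (by omega)).2.2, mul_one, show n - (n - 1) = 1 by omega, pow_one]
  · rw [← h2]
    linear_combination -(u * D.r₁ v₁) * j₀

end RibbonAlgebra

end RibbonCurve

namespace RibbonCurve
open Function

/-! ### Sections over open sets -/

section Restriction

variable {X : Scheme.{u}}

/-- Restriction of sections of a sheaf of modules. -/
def resM (M : X.Modules) {W V : X.Opens} (h : W ≤ V) : Γ(M, V) →+ Γ(M, W) :=
  (M.presheaf.map (homOfLE h).op).hom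

theorem resM_resM (M : X.Modules) {W V T : X.Opens} (h : W ≤ V) (h' : V ≤ T) (x : Γ(M, T)) :
    resM M h (resM M h' x) = resM M (h.trans h') x := by
  have := congr($(M.presheaf.map_comp (homOfLE h').op (homOfLE h).op) x)
  exact this.symm

theorem resM_self (M : X.Modules) {W : X.Opens} (h : W ≤ W) (x : Γ(M, W)) :
    resM M h x = x := by
  have := congr($(M.presheaf.map_id (op W)) x)
  exact this

theorem resM_smul (M : X.Modules) {W V : X.Opens} (h : W ≤ V) (r : Γ(X, V)) (x : Γ(M, V)) :
    resM M h (r • x) = resO h r • resM M h x :=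
  Scheme.Modules.map_smul M (homOfLE h) r x

theorem resO_eq_of_sup {D E H : X.Opens} (hD : D ≤ H) (hE : E ≤ H) (hH : H ≤ D ⊔ E)
    {a b : Γ(X, H)} (h₁ : resO hD a = resO hD b) (h₂ : resO hE a = resO hE b) : a = b := by
  refine X.sheaf.eq_of_locally_eq₂ (homOfLE hD) (homOfLE hE) hH a b h₁ h₂

theorem resM_eq_of_sup (M : X.Modules) {D E H : X.Opens} (hD : D ≤ H) (hE : E ≤ H)
    (hH : H ≤ D ⊔ E) {a b : Γ(M, H)} (h₁ : resM M hD a = resM M hD b)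
    (h₂ : resM M hE a = resM M hE b) : a = b :=
  TopCat.Sheaf.eq_of_locally_eq₂ ⟨M.presheaf, M.isSheaf⟩ (homOfLE hD) (homOfLE hE) hH a b h₁ h₂

theorem exists_resO_of_sup {D E H : X.Opens} (hD : D ≤ H) (hE : E ≤ H) (hH : H ≤ D ⊔ E)
    {a : Γ(X, D)} {b : Γ(X, E)}
    (h : resO (inf_le_left : D ⊓ E ≤ D) a = resO (inf_le_right : D ⊓ E ≤ E) b) :
    ∃ s : Γ(X, H), resO hD s = a ∧ resO hE s = b := by
  let U : Bool → X.Opens := fun i => bif i then D else E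
  let s : (i : Bool) → Γ(X, U i) := fun i => match i with
    | true => a
    | false => b
  obtain ⟨t, ht, -⟩ := X.sheaf.existsUnique_gluing' U H
    (fun i => homOfLE (by cases i <;> assumption))
    (hH.trans (sup_le (le_iSup U true) (le_iSup U false))) s (by
      rintro (_ | _) (_ | _)
      · rfl
      · have := congr(resO (inf_comm E D).le $h)
        rw [resO_resO, resO_resO] at this
        exact this.symm
      · exact h
      · rfl)
  exact ⟨t, ht true, ht false⟩

theorem exists_resM_of_sup (M : X.Modules) {D E H : X.Opens} (hD : D ≤ H) (hE : E ≤ H)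
    (hH : H ≤ D ⊔ E) {a : Γ(M, D)} {b : Γ(M, E)}
    (h : resM M (inf_le_left : D ⊓ E ≤ D) a = resM M (inf_le_right : D ⊓ E ≤ E) b) :
    ∃ s : Γ(M, H), resM M hD s = a ∧ resM M hE s = b := by
  let U : Bool → X.Opens := fun i => bif i then D else E
  let s : (i : Bool) → Γ(M, U i) := fun i => match i with
    | true => a
    | false => b
  obtain ⟨t, ht, -⟩ := TopCat.Sheaf.existsUnique_gluing' ⟨M.presheaf, M.isSheaf⟩ U H
    (fun i => homOfLE (by cases i <;> assumption))
    (hH.trans (sup_le (le_iSup U true) (le_iSup U false))) s (by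
      rintro (_ | _) (_ | _)
      · rfl
      · have := congr(resM M (inf_comm E D).le $h)
        rw [resM_resM, resM_resM] at this
        exact this.symm
      · exact h
      · rfl)
  exact ⟨t, ht true, ht false⟩

theorem isUnit_of_basicOpen_eq {W : X.Opens} {a : Γ(X, W)} (h : X.basicOpen a = W) : IsUnit a := by
  have h1 := RingedSpace.isUnit_res_basicOpen X.toRingedSpace a
  have h2 : IsUnit (resO (X.basicOpen_le a) a) := h1
  have h3 := h2.map (resO h.ge)
  rwa [resO_resO, resO_self] at h3

theorem basicOpen_resO {W V : X.Opens} (h : W ≤ V) (a : Γ(X, V)) :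
    X.basicOpen (resO h a) = W ⊓ X.basicOpen a :=
  X.basicOpen_res a (homOfLE h).op

theorem exists_resO_eq_pow_mul {V W : X.Opens} (hV : IsAffineOpen V) (f : Γ(X, V))
    (hW : W = X.basicOpen f) (h : W ≤ V) (c : Γ(X, W)) :
    ∃ (n : ℕ) (a : Γ(X, V)), resO h a = resO h f ^ n * c := by
  let := (X.presheaf.map (homOfLE h).op).hom.toAlgebra
  have := hV.isLocalization_of_eq_basicOpen f (homOfLE h) hW
  obtain ⟨n, a, ha⟩ := IsLocalization.Away.surj f c
  exact ⟨n, a, by rw [mul_comm]; exact ha.symm⟩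

theorem exists_pow_mul_eq_zero {V W : X.Opens} (hV : IsAffineOpen V) (f : Γ(X, V))
    (hW : W = X.basicOpen f) (h : W ≤ V) {a : Γ(X, V)} (ha : resO h a = 0) :
    ∃ n : ℕ, f ^ n * a = 0 := by
  let := (X.presheaf.map (homOfLE h).op).hom.toAlgebra
  have := hV.isLocalization_of_eq_basicOpen f (homOfLE h) hW
  have h1 : algebraMap Γ(X, V) Γ(X, W) a = 0 := ha
  obtain ⟨⟨_, n, rfl⟩, hn⟩ := (IsLocalization.map_eq_zero_iff (Submonoid.powers f) _ a).mp h1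
  exact ⟨n, hn⟩

end Restriction

/-! ### Square-zero thickenings -/

section Thickening

variable {X Z : Scheme.{u}} (i : Z ⟶ X)

/-- Restriction of functions along a morphism. -/
def pb (W : X.Opens) : Γ(X, W) →+* Γ(Z, i ⁻¹ᵁ W) := (i.app W).hom

theorem pb_resO {W V : X.Opens} (h : W ≤ V) (a : Γ(X, V)) :
    pb i W (resO h a) = resO (i.preimage_mono h) (pb i V a) :=
  congr($(i.naturality (homOfLE h).op) a)

theorem preimage_basicOpen_pb {W : X.Opens} (a : Γ(X, W)) :
    i ⁻¹ᵁ X.basicOpen a = Z.basicOpen (pb i W a) :=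
  Scheme.preimage_basicOpen i a

/-- A closed immersion which is a homeomorphism, defined by an ideal sheaf of square zero. -/
structure IsThickening : Prop where
  isClosedImmersion : IsClosedImmersion i
  surjective : Function.Surjective i
  sq_zero : ∀ (W : X.Opens) (a b : Γ(X, W)), pb i W a = 0 → pb i W b = 0 → a * b = 0

namespace IsThickening

variable {i} (hi : IsThickening i)
include hi

theorem preimage_le_iff {D E : X.Opens} : i ⁻¹ᵁ D ≤ i ⁻¹ᵁ E ↔ D ≤ E := by
  refine ⟨fun h x hx => ?_, fun h => i.preimage_mono h⟩
  obtain ⟨z, rfl⟩ := hi.surjective x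
  exact h hx

theorem preimage_inj {D E : X.Opens} : i ⁻¹ᵁ D = i ⁻¹ᵁ E ↔ D = E := by
  simp only [le_antisymm_iff, hi.preimage_le_iff]

theorem exists_preimage_eq (W : Z.Opens) : ∃ D : X.Opens, i ⁻¹ᵁ D = W := by
  have := hi.isClosedImmersion
  obtain ⟨D, hD, h⟩ := i.isClosedEmbedding.isInducing.isOpen_iff.mp W.isOpen
  exact ⟨⟨D, hD⟩, Opens.ext h⟩

/-- Invertibility says that the basic open set is all of `W`, and a homeomorphism detects this. No
affineness is needed. -/
theorem isUnit_iff {W : X.Opens} {a : Γ(X, W)} : IsUnit (pb i W a) ↔ IsUnit a := by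
  refine ⟨fun h => isUnit_of_basicOpen_eq ?_, fun h => h.map _⟩
  rw [← hi.preimage_inj, preimage_basicOpen_pb]
  exact Z.basicOpen_of_isUnit h

theorem pb_surjective {W : X.Opens} (hW : IsAffineOpen W) : Surjective (pb i W) :=
  have := hi.isClosedImmersion
  i.app_surjective W hW

theorem mul_eq_self {W : X.Opens} {a b : Γ(X, W)} (ha : pb i W a = 1) (hb : pb i W b = 0) :
    a * b = b := by
  have := hi.sq_zero W (a - 1) b (by rw [map_sub, ha, map_one, sub_self]) hb
  linear_combination this

/-- Over an affine open set, functions vanishing on the reduced scheme extend after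
multiplication by a power. -/
theorem exists_extension {D W : X.Opens} (hD : IsAffineOpen D) (g : Γ(X, D))
    (hW : W = X.basicOpen g) (h : W ≤ D) {c : Γ(X, W)} (hc : pb i W c = 0) :
    ∃ (n : ℕ) (a : Γ(X, D)), pb i D a = 0 ∧ resO h a = resO h g ^ n * c := by
  have := hi.isClosedImmersion
  -- This first extension need not vanish on `Z`, but its image there vanishes where `g` is
  -- invertible, so a further power of `g` kills it.
  obtain ⟨n, a, ha⟩ := exists_resO_eq_pow_mul hD g hW h c
  obtain ⟨m, hm⟩ := exists_pow_mul_eq_zero (hD.preimage i) (pb i D g)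
    (W := i ⁻¹ᵁ W) (by rw [hW, preimage_basicOpen_pb]) (i.preimage_mono h) (a := pb i D a) (by
      rw [← pb_resO i h, ha, map_mul, hc, mul_zero])
  refine ⟨m + n, g ^ m * a, by rw [map_mul, map_pow, hm], ?_⟩
  rw [map_mul, map_pow, ha, pow_add, mul_assoc]

/-- Vanishing of Čech `H¹` for the ideal of `Z`, by the usual partition of unity: `g ^ n c` extends
to `D`, `f ^ m c` extends to `E`, and `p g ^ n + q f ^ m = 1`. That relation is only known on `Z`,
which is enough because the ideal has square zero. -/
theorem exists_split {D E H : X.Opens} (hD : IsAffineOpen D) (hE : IsAffineOpen E)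
    (hDH : D ≤ H) (hEH : E ≤ H) {f g : Γ(Z, i ⁻¹ᵁ H)} (hfg : IsCoprime f g)
    (hf : i ⁻¹ᵁ D = Z.basicOpen f) (hg : i ⁻¹ᵁ E = Z.basicOpen g)
    {c : Γ(X, D ⊓ E)} (hc : pb i _ c = 0) :
    ∃ (a : Γ(X, D)) (b : Γ(X, E)), pb i D a = 0 ∧ pb i E b = 0 ∧
      c = resO (inf_le_left : D ⊓ E ≤ D) a + resO (inf_le_right : D ⊓ E ≤ E) b := by
  obtain ⟨g', hg'⟩ := hi.pb_surjective hD (resO (i.preimage_mono hDH) g)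
  obtain ⟨f', hf'⟩ := hi.pb_surjective hE (resO (i.preimage_mono hEH) f)
  obtain ⟨n, a, ha, ha'⟩ := hi.exists_extension hD g' (W := D ⊓ E) (by
    rw [← hi.preimage_inj, preimage_basicOpen_pb, hg', basicOpen_resO, ← hg]; rfl)
    inf_le_left hc
  obtain ⟨m, b, hb, hb'⟩ := hi.exists_extension hE f' (W := D ⊓ E) (by
    rw [← hi.preimage_inj, preimage_basicOpen_pb, hf', basicOpen_resO, ← hf]
    exact inf_comm (i ⁻¹ᵁ D) (i ⁻¹ᵁ E))
    inf_le_right hc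
  obtain ⟨p, q, hpq⟩ : IsCoprime (g ^ n) (f ^ m) := hfg.symm.pow
  obtain ⟨p', hp'⟩ := hi.pb_surjective hD (resO (i.preimage_mono hDH) p)
  obtain ⟨q', hq'⟩ := hi.pb_surjective hE (resO (i.preimage_mono hEH) q)
  refine ⟨p' * a, q' * b, by rw [map_mul, ha, mul_zero], by rw [map_mul, hb, mul_zero], ?_⟩
  rw [map_mul, map_mul, ha', hb']
  have := hi.mul_eq_self
    (a := resO (inf_le_left : D ⊓ E ≤ D) p' * resO inf_le_left g' ^ n +
      resO (inf_le_right : D ⊓ E ≤ E) q' * resO inf_le_right f' ^ m) (b := c) (by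
      simp only [map_add, map_mul, map_pow, pb_resO, hp', hq', hf', hg', resO_resO]
      have h1 := congr(resO (i.preimage_mono (inf_le_left.trans hDH) :
        i ⁻¹ᵁ (D ⊓ E) ≤ i ⁻¹ᵁ H) $hpq)
      simpa only [map_add, map_mul, map_pow, map_one] using h1) hc
  linear_combination -this

/-- By `exists_split`, local lifts of a function on `Z` can be corrected so as to glue, so functions
on `Z` lift to `H`. Lifts of `f` and `g` then generate the unit ideal and have the affine basic open
sets `D` and `E`. -/
theorem isAffineOpen_of_cover {D E H : X.Opens} (hD : IsAffineOpen D) (hE : IsAffineOpen E)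
    (hDH : D ≤ H) (hEH : E ≤ H) (hH : H ≤ D ⊔ E) {f g : Γ(Z, i ⁻¹ᵁ H)} (hfg : IsCoprime f g)
    (hf : i ⁻¹ᵁ D = Z.basicOpen f) (hg : i ⁻¹ᵁ E = Z.basicOpen g) : IsAffineOpen H := by
  have hs : Surjective (pb i H) := by
    intro z
    obtain ⟨d, hd⟩ := hi.pb_surjective hD (resO (i.preimage_mono hDH) z)
    obtain ⟨e, he⟩ := hi.pb_surjective hE (resO (i.preimage_mono hEH) z)
    obtain ⟨a, b, ha, hb, hab⟩ := hi.exists_split hD hE hDH hEH hfg hf hg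
      (c := resO (inf_le_left : D ⊓ E ≤ D) d - resO (inf_le_right : D ⊓ E ≤ E) e) (by
        rw [map_sub, pb_resO, pb_resO, hd, he, resO_resO, resO_resO, sub_self])
    obtain ⟨s, hs, hs'⟩ := exists_resO_of_sup hDH hEH hH (a := d - a) (b := e + b) (by
      rw [map_sub, map_add]
      linear_combination hab)
    refine ⟨s, resO_eq_of_sup (i.preimage_mono hDH) (i.preimage_mono hEH)
      (i.preimage_mono hH) ?_ ?_⟩
    · rw [← pb_resO i hDH, hs, map_sub, hd, ha, sub_zero]
    · rw [← pb_resO i hEH, hs', map_add, he, hb, add_zero]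
  obtain ⟨f', rfl⟩ := hs f
  obtain ⟨g', rfl⟩ := hs g
  rw [← preimage_basicOpen_pb, hi.preimage_inj] at hf hg
  refine isAffineOpen_of_isAffineOpen_basicOpen H {f', g'} ?_ ?_
  · obtain ⟨p, q, hpq⟩ := hfg
    obtain ⟨p', rfl⟩ := hs p
    obtain ⟨q', rfl⟩ := hs q
    refine Ideal.eq_top_of_isUnit_mem _ (x := p' * f' + q' * g') ?_ (hi.isUnit_iff.mp ?_)
    · exact Ideal.add_mem _ (Ideal.mul_mem_left _ _ (Ideal.subset_span (by simp)))
        (Ideal.mul_mem_left _ _ (Ideal.subset_span (by simp)))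
    · rw [map_add, map_mul, map_mul, hpq]; exact isUnit_one
  · rintro x (rfl | rfl)
    · rwa [← hf]
    · rwa [← hg]

/-- A property of open subsets of an affine line holds for the line if it holds locally and is
compatible with unions of two open sets. -/
theorem induction_of_isPrincipalIdealRing {U : X.Opens} (hU : IsAffineOpen (i ⁻¹ᵁ U))
    [IsDomain Γ(Z, i ⁻¹ᵁ U)] [IsPrincipalIdealRing Γ(Z, i ⁻¹ᵁ U)] (Q : X.Opens → Prop)
    (hloc : ∀ x ∈ U, ∃ W : X.Opens, x ∈ W ∧
      ∀ D ≤ W, ∀ g : Γ(Z, i ⁻¹ᵁ U), i ⁻¹ᵁ D = Z.basicOpen g → Q D)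
    (hglue : ∀ (D E H : X.Opens) (_ : D ≤ H) (_ : E ≤ H) (_ : H ≤ U),
      ∀ f g f' g' h : Γ(Z, i ⁻¹ᵁ U), f = h * f' → g = h * g' → IsCoprime f' g' →
      i ⁻¹ᵁ D = Z.basicOpen f → i ⁻¹ᵁ E = Z.basicOpen g → i ⁻¹ᵁ H = Z.basicOpen h →
      Q D → Q E → Q H) : Q U := by
  have := hi.isClosedImmersion
  have hloc' (z : Z) (hz : z ∈ i ⁻¹ᵁ U) : ∃ (g : Γ(Z, i ⁻¹ᵁ U)) (E : X.Opens),
      i ⁻¹ᵁ E = Z.basicOpen g ∧ z ∈ Z.basicOpen g ∧ Q E := by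
    obtain ⟨W, hzW, hW⟩ := hloc (i z) hz
    obtain ⟨g, hg, hz'⟩ := hU.exists_basicOpen_le (V := i ⁻¹ᵁ W) ⟨z, hzW⟩ hz
    obtain ⟨E, hE⟩ := hi.exists_preimage_eq (Z.basicOpen g)
    refine ⟨g, E, hE, hz', hW E ?_ g hE⟩
    rw [← hi.preimage_le_iff, hE]; exact hg
  -- Start from one basic open set with the property and enlarge it. Each enlargement replaces `f`
  -- by a proper divisor, which cannot go on forever in a principal ideal domain.
  have key (f : Γ(Z, i ⁻¹ᵁ U)) : ∀ D : X.Opens, i ⁻¹ᵁ D = Z.basicOpen f → Q D → Q U := by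
    induction f using WellFounded.induction
      (IsWellFounded.wf : WellFounded (DvdNotUnit (α := Γ(Z, i ⁻¹ᵁ U)))) with
    | _ f ih =>
    intro D hD hQ
    by_cases hDU : Z.basicOpen f = i ⁻¹ᵁ U
    · rw [hDU, hi.preimage_inj] at hD
      rwa [← hD]
    obtain ⟨z, hz, hzf⟩ : ∃ z ∈ i ⁻¹ᵁ U, z ∉ Z.basicOpen f := by
      by_contra! h
      exact hDU (le_antisymm (Z.basicOpen_le f) h)
    obtain ⟨g, E, hE, hzg, hQE⟩ := hloc' z hz
    -- The gcd `h` defines the union of the two basic open sets. It divides `f` properly because `z`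
    -- lies in the locus of `h` but not in that of `f`.
    obtain ⟨h, hh⟩ := (IsPrincipalIdealRing.principal (Ideal.span {f, g})).principal
    rw [Ideal.submodule_span_eq] at hh
    obtain ⟨f', rfl⟩ : h ∣ f := Ideal.mem_span_singleton.mp
      (hh ▸ Ideal.subset_span (by simp))
    obtain ⟨g', rfl⟩ : h ∣ g := Ideal.mem_span_singleton.mp
      (hh ▸ Ideal.subset_span (by simp))
    obtain ⟨p, q, hpq⟩ := Ideal.mem_span_pair.mp (hh.ge (Ideal.mem_span_singleton_self h))
    have hh0 : h ≠ 0 := by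
      rintro rfl
      simp at hzg
    have hco : IsCoprime f' g' := ⟨p, q, mul_left_cancel₀ hh0 (by linear_combination hpq)⟩
    obtain ⟨H, hH⟩ := hi.exists_preimage_eq (Z.basicOpen h)
    have hzg' := hzg
    rw [Scheme.basicOpen_mul] at hzg' hzf
    refine ih h ⟨hh0, f', ?_, rfl⟩ H hH (hglue D E H ?_ ?_ ?_ _ _
      f' g' h rfl rfl hco hD hE hH hQ hQE)
    · intro hu
      apply hzf
      rw [Z.basicOpen_of_isUnit hu]
      exact ⟨hzg'.1, hz⟩
    · rw [← hi.preimage_le_iff, hD, hH, Scheme.basicOpen_mul]; exact inf_le_left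
    · rw [← hi.preimage_le_iff, hE, hH, Scheme.basicOpen_mul]; exact inf_le_left
    · rw [← hi.preimage_le_iff, hH]; exact Z.basicOpen_le h
  -- The empty set is excluded because its ring of functions is zero, hence not a domain.
  have hne : ∃ z, z ∈ i ⁻¹ᵁ U := by
    by_contra! h
    have hb : i ⁻¹ᵁ U = ⊥ := le_bot_iff.mp h
    have : Z.basicOpen (0 : Γ(Z, i ⁻¹ᵁ U)) = i ⁻¹ᵁ U := by rw [Scheme.basicOpen_zero, hb]
    exact not_isUnit_zero (isUnit_of_basicOpen_eq this)
  obtain ⟨z, hz⟩ := hne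
  obtain ⟨g, E, hE, -, hQ⟩ := hloc' z hz
  exact key g E hE hQ

theorem le_sup_of_isCoprime {D E H : X.Opens} {f g : Γ(Z, i ⁻¹ᵁ H)} (hfg : IsCoprime f g)
    (hf : i ⁻¹ᵁ D = Z.basicOpen f) (hg : i ⁻¹ᵁ E = Z.basicOpen g) : H ≤ D ⊔ E := by
  obtain ⟨p, q, hpq⟩ := hfg
  rw [← hi.preimage_le_iff, Scheme.Hom.preimage_sup, hf, hg]
  refine (iSup_basicOpen_of_span_eq_top _ {f, g} ?_).ge.trans ?_
  · rw [Ideal.eq_top_iff_one, Ideal.mem_span_pair]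
    exact ⟨p, q, hpq⟩
  · simp only [iSup_le_iff]
    rintro x (rfl | rfl)
    · exact le_sup_left
    · exact le_sup_right

/-- The special case of "a thickening of an affine scheme is affine" needed for the charts, obtained
from the induction and `isAffineOpen_of_cover`. -/
theorem isAffineOpen {U : X.Opens} (hU : IsAffineOpen (i ⁻¹ᵁ U))
    [IsDomain Γ(Z, i ⁻¹ᵁ U)] [IsPrincipalIdealRing Γ(Z, i ⁻¹ᵁ U)] : IsAffineOpen U := by
  refine hi.induction_of_isPrincipalIdealRing hU (fun D => IsAffineOpen D) ?_ ?_
  · intro x hx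
    obtain ⟨_, ⟨W, hW, rfl⟩, hxW, hWU⟩ := X.isBasis_affineOpens.exists_subset_of_mem_open hx U.2
    refine ⟨W, hxW, fun D hD g hg => ?_⟩
    obtain ⟨g', hg'⟩ := hi.pb_surjective hW (resO (i.preimage_mono hWU) g)
    have : D = X.basicOpen g' := by
      rw [← hi.preimage_inj, preimage_basicOpen_pb, hg', basicOpen_resO, ← hg]
      exact (inf_eq_right.mpr (i.preimage_mono hD)).symm
    rw [this]
    exact hW.basicOpen g'
  · intro D E H hDH hEH hHU f g f' g' h hf hg hfg hD hE hH h₁ h₂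
    have hfg' := hfg.map (resO (i.preimage_mono hHU))
    -- On the locus of `h` the functions `f = h f'` and `f'` have the same basic open set, so `f`
    -- may be replaced by its coprime part.
    have hf' : i ⁻¹ᵁ D = Z.basicOpen (resO (i.preimage_mono hHU) f') := by
      rw [basicOpen_resO, hH, ← Scheme.basicOpen_mul, ← hf, hD]
    have hg' : i ⁻¹ᵁ E = Z.basicOpen (resO (i.preimage_mono hHU) g') := by
      rw [basicOpen_resO, hH, ← Scheme.basicOpen_mul, ← hg, hE]
    exact hi.isAffineOpen_of_cover h₁ h₂ hDH hEH (hi.le_sup_of_isCoprime hfg' hf' hg') hfg' hf' hg'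

end IsThickening

end Thickening

end RibbonCurve

namespace RibbonCurve
open Function

/-! ### Free generators of line bundles -/

section Generators

variable {X : Scheme.{u}} (M : X.Modules)

/-- A section `e` of `M` over `U` is a free generator if every section of `M` over an open set
`W ≤ U` is uniquely a multiple of `e`. -/
def IsGen {U : X.Opens} (e : Γ(M, U)) : Prop :=
  ∀ (W : X.Opens) (h : W ≤ U), Bijective fun a : Γ(X, W) => a • resM M h e

variable {M}

theorem IsGen.res {U V : X.Opens} {e : Γ(M, U)} (he : IsGen M e) (h : V ≤ U) :
    IsGen M (resM M h e) := by
  intro W hW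
  simp only [resM_resM]
  exact he W _

theorem IsGen.bijective {U : X.Opens} {e : Γ(M, U)} (he : IsGen M e) :
    Bijective fun a : Γ(X, U) => a • e := by
  have := he U le_rfl
  simpa only [resM_self] using this

theorem IsGen.smul {U : X.Opens} {e : Γ(M, U)} (he : IsGen M e) {v : Γ(X, U)} (hv : IsUnit v) :
    IsGen M (v • e) := by
  intro W hW
  obtain ⟨w, hw⟩ := hv.map (resO hW)
  have : (fun a : Γ(X, W) => a • resM M hW (v • e)) =
      (fun a : Γ(X, W) => a • resM M hW e) ∘ fun a => a * w := by
    funext a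
    simp only [comp_apply, resM_smul, ← hw, mul_smul]
  rw [this]
  exact (he W hW).comp w.mulRight_bijective

theorem IsGen.exists_unit {U : X.Opens} {e e' : Γ(M, U)} (he : IsGen M e) (he' : IsGen M e') :
    ∃ v : Γ(X, U)ˣ, e' = (v : Γ(X, U)) • e := by
  obtain ⟨v, hv⟩ := he.bijective.2 e'
  obtain ⟨w, hw⟩ := he'.bijective.2 e
  have h1 : w * v = 1 := he.bijective.1 (by
    simp only at hv hw
    simp only [mul_smul, hv, hw, one_smul])
  exact ⟨⟨v, w, by rw [mul_comm, h1], h1⟩, hv.symm⟩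

theorem isGen_of_sup {D E H : X.Opens} (hD : D ≤ H) (hE : E ≤ H) (hH : H ≤ D ⊔ E) {e : Γ(M, H)}
    (h₁ : IsGen M (resM M hD e)) (h₂ : IsGen M (resM M hE e)) : IsGen M e := by
  intro W hW
  have hcov : W ≤ (W ⊓ D) ⊔ (W ⊓ E) := by rw [← inf_sup_left]; exact le_inf le_rfl (hW.trans hH)
  have b₁ := h₁ (W ⊓ D) inf_le_right
  have b₂ := h₂ (W ⊓ E) inf_le_right
  have b₃ := h₁ ((W ⊓ D) ⊓ (W ⊓ E)) (inf_le_left.trans inf_le_right)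
  simp only [resM_resM] at b₁ b₂ b₃
  constructor
  · intro a b hab
    refine resO_eq_of_sup inf_le_left inf_le_left hcov (b₁.1 ?_) (b₂.1 ?_)
    · have := congr(resM M (inf_le_left : W ⊓ D ≤ W) $hab)
      simpa only [resM_smul, resM_resM] using this
    · have := congr(resM M (inf_le_left : W ⊓ E ≤ W) $hab)
      simpa only [resM_smul, resM_resM] using this
  · intro m
    obtain ⟨a, ha⟩ := b₁.2 (resM M inf_le_left m)
    obtain ⟨b, hb⟩ := b₂.2 (resM M inf_le_left m)
    simp only at ha hb
    obtain ⟨s, hs₁, hs₂⟩ := exists_resO_of_sup (inf_le_left : W ⊓ D ≤ W)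
      (inf_le_left : W ⊓ E ≤ W) hcov (a := a) (b := b) (b₃.1 (by
        have h1 := congr(resM M (inf_le_left : (W ⊓ D) ⊓ (W ⊓ E) ≤ W ⊓ D) $ha)
        have h2 := congr(resM M (inf_le_right : (W ⊓ D) ⊓ (W ⊓ E) ≤ W ⊓ E) $hb)
        simp only [resM_smul, resM_resM] at h1 h2
        exact h1.trans h2.symm))
    refine ⟨s, resM_eq_of_sup M inf_le_left inf_le_left hcov ?_ ?_⟩
    · rw [resM_smul, hs₁, resM_resM, ha]
    · rw [resM_smul, hs₂, resM_resM, hb]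

variable (X) in
/-- The structure sheaf as a module over itself. -/
def unitModule : X.Modules := SheafOfModules.unit X.ringCatSheaf

/-- Functions as sections of the structure sheaf. -/
def toUnit {W : X.Opens} (a : Γ(X, W)) : Γ(unitModule X, W) := a

theorem smul_toUnit {W : X.Opens} (a b : Γ(X, W)) : a • toUnit b = toUnit (a * b) := rfl

theorem resM_toUnit {W V : X.Opens} (h : W ≤ V) (a : Γ(X, V)) :
    resM (unitModule X) h (toUnit a) = toUnit (resO h a) := rfl

theorem app_resM {N : X.Modules} (ψ : N ⟶ M) {W V : X.Opens} (h : W ≤ V) (x : Γ(N, V)) :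
    ψ.app W (resM N h x) = resM M h (ψ.app V x) :=
  congr($(ψ.mapPresheaf.naturality (homOfLE h).op) x)

theorem app_toUnit (ψ : unitModule X ⟶ M) {W V : X.Opens} (h : W ≤ V) (a : Γ(X, W)) :
    ψ.app W (toUnit a) = a • resM M h (ψ.app V (toUnit 1)) := by
  rw [← app_resM, ← Scheme.Modules.Hom.app_smul, resM_toUnit, smul_toUnit, map_one, mul_one]

/-- The generator is the image of `1` under a local trivialization. The trivialization lives on the
open subscheme, so its functions are transported to `X` by `appIso`. -/
theorem IsLineBundle.exists_isGen (hM : IsLineBundle M) (x : X) :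
    ∃ (U : X.Opens) (e : Γ(M, U)), x ∈ U ∧ IsGen M e := by
  obtain ⟨U, hx, ⟨φ⟩⟩ := hM x
  let ψ : unitModule (U : Scheme.{u}) ≅ M.restrict U.ι := φ.symm
  refine ⟨U.ι ''ᵁ ⊤, ψ.hom.app ⊤ (toUnit 1), ?_, ?_⟩
  · simpa using hx
  · intro W hW
    obtain ⟨W, rfl⟩ : ∃ W' : (U : Scheme.{u}).Opens, U.ι ''ᵁ W' = W :=
      ⟨U.ι ⁻¹ᵁ W, by
        rw [Scheme.Hom.image_preimage_eq_opensRange_inf]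
        exact inf_eq_right.mpr (hW.trans (U.ι.image_le_opensRange _))⟩
    have hiso : IsIso (ψ.hom.app W) :=
      Scheme.Modules.Hom.isIso_iff_isIso_app.mp (Iso.isIso_hom ψ) W
    have hb := ConcreteCategory.bijective_of_isIso (ψ.hom.app W)
    have hb' := ConcreteCategory.bijective_of_isIso (U.ι.appIso W).hom
    convert! hb.comp hb' using 1
    funext a
    refine Eq.trans ?_ (app_toUnit ψ.hom (le_top : W ≤ ⊤) ((U.ι.appIso W).hom a)).symm
    have h2 : (U.ι.appIso W).inv ((U.ι.appIso W).hom a) = a :=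
      congr($((U.ι.appIso W).hom_inv_id) a)
    conv_lhs => rw [← h2]
    rfl

/-- Units on the intersection of two basic open sets of an affine line are quotients of units. -/
theorem exists_isUnit_mul_eq {V W₁ W₂ : X.Opens} (hV : IsAffineOpen V)
    [DecompositionMonoid Γ(X, V)] {f g : Γ(X, V)} (hf : W₁ = X.basicOpen f)
    (hg : W₂ = X.basicOpen g) (u : Γ(X, W₁ ⊓ W₂)) (hu : IsUnit u) :
    ∃ (v : Γ(X, W₁)) (w : Γ(X, W₂)), IsUnit v ∧ IsUnit w ∧
      u * resO inf_le_right w = resO inf_le_left v := by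
  have h₁ : W₁ ≤ V := hf.trans_le (X.basicOpen_le f)
  have h₂ : W₂ ≤ V := hg.trans_le (X.basicOpen_le g)
  have h₁₂ : W₁ ⊓ W₂ ≤ V := inf_le_left.trans h₁
  have hfg : W₁ ⊓ W₂ = X.basicOpen (f * g) := by rw [Scheme.basicOpen_mul, hf, hg]
  obtain ⟨u, rfl⟩ := hu
  obtain ⟨n, a, ha⟩ := exists_resO_eq_pow_mul hV (f * g) hfg h₁₂ (u : Γ(X, W₁ ⊓ W₂))
  obtain ⟨m, c, hc⟩ := exists_resO_eq_pow_mul hV (f * g) hfg h₁₂ ((u⁻¹ : Γ(X, W₁ ⊓ W₂)ˣ) :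
    Γ(X, W₁ ⊓ W₂))
  obtain ⟨l, hl⟩ := exists_pow_mul_eq_zero hV (f * g) hfg h₁₂
    (a := a * c - (f * g) ^ (n + m)) (by
      rw [map_sub, map_mul, ha, hc, map_pow]
      linear_combination (resO h₁₂ (f * g) ^ n * resO h₁₂ (f * g) ^ m) * u.mul_inv)
  -- Clearing denominators in `u` and `u⁻¹` makes the numerator `a` of `u` a divisor of a power of
  -- `f g`. It then factors as `a₁ a₂` with `a₁` invertible on `W₁` and `a₂` on `W₂`.
  have hdvd : a ∣ f ^ (l + (n + m)) * g ^ (l + (n + m)) :=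
    ⟨(f * g) ^ l * c, by rw [← mul_pow, pow_add]; linear_combination -hl⟩
  obtain ⟨a₁, a₂, h1, h2, rfl⟩ := exists_dvd_and_dvd_of_dvd_mul hdvd
  have uf : IsUnit (resO h₁ f) := isUnit_of_basicOpen_eq (by
    rw [basicOpen_resO, ← hf, inf_idem])
  have ug : IsUnit (resO h₂ g) := isUnit_of_basicOpen_eq (by
    rw [basicOpen_resO, ← hg, inf_idem])
  have u₁ : IsUnit (resO h₁ a₁) := isUnit_of_dvd_unit (map_dvd (resO h₁) h1) (by
    rw [map_pow]; exact uf.pow _)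
  have u₂ : IsUnit (resO h₂ a₂) := isUnit_of_dvd_unit (map_dvd (resO h₂) h2) (by
    rw [map_pow]; exact ug.pow _)
  obtain ⟨f', hf'⟩ := uf
  obtain ⟨a', ha'⟩ := u₂
  -- From `u = a₁ a₂ / (f g) ^ n`, take `v = a₁ / f ^ n` and `w = g ^ n / a₂`.
  refine ⟨resO h₁ a₁ * ((f'⁻¹ ^ n : Γ(X, W₁)ˣ) : Γ(X, W₁)),
    resO h₂ g ^ n * ((a'⁻¹ : Γ(X, W₂)ˣ) : Γ(X, W₂)), u₁.mul (Units.isUnit _),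
    (ug.pow n).mul (Units.isUnit _), ?_⟩
  have e1 := congr(resO (inf_le_left : W₁ ⊓ W₂ ≤ W₁) $((f' ^ n).mul_inv))
  have e2 := congr(resO (inf_le_right : W₁ ⊓ W₂ ≤ W₂) $(a'.mul_inv))
  simp only [Units.val_pow_eq_pow_val, map_mul, map_pow, map_one, hf', ha', resO_resO,
    inv_pow] at e1 e2 ha ⊢
  linear_combination -(u.val * resO h₁₂ g ^ n * resO inf_le_right a'⁻¹.val) * e1 -
    (resO inf_le_left (f' ^ n)⁻¹.val * resO inf_le_right a'⁻¹.val) * ha +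
    (resO h₁₂ a₁ * resO inf_le_left (f' ^ n)⁻¹.val) * e2

end Generators

/-! ### Triviality of line bundles on thickenings of affine lines. -/

namespace IsThickening

variable {X Z : Scheme.{u}} {i : Z ⟶ X} (hi : IsThickening i)
include hi

/-- The transition function is trivialized in two stages: its reduction by a quotient of units,
supplied by `hu`, and the remaining factor `1 + c`, with `c` in the ideal, by `exists_split`. -/
theorem exists_isGen_of_cover {M : X.Modules} {D E H : X.Opens} (hD : IsAffineOpen D)
    (hE : IsAffineOpen E) (hDH : D ≤ H) (hEH : E ≤ H) (hH : H ≤ D ⊔ E)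
    {f g : Γ(Z, i ⁻¹ᵁ H)} (hfg : IsCoprime f g)
    (hf : i ⁻¹ᵁ D = Z.basicOpen f) (hg : i ⁻¹ᵁ E = Z.basicOpen g)
    {d : Γ(M, D)} {e : Γ(M, E)} (hd : IsGen M d) (he : IsGen M e)
    (hu : ∀ u : Γ(Z, i ⁻¹ᵁ (D ⊓ E)), IsUnit u → ∃ (v : Γ(Z, i ⁻¹ᵁ D)) (w : Γ(Z, i ⁻¹ᵁ E)),
      IsUnit v ∧ IsUnit w ∧ u * resO (i.preimage_mono inf_le_right) w =
        resO (i.preimage_mono inf_le_left) v) :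
    ∃ s : Γ(M, H), IsGen M s := by
  obtain ⟨u, hu'⟩ := (hd.res (inf_le_left : D ⊓ E ≤ D)).exists_unit
    (he.res (inf_le_right : D ⊓ E ≤ E))
  obtain ⟨v, w, hv, hw, huvw⟩ := hu (pb i _ u) (u.isUnit.map _)
  obtain ⟨v', rfl⟩ := hi.pb_surjective hD v
  obtain ⟨w', rfl⟩ := hi.pb_surjective hE w
  rw [hi.isUnit_iff] at hv hw
  rw [← pb_resO i inf_le_right, ← pb_resO i inf_le_left, ← map_mul] at huvw
  obtain ⟨r, hr⟩ := hv.map (resO (inf_le_left : D ⊓ E ≤ D))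
  obtain ⟨a, b, ha, hb, hab⟩ := hi.exists_split hD hE hDH hEH hfg hf hg
    (c := r⁻¹.val * (u.val * resO inf_le_right w') - 1) (by
      rw [map_sub, map_mul, huvw, ← hr, ← map_mul, Units.inv_mul, map_one, sub_self])
  have ha' : IsUnit (1 + a) := by
    rw [← hi.isUnit_iff, map_add, ha, map_one, add_zero]; exact isUnit_one
  have hb' : IsUnit (1 - b) := by
    rw [← hi.isUnit_iff, map_sub, hb, map_one, sub_zero]; exact isUnit_one
  have gD := hd.smul (hv.mul ha')
  have gE := he.smul (hw.mul hb')
  -- The corrected generators agree on the overlap because `(1 + a + b)(1 - b) = 1 + a` modulo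
  -- products of elements of the ideal.
  obtain ⟨s, hs₁, hs₂⟩ := exists_resM_of_sup M hDH hEH hH
    (a := (v' * (1 + a)) • d) (b := (w' * (1 - b)) • e) (by
      rw [resM_smul, resM_smul, hu', ← mul_smul]
      congr 1
      rw [map_mul, map_mul, map_add, map_sub, map_one, map_one]
      have h1 : u.val * resO inf_le_right w' =
          r.val * (1 + resO inf_le_left a + resO inf_le_right b) := by
        rw [add_assoc, ← hab, add_sub_cancel, Units.mul_inv_cancel_left]
      have h2 := hi.sq_zero (D ⊓ E) (resO inf_le_left a) (resO inf_le_right b)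
        (by rw [pb_resO i inf_le_left, ha, map_zero]) (by rw [pb_resO i inf_le_right, hb, map_zero])
      have h3 := hi.sq_zero (D ⊓ E) (resO inf_le_right b) (resO inf_le_right b)
        (by rw [pb_resO i inf_le_right, hb, map_zero]) (by rw [pb_resO i inf_le_right, hb, map_zero])
      rw [← hr]
      linear_combination -(1 - resO (inf_le_right : D ⊓ E ≤ E) b) * h1 + r.val * (h2 + h3))
  exact ⟨s, isGen_of_sup hDH hEH hH (by rwa [hs₁]) (by rwa [hs₂])⟩

/-- Having a generator is a local property which passes to coprime unions, so the induction applies.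
Unique factorization splits the units on overlaps. -/
theorem exists_isGen {M : X.Modules} (hM : IsLineBundle M) {U : X.Opens}
    (hU : IsAffineOpen (i ⁻¹ᵁ U)) [IsDomain Γ(Z, i ⁻¹ᵁ U)]
    [IsPrincipalIdealRing Γ(Z, i ⁻¹ᵁ U)] : ∃ e : Γ(M, U), IsGen M e := by
  have hU' := hi.isAffineOpen hU
  refine hi.induction_of_isPrincipalIdealRing hU (fun D => ∃ e : Γ(M, D), IsGen M e) ?_ ?_
  · intro x _
    obtain ⟨W, e, hxW, he⟩ := hM.exists_isGen x
    exact ⟨W, hxW, fun D hD _ _ => ⟨_, he.res hD⟩⟩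
  · rintro D E H hDH hEH hHU f g f' g' h hf hg hfg hD hE hH ⟨d, hd⟩ ⟨e, he⟩
    have hfg' := hfg.map (resO (i.preimage_mono hHU))
    have hf' : i ⁻¹ᵁ D = Z.basicOpen (resO (i.preimage_mono hHU) f') := by
      rw [basicOpen_resO, hH, ← Scheme.basicOpen_mul, ← hf, hD]
    have hg' : i ⁻¹ᵁ E = Z.basicOpen (resO (i.preimage_mono hHU) g') := by
      rw [basicOpen_resO, hH, ← Scheme.basicOpen_mul, ← hg, hE]
    have affine_basic {W : X.Opens} {f : Γ(Z, i ⁻¹ᵁ U)} (hW : i ⁻¹ᵁ W = Z.basicOpen f) :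
        IsAffineOpen W := by
      obtain ⟨f, rfl⟩ := hi.pb_surjective hU' f
      rw [← preimage_basicOpen_pb, hi.preimage_inj] at hW
      rw [hW]
      exact hU'.basicOpen f
    exact hi.exists_isGen_of_cover (affine_basic hD) (affine_basic hE) hDH hEH
      (hi.le_sup_of_isCoprime hfg' hf' hg') hfg' hf' hg' hd he
      (fun u hu => exists_isUnit_mul_eq hU hD hE u hu)

end IsThickening

end RibbonCurve

/-! ### The standard charts of `ℙ¹` are affine lines. -/

namespace RibbonCurve
open Function
-- A factorization of the structure morphism through `Spec` determines the action of constants; this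
-- is how the constants on the charts of `ℙ¹` are computed.
theorem scalars_eq_of_comp {k : Type u} [Field k] {X : Scheme.{u}} (p : X ⟶ Spec (.of k))
    (U : X.Opens) (φ : CommRingCat.of k ⟶ Γ(X, U))
    (h : U.ι ≫ p = U.toSpecΓ ≫ Spec.map φ) : scalars p U = φ.hom := by
  have h1 : p.appTop ≫ U.ι.appTop = (Spec.map φ).appTop ≫ U.toSpecΓ.appTop := by
    rw [← Scheme.Hom.comp_appTop, h, Scheme.Hom.comp_appTop]
  rw [Scheme.Opens.toSpecΓ_appTop, Scheme.ΓSpecIso_naturality_assoc] at h1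
  have h2 : (Scheme.ΓSpecIso (.of k)).inv ≫ p.appTop ≫ U.ι.appTop ≫ U.topIso.hom = φ := by
    rw [reassoc_of% h1, Iso.inv_hom_id_assoc]
    exact (congrArg (φ ≫ ·) U.topIso.inv_hom_id).trans (Category.comp_id _)
  have h3 : U.ι.appTop ≫ U.topIso.hom = X.presheaf.map (homOfLE le_top).op := by
    rw [Scheme.Opens.ι_appTop, Scheme.Opens.topIso_hom]
    exact (X.presheaf.map_comp _ _).symm
  rw [h3] at h2
  rw [← h2]
  rfl

namespace P1

variable (k : Type u) [Field k]

theorem X_mem (j : Fin 2) : (MvPolynomial.X j : MvPolynomial (Fin 2) k) ∈ grading k 1 :=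
  MvPolynomial.isHomogeneous_X k j

/-- The fraction `x_i / x_j`. -/
def frac (j i : Fin 2) : HomogeneousLocalization.Away (grading k) (MvPolynomial.X j) :=
  HomogeneousLocalization.Away.mk (grading k) (d := 1) (X_mem k j) 1
    (MvPolynomial.X i) (X_mem k i)

/-- Homogeneous fractions of degree zero as functions on a standard chart. -/
def awaySection (j : Fin 2) : HomogeneousLocalization.Away (grading k) (MvPolynomial.X j) →+*
    Γ(P1 k, P1.chart k j) :=
  (Proj.awayToSection (grading k) (MvPolynomial.X j)).hom

/-- The coordinate `x_i / x_j` on the chart `x_j ≠ 0`. -/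
def coordinate (j i : Fin 2) : Γ(P1 k, P1.chart k j) :=
  awaySection k j (frac k j i)

/-- Constants in the degree zero localization. -/
def awayConst (j : Fin 2) :
    k →+* HomogeneousLocalization.Away (grading k) (MvPolynomial.X j) :=
  (HomogeneousLocalization.fromZeroRingHom (grading k) _).comp (algebraMap k (grading k 0))

theorem isAffineOpen_chart (j : Fin 2) : IsAffineOpen (P1.chart k j) :=
  Proj.isAffineOpen_basicOpen (grading k) (MvPolynomial.X j) (X_mem k j) one_pos

theorem awaySection_bijective (j : Fin 2) : Bijective (awaySection k j) := by
  have : IsIso (Proj.awayToSection (grading k) (MvPolynomial.X j)) :=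
    (Proj.basicOpenIsoAway (grading k) (MvPolynomial.X j) (X_mem k j) one_pos).isIso_hom
  exact ConcreteCategory.bijective_of_isIso (Proj.awayToSection (grading k) (MvPolynomial.X j))

theorem scalars_chart (j : Fin 2) (c : k) :
    scalars (P1.toSpec k) (P1.chart k j) c =
      awaySection k j (awayConst k j c) := by
  refine congr($(scalars_eq_of_comp (P1.toSpec k) (P1.chart k j) (CommRingCat.ofHom (awayConst k j) ≫
    Proj.awayToSection (grading k) (MvPolynomial.X j)) ?_) c)
  have h1 := Proj.awayι_toSpecZero (grading k) (MvPolynomial.X j) (X_mem k j) one_pos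
  have h0 : (Proj.basicOpenIsoSpec (grading k) (MvPolynomial.X j)
      (X_mem k j) one_pos).inv ≫ (Proj.basicOpen (grading k)
      (MvPolynomial.X j)).ι ≫ Proj.toSpecZero (grading k) = _ := h1
  rw [Iso.inv_comp_eq, Proj.basicOpenIsoSpec_hom, Proj.basicOpenToSpec] at h0
  refine (congrArg (· ≫ Spec.map (CommRingCat.ofHom (algebraMap k (grading k 0)))) h0).trans ?_
  rw [Category.assoc, Category.assoc, ← Spec.map_comp, ← Spec.map_comp]
  rfl

/-- The localization of `k[x₀, x₁]` at `x_j`. -/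
abbrev Loc (j : Fin 2) := Localization.Away (MvPolynomial.X j : MvPolynomial (Fin 2) k)

theorem val_mk_mul (j : Fin 2) (n : ℕ) (f : MvPolynomial (Fin 2) k) (hf : f ∈ grading k (n • 1)) :
    (HomogeneousLocalization.Away.mk (grading k) (X_mem k j) n f hf).val *
      algebraMap (MvPolynomial (Fin 2) k) (Loc k j) (MvPolynomial.X j ^ n) =
      algebraMap (MvPolynomial (Fin 2) k) (Loc k j) f := by
  rw [HomogeneousLocalization.Away.val_mk, Localization.mk_eq_mk']
  exact IsLocalization.mk'_spec (M := Submonoid.powers (MvPolynomial.X j)) (Loc k j) f ⟨_, n, rfl⟩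

theorem val_frac_mul (j i : Fin 2) : (frac k j i).val *
      algebraMap (MvPolynomial (Fin 2) k) (Loc k j) (MvPolynomial.X j) =
      algebraMap (MvPolynomial (Fin 2) k) (Loc k j) (MvPolynomial.X i) := by
  have := val_mk_mul k j 1 (MvPolynomial.X i) (X_mem k i)
  rwa [pow_one] at this

theorem val_awayConst (j : Fin 2) (c : k) : (awayConst k j c).val =
    algebraMap (MvPolynomial (Fin 2) k) (Loc k j) (MvPolynomial.C c) := by
  rw [← Localization.mk_one_eq_algebraMap]
  rfl

theorem val_ext {j : Fin 2} {x y : HomogeneousLocalization.Away (grading k) (MvPolynomial.X j)}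
    {n : ℕ} (h : x.val * algebraMap (MvPolynomial (Fin 2) k) (Loc k j) (MvPolynomial.X j ^ n) =
      y.val * algebraMap (MvPolynomial (Fin 2) k) (Loc k j) (MvPolynomial.X j ^ n)) : x = y := by
  refine HomogeneousLocalization.val_injective _ ?_
  refine (IsUnit.mul_left_inj ?_).mp h
  exact IsLocalization.map_units (Loc k j) (⟨_, n, rfl⟩ : Submonoid.powers (MvPolynomial.X j))

/-- Dehomogenization. -/
def dehom (j : Fin 2) : MvPolynomial (Fin 2) k →+* Polynomial k :=
  MvPolynomial.eval₂Hom Polynomial.C fun l => if l = j then 1 else Polynomial.X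

theorem dehom_C (j : Fin 2) (c : k) : dehom k j (MvPolynomial.C c) = Polynomial.C c := by
  simp [dehom]

theorem dehom_X_self (j : Fin 2) : dehom k j (MvPolynomial.X j) = 1 := by
  simp [dehom]

theorem dehom_X {j i : Fin 2} (h : i ≠ j) : dehom k j (MvPolynomial.X i) = Polynomial.X := by
  simp [dehom, h]

/-- Dehomogenization of fractions. -/
def awayToPoly (j : Fin 2) :
    HomogeneousLocalization.Away (grading k) (MvPolynomial.X j) →+* Polynomial k :=
  (IsLocalization.Away.lift (S := Loc k j) (MvPolynomial.X j) (g := dehom k j)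
    (by rw [dehom_X_self]; exact isUnit_one)).comp (algebraMap _ (Loc k j))

theorem awayToPoly_eq {j : Fin 2} (x : HomogeneousLocalization.Away (grading k) (MvPolynomial.X j))
    {f : MvPolynomial (Fin 2) k} {n : ℕ}
    (h : x.val * algebraMap (MvPolynomial (Fin 2) k) (Loc k j) (MvPolynomial.X j ^ n) =
      algebraMap (MvPolynomial (Fin 2) k) (Loc k j) f) : awayToPoly k j x = dehom k j f := by
  have hX : dehom k j (.X j ^ n) = 1 := by rw [map_pow, dehom_X_self, one_pow]
  have := congr(IsLocalization.Away.lift (S := Loc k j) (MvPolynomial.X j) (g := dehom k j)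
    (by rw [dehom_X_self]; exact isUnit_one) $h)
  rw [map_mul, IsLocalization.Away.lift_eq, IsLocalization.Away.lift_eq, hX, mul_one] at this
  exact this

theorem awayToPoly_const (j : Fin 2) (c : k) : awayToPoly k j (awayConst k j c) =
    Polynomial.C c := by
  rw [awayToPoly_eq k (n := 0) (f := MvPolynomial.C c), dehom_C]
  rw [val_awayConst, pow_zero, map_one, mul_one]

theorem awayToPoly_frac {j i : Fin 2} (h : i ≠ j) : awayToPoly k j (frac k j i) = Polynomial.X := by
  rw [awayToPoly_eq k (n := 1) (f := MvPolynomial.X i), dehom_X k h]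
  rw [pow_one, val_frac_mul]

/-- Polynomials in the coordinate `x_i / x_j`. -/
def polyToAway (j i : Fin 2) :
    Polynomial k →+* HomogeneousLocalization.Away (grading k) (MvPolynomial.X j) :=
  Polynomial.eval₂RingHom (awayConst k j) (frac k j i)

theorem awayToPoly_polyToAway {j i : Fin 2} (h : i ≠ j) (p : Polynomial k) :
    awayToPoly k j (polyToAway k j i p) = p := by
  have : (awayToPoly k j).comp (polyToAway k j i) = RingHom.id _ := by
    refine Polynomial.ringHom_ext (fun c => ?_) ?_
    · simp [polyToAway, awayToPoly_const]
    · simp [polyToAway, awayToPoly_frac k h]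
  exact congr($this p)

/-- Rehomogenizing recovers a form from its dehomogenization. This gives surjectivity of
`polyToAway`, and is checked on monomials, where both sides are multiplicative. -/
theorem val_polyToAway_dehom {j i : Fin 2} (h : i ≠ j) {n : ℕ} {f : MvPolynomial (Fin 2) k}
    (hf : f.IsHomogeneous n) :
    (polyToAway k j i (dehom k j f)).val *
      algebraMap (MvPolynomial (Fin 2) k) (Loc k j) (MvPolynomial.X j ^ n) =
      algebraMap (MvPolynomial (Fin 2) k) (Loc k j) f := by
  have hmon : ∀ (d : Fin 2 →₀ ℕ) (c : k), (polyToAway k j i (dehom k j (.monomial d c))).val *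
      algebraMap (MvPolynomial (Fin 2) k) (Loc k j) (MvPolynomial.X j ^ d.degree) =
      algebraMap (MvPolynomial (Fin 2) k) (Loc k j) (.monomial d c) := by
    intro d c
    induction d using Finsupp.induction_linear generalizing c with
    | zero =>
      have : (MvPolynomial.monomial 0 c : MvPolynomial (Fin 2) k) = .C c := rfl
      rw [this, dehom_C]
      simp [polyToAway, val_awayConst]
    | add d d' hd hd' =>
      have : (MvPolynomial.monomial (d + d') c : MvPolynomial (Fin 2) k) =
        .monomial d c * .monomial d' 1 := by simp
      rw [this, map_mul, map_mul, HomogeneousLocalization.val_mul, map_add, pow_add, map_mul,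
        map_mul, mul_mul_mul_comm, hd, hd']
    | single l m =>
      have : (MvPolynomial.monomial (Finsupp.single l m) c : MvPolynomial (Fin 2) k) =
        .C c * .X l ^ m := by rw [MvPolynomial.C_mul_X_pow_eq_monomial]
      have h2 : (polyToAway k j i (dehom k j (.X l))).val *
        algebraMap (MvPolynomial (Fin 2) k) (Loc k j) (MvPolynomial.X j) =
        algebraMap (MvPolynomial (Fin 2) k) (Loc k j) (.X l) := by
        by_cases hl : l = j
        · subst hl
          rw [dehom_X_self, map_one, HomogeneousLocalization.val_one, one_mul]
        · have : l = i := by omega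
          subst this
          rw [dehom_X k hl]
          simp only [polyToAway, Polynomial.coe_eval₂RingHom, Polynomial.eval₂_X]
          exact val_frac_mul k j l
      rw [this, map_mul, map_mul, HomogeneousLocalization.val_mul, Finsupp.degree_single, map_pow,
        map_pow, map_pow, HomogeneousLocalization.val_pow, mul_assoc, ← mul_pow, h2, map_mul,
        map_pow, dehom_C]
      congr 1
      simp [polyToAway, val_awayConst]
  have hval : ∀ x : HomogeneousLocalization.Away (grading k) (MvPolynomial.X j),
      x.val = algebraMap _ (Loc k j) x := fun _ => rfl
  simp only [hval] at hmon ⊢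
  rw [f.as_sum]
  simp only [map_sum, Finset.sum_mul]
  refine Finset.sum_congr rfl fun d hd => ?_
  rw [← hmon d, ← hf (MvPolynomial.mem_support_iff.mp hd), Finsupp.degree_eq_weight_one]
  rfl

theorem polyToAway_bijective {j i : Fin 2} (h : i ≠ j) : Bijective (polyToAway k j i) := by
  refine ⟨LeftInverse.injective (awayToPoly_polyToAway k h),
    fun x => ?_⟩
  obtain ⟨n, f, hf, rfl⟩ := HomogeneousLocalization.Away.mk_surjective (grading k) (X_mem k j) x
  refine ⟨dehom k j f, val_ext k (n := n) ?_⟩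
  have hf' : f.IsHomogeneous n := by simpa using hf
  rw [val_polyToAway_dehom k h hf', val_mk_mul]

end P1

end RibbonCurve

/-! ### Coordinates on `ℙ¹` and functions on the overlap of the charts. -/

namespace RibbonCurve
open Function
namespace P1
variable (k : Type u) [Field k]

/-- The homogeneous prime ideal of a point of `ℙ¹`. -/
def primeOf {k : Type u} [Field k] (x : P1 k) : Ideal (MvPolynomial (Fin 2) k) :=
  ProjectiveSpectrum.asHomogeneousIdeal (𝒜 := grading k) x |>.toIdeal

instance primeOf_isPrime {k : Type u} [Field k] (x : P1 k) : (primeOf x).IsPrime :=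
  ProjectiveSpectrum.isPrime (𝒜 := grading k) x

/-- The value of a function on an open set of `ℙ¹` in the local ring of a point. -/
def evalAt {k : Type u} [Field k] (x : P1 k) {U : (P1 k).Opens} (hx : x ∈ U) :
    Γ(P1 k, U) →+* HomogeneousLocalization.AtPrime (grading k) (primeOf x) where
  toFun s := s.1 ⟨x, hx⟩
  map_one' := rfl
  map_mul' _ _ := rfl
  map_zero' := rfl
  map_add' _ _ := rfl

theorem evalAt_resO {k : Type u} [Field k] (x : P1 k) {U V : (P1 k).Opens} (h : U ≤ V) (hx : x ∈ U)
    (s : Γ(P1 k, V)) : evalAt x hx (resO h s) = evalAt x (h hx) s := rfl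

theorem ext_evalAt {k : Type u} [Field k] {U : (P1 k).Opens} {s t : Γ(P1 k, U)}
    (h : ∀ x (hx : x ∈ U), evalAt x hx s = evalAt x hx t) : s = t :=
  Subtype.ext (funext fun x => h x.1 x.2)

theorem val_evalAt_coordinate (j i : Fin 2) (x : P1 k) (hx : x ∈ chart k j) :
    (evalAt x hx (coordinate k j i)).val *
      algebraMap (MvPolynomial (Fin 2) k) (Localization.AtPrime (primeOf x)) (MvPolynomial.X j) =
      algebraMap (MvPolynomial (Fin 2) k) (Localization.AtPrime (primeOf x)) (MvPolynomial.X i) := by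
  have h1 : (MvPolynomial.X j : MvPolynomial (Fin 2) k) ^ 1 ∈ (primeOf x).primeCompl := by
    rw [pow_one]; exact hx
  have h2 := IsLocalization.mk'_spec (M := (primeOf x).primeCompl)
    (Localization.AtPrime (primeOf x)) (.X i) ⟨_, h1⟩
  rw [← Localization.mk_eq_mk'] at h2
  have h3 : algebraMap (MvPolynomial (Fin 2) k) (Localization.AtPrime (primeOf x))
      (MvPolynomial.X j ^ 1) = algebraMap (MvPolynomial (Fin 2) k) _ (MvPolynomial.X j) := by
    rw [pow_one]
  rw [← h3]
  exact h2

theorem isUnit_algebraMap_X {j : Fin 2} {x : P1 k} :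
    IsUnit (algebraMap (MvPolynomial (Fin 2) k) (Localization.AtPrime (primeOf x)) (MvPolynomial.X j)) ↔
      x ∈ chart k j :=
  IsLocalization.AtPrime.isUnit_to_map_iff (Localization.AtPrime (primeOf x)) (primeOf x) _

theorem coordinate_mul (j i : Fin 2) :
    resO (inf_le_left : chart k j ⊓ chart k i ≤ chart k j) (coordinate k j i) *
      resO (inf_le_right : chart k j ⊓ chart k i ≤ chart k i) (coordinate k i j) = 1 := by
  refine ext_evalAt fun x hx => HomogeneousLocalization.val_injective _ ?_
  rw [map_mul, map_one, evalAt_resO, evalAt_resO, HomogeneousLocalization.val_mul,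
    HomogeneousLocalization.val_one]
  refine ((isUnit_algebraMap_X k).mpr hx.2).mul_left_injective ?_
  change _ * _ = _ * _
  rw [mul_assoc, val_evalAt_coordinate, val_evalAt_coordinate, one_mul]

theorem chart_sup : chart k 0 ⊔ chart k 1 = ⊤ := by
  have h := Proj.iSup_basicOpen_eq_top' (grading k) (fun j : Fin 2 => (MvPolynomial.X j))
    (fun j => ⟨1, X_mem k j⟩) ?_
  · refine top_le_iff.mp fun x _ => ?_
    have hx : x ∈ ⨆ i : Fin 2, Proj.basicOpen (grading k) (MvPolynomial.X i) := by
      rw [h]; trivial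
    obtain ⟨i, hi⟩ := Opens.mem_iSup.mp hx
    fin_cases i
    · exact Or.inl hi
    · exact Or.inr hi
  · rw [eq_top_iff]
    intro f _
    induction f using MvPolynomial.induction_on with
    | C c => exact Subalgebra.algebraMap_mem _ (algebraMap k (grading k 0) c)
    | add p q hp hq => exact add_mem (hp trivial) (hq trivial)
    | mul_X p i hp => exact mul_mem (hp trivial) (Algebra.subset_adjoin ⟨i, rfl⟩)

/-- In the local ring of a point where `x_j` is invertible, `x_i / x_j` is a unit exactly when `x_i`
is. -/
theorem basicOpen_coordinate (j i : Fin 2) :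
    (P1 k).basicOpen (coordinate k j i) = chart k j ⊓ chart k i := by
  apply le_antisymm
  · refine le_inf ((P1 k).basicOpen_le _) fun x hx => ?_
    have hu : IsUnit (resO ((P1 k).basicOpen_le (coordinate k j i))
      (coordinate k j i)) := by
      refine isUnit_of_basicOpen_eq ?_
      rw [basicOpen_resO, inf_idem]
    have h1 := hu.map ((algebraMap (HomogeneousLocalization.AtPrime (grading k) (primeOf x))
      (Localization.AtPrime (primeOf x))).comp (evalAt x hx))
    refine (isUnit_algebraMap_X k).mp ?_
    rw [← val_evalAt_coordinate k j i x ((P1 k).basicOpen_le _ hx)]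
    exact h1.mul ((isUnit_algebraMap_X k).mpr ((P1 k).basicOpen_le _ hx))
  · have hu : IsUnit (resO (inf_le_left : chart k j ⊓ chart k i ≤ chart k j) (coordinate k j i)) :=
      IsUnit.of_mul_eq_one _ (coordinate_mul k j i)
    have h1 := basicOpen_resO (inf_le_left : chart k j ⊓ chart k i ≤ chart k j) (coordinate k j i)
    rw [Scheme.basicOpen_of_isUnit _ hu] at h1
    exact h1.le.trans inf_le_right

theorem resO_scalars {X : Scheme.{u}} (p : X ⟶ Spec (.of k)) {W V : X.Opens} (h : W ≤ V) (c : k) :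
    resO h (scalars p V c) = scalars p W c :=
  resO_resO h le_top _

/-- Polynomials as functions on a standard chart. -/
def chartPoly (j i : Fin 2) : Polynomial k →+* Γ(P1 k, chart k j) :=
  Polynomial.eval₂RingHom (scalars (P1.toSpec k) (chart k j)) (coordinate k j i)

theorem chartPoly_bijective {j i : Fin 2} (h : i ≠ j) : Bijective (chartPoly k j i) := by
  have : chartPoly k j i = (awaySection k j).comp
      (polyToAway k j i) := by
    refine Polynomial.ringHom_ext (fun c => ?_) ?_
    · simp [chartPoly, polyToAway, scalars_chart]
    · simp [chartPoly, polyToAway, coordinate]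
  rw [this]
  exact (awaySection_bijective k j).comp (polyToAway_bijective k h)

theorem chartPoly_C (j i : Fin 2) (c : k) :
    chartPoly k j i (Polynomial.C c) = scalars (P1.toSpec k) (chart k j) c := by
  simp [chartPoly]

theorem chartPoly_X (j i : Fin 2) : chartPoly k j i Polynomial.X = coordinate k j i := by
  simp [chartPoly]

/-- `Γ(ℙ¹, chart j)` is a polynomial ring. -/
def chartEquiv (j : Fin 2) : Polynomial k ≃+* Γ(P1 k, chart k j) :=
  RingEquiv.ofBijective (chartPoly k j (1 - j)) (chartPoly_bijective k (by fin_cases j <;> decide))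

instance (j : Fin 2) : IsDomain Γ(P1 k, chart k j) :=
  (chartEquiv k j).symm.toMulEquiv.isDomain _

instance (j : Fin 2) : IsPrincipalIdealRing Γ(P1 k, chart k j) :=
  IsPrincipalIdealRing.of_surjective (chartEquiv k j) (chartEquiv k j).surjective

/-- The coordinate on the overlap of the charts. -/
def overlapCoord : Γ(P1 k, chart k 0 ⊓ chart k 1)ˣ where
  val := resO inf_le_left (coordinate k 0 1)
  inv := resO inf_le_right (coordinate k 1 0)
  val_inv := coordinate_mul k 0 1
  inv_val := by rw [mul_comm]; exact coordinate_mul k 0 1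

open LaurentPolynomial in
/-- Laurent polynomials as functions on the overlap of the charts. -/
def overlapLaurent : k[T;T⁻¹] →+* Γ(P1 k, chart k 0 ⊓ chart k 1) :=
  LaurentPolynomial.eval₂ (scalars (P1.toSpec k) _) (overlapCoord k)

open LaurentPolynomial in
theorem overlapLaurent_C (c : k) :
    overlapLaurent k (C c) = scalars (P1.toSpec k) _ c := by
  simp [overlapLaurent]

open LaurentPolynomial in
theorem overlapLaurent_T (n : ℤ) :
    overlapLaurent k (T n) = (overlapCoord k ^ n).val := by
  simp [overlapLaurent]

open LaurentPolynomial in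
theorem overlapLaurent_toLaurent (p : Polynomial k) :
    overlapLaurent k p.toLaurent = resO inf_le_left (chartPoly k 0 1 p) := by
  have : (overlapLaurent k).comp Polynomial.toLaurent =
      (resO inf_le_left).comp (chartPoly k 0 1) := by
    refine Polynomial.ringHom_ext (fun c => ?_) ?_
    · simp [overlapLaurent_C, chartPoly_C, resO_scalars]
    · simp [overlapLaurent_T, chartPoly_X, overlapCoord]
  exact congr($this p)

open LaurentPolynomial in
theorem overlapLaurent_invert (p : Polynomial k) :
    overlapLaurent k (invert p.toLaurent) = resO inf_le_right (chartPoly k 1 0 p) := by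
  have : ((overlapLaurent k).comp (invert (R := k)).toRingHom).comp Polynomial.toLaurent =
      (resO inf_le_right).comp (chartPoly k 1 0) := by
    refine Polynomial.ringHom_ext (fun c => ?_) ?_
    · simp [overlapLaurent_C, chartPoly_C, resO_scalars]
    · simp [overlapLaurent_T, chartPoly_X, overlapCoord]
  exact congr($this p)

open LaurentPolynomial in
theorem overlapLaurent_bijective : Bijective (overlapLaurent k) := by
  have hT : ∀ n : ℤ, IsUnit (overlapLaurent k (T n)) := fun n => (isUnit_T n).map _
  constructor
  · rw [injective_iff_map_eq_zero]
    intro f hf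
    -- The overlap is the locus in the first chart where the coordinate is invertible. Multiplying
    -- by powers of the coordinate reduces both injectivity and surjectivity to polynomials.
    obtain ⟨n, p, hp⟩ := f.exists_T_pow
    have h1 : overlapLaurent k p.toLaurent = 0 := by rw [hp, map_mul, hf, zero_mul]
    rw [overlapLaurent_toLaurent] at h1
    obtain ⟨m, hm⟩ := exists_pow_mul_eq_zero (isAffineOpen_chart k 0) (coordinate k 0 1)
      (basicOpen_coordinate k 0 1).symm inf_le_left h1
    rw [← chartPoly_X, ← map_pow, ← map_mul, map_eq_zero_iff _ (chartPoly_bijective k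
      (by decide)).1] at hm
    have hp0 : p = 0 := by simpa using hm
    rw [hp0, map_zero] at hp
    exact (isUnit_T (n : ℤ)).mul_left_eq_zero.mp hp.symm
  · intro c
    obtain ⟨n, a, ha⟩ := exists_resO_eq_pow_mul (isAffineOpen_chart k 0) (coordinate k 0 1)
      (basicOpen_coordinate k 0 1).symm inf_le_left c
    obtain ⟨p, rfl⟩ := (chartPoly_bijective k (j := 0) (i := 1) (by decide)).2 a
    refine ⟨p.toLaurent * T (-n), ?_⟩
    have h2 : overlapLaurent k (T n) = resO inf_le_left (coordinate k 0 1) ^ n := by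
      rw [overlapLaurent_T]; simp [overlapCoord]
    rw [← h2, ← overlapLaurent_toLaurent] at ha
    rw [map_mul, ha, mul_right_comm, ← map_mul, ← T_add]
    simp

end P1
end RibbonCurve

namespace RibbonCurve
open Function

/-! ### Generators of the kernel of a thickening -/

/-- The kernel of `φ : A → B` is generated by `ε`, and the annihilator of `ε` is the kernel. -/
structure IsKerGen {A B : Type*} [CommRing A] [CommRing B] (φ : A →+* B) (ε : A) : Prop where
  map_eq_zero : φ ε = 0
  exists_eq_mul : ∀ a, φ a = 0 → ∃ c, a = c * ε
  mul_eq_zero_iff : ∀ c, c * ε = 0 ↔ φ c = 0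

namespace IsKerGen

variable {A B : Type*} [CommRing A] [CommRing B] {φ : A →+* B} {ε : A} (h : IsKerGen φ ε)
include h

theorem mul_eq_mul_iff {c d : A} : c * ε = d * ε ↔ φ c = φ d := by
  rw [← sub_eq_zero, ← sub_mul, h.mul_eq_zero_iff, map_sub, sub_eq_zero]

theorem unit_mul {v : A} (hv : IsUnit v) : IsKerGen φ (v * ε) where
  map_eq_zero := by rw [map_mul, h.map_eq_zero, mul_zero]
  exists_eq_mul a ha := by
    obtain ⟨c, rfl⟩ := h.exists_eq_mul a ha
    obtain ⟨w, hw⟩ := hv.exists_left_inv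
    exact ⟨c * w, by linear_combination (-c * ε) * hw⟩
  mul_eq_zero_iff c := by
    rw [mul_left_comm, hv.mul_right_eq_zero, h.mul_eq_zero_iff]

theorem comp_injective {C : Type*} [CommRing C] {ψ : B →+* C} (hψ : Injective ψ) :
    IsKerGen (ψ.comp φ) ε where
  map_eq_zero := by rw [RingHom.comp_apply, h.map_eq_zero, map_zero]
  exists_eq_mul a ha := h.exists_eq_mul a ((map_eq_zero_iff ψ hψ).mp ha)
  mul_eq_zero_iff c := by rw [h.mul_eq_zero_iff, RingHom.comp_apply, map_eq_zero_iff ψ hψ]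

/-- Two generators differ by a function whose image is invertible. -/
theorem exists_mul_eq {ε' : A} (h' : IsKerGen φ ε') : ∃ w, ε' = w * ε ∧ IsUnit (φ w) := by
  obtain ⟨w, hw⟩ := h.exists_eq_mul ε' h'.map_eq_zero
  obtain ⟨w', hw'⟩ := h'.exists_eq_mul ε h.map_eq_zero
  refine ⟨w, hw, IsUnit.of_mul_eq_one (φ w') ?_⟩
  rw [← map_mul, ← map_one φ, ← h.mul_eq_mul_iff, one_mul]
  linear_combination -hw' - w' * hw

end IsKerGen

/-- Since `I ^ 2 = 0`, the ideal is its own cotangent module. This is invertible over `A ⧸ I ≅ B`,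
hence free of rank one because `B` is a principal ideal domain. -/
theorem exists_isKerGen_of_invertible_cotangent {A B : Type*} [CommRing A] [CommRing B]
    [IsDomain B] [IsPrincipalIdealRing B] (φ : A →+* B) (hφ : Surjective φ) (I : Ideal A)
    (hI : I = RingHom.ker φ) (hsq : I ^ 2 = ⊥) [Module.Invertible (A ⧸ I) I.Cotangent] :
    ∃ ε, IsKerGen φ ε := by
  have e : A ⧸ I ≃+* B := (Ideal.quotEquivOfEq hI).trans (RingHom.quotientKerEquivOfSurjective hφ)
  have : IsDomain (A ⧸ I) := e.toMulEquiv.isDomain _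
  have : IsPrincipalIdealRing (A ⧸ I) := IsPrincipalIdealRing.of_surjective e.symm e.symm.surjective
  have : Module.Free (A ⧸ I) I.Cotangent := Module.free_of_finite_type_torsion_free'
  obtain ⟨f⟩ := Module.Invertible.free_iff_linearEquiv.mp this
  obtain ⟨ε, hε⟩ := I.toCotangent_surjective (f.symm 1)
  have hmem : ∀ {a}, a ∈ I ↔ φ a = 0 := by simp [hI]
  have hz : ∀ x : I, I.toCotangent x = 0 ↔ (x : A) = 0 := by
    intro x
    rw [I.toCotangent_eq_zero, hsq, Ideal.mem_bot]
  have hsm : ∀ c : A, I.toCotangent (c • ε) = f.symm (Ideal.Quotient.mk I c) := by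
    intro c
    rw [map_smul, hε]
    have : c • f.symm 1 = (Ideal.Quotient.mk I c) • f.symm 1 := rfl
    rw [this, ← map_smul, smul_eq_mul, mul_one]
  refine ⟨ε, hmem.mp ε.2, fun a ha => ?_, fun c => ?_⟩
  · obtain ⟨c, hc⟩ := Ideal.Quotient.mk_surjective (f (I.toCotangent ⟨a, hmem.mpr ha⟩))
    refine ⟨c, ?_⟩
    have h1 : I.toCotangent (⟨a, hmem.mpr ha⟩ - c • ε) = 0 := by
      rw [map_sub, hsm, hc, f.symm_apply_apply, sub_self]
    exact sub_eq_zero.mp ((hz _).mp h1)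
  · rw [← hmem, ← Ideal.Quotient.eq_zero_iff_mem, ← f.symm.map_eq_zero_iff, ← hsm, hz]
    rfl

section
variable {X Z : Scheme.{u}} {i : Z ⟶ X}

/-- Both conditions on a generator survive localization: denominators are cleared by powers of `f`,
which are invertible on `W`. -/
theorem IsThickening.isKerGen_res (hi : IsThickening i) {V W : X.Opens} (hV : IsAffineOpen V)
    (hV' : IsAffineOpen (i ⁻¹ᵁ V)) (f : Γ(X, V)) (hW : W = X.basicOpen f) (hWV : W ≤ V)
    {ε : Γ(X, V)} (h : IsKerGen (pb i V) ε) : IsKerGen (pb i W) (resO hWV ε) := by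
  have hu : IsUnit (resO hWV f) := isUnit_of_basicOpen_eq (by
    rw [basicOpen_resO, ← hW, inf_idem])
  have hW' : i ⁻¹ᵁ W = Z.basicOpen (pb i V f) := by rw [hW, preimage_basicOpen_pb]
  refine ⟨by rw [pb_resO, h.map_eq_zero, map_zero], fun a ha => ?_, fun c => ⟨fun hc => ?_,
    fun hc => hi.sq_zero _ _ _ hc (by rw [pb_resO, h.map_eq_zero, map_zero])⟩⟩
  · obtain ⟨n, a', ha'⟩ := exists_resO_eq_pow_mul hV f hW hWV a
    have h1 : resO (i.preimage_mono hWV) (pb i V a') = 0 := by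
      rw [← pb_resO i hWV, ha', map_mul, ha, mul_zero]
    obtain ⟨m, hm⟩ := exists_pow_mul_eq_zero hV' _ hW' _ h1
    rw [← map_pow, ← map_mul] at hm
    obtain ⟨c, hc⟩ := h.exists_eq_mul _ hm
    obtain ⟨w, hw⟩ := (hu.pow (m + n)).exists_left_inv
    refine ⟨w * resO hWV c, ?_⟩
    have h2 := congr(resO hWV $hc)
    rw [map_mul, map_mul, ha', map_pow] at h2
    rw [pow_add] at hw
    linear_combination w * h2 - a * hw
  · obtain ⟨n, c', hc'⟩ := exists_resO_eq_pow_mul hV f hW hWV c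
    have h1 : resO hWV (c' * ε) = 0 := by
      rw [map_mul, hc', mul_assoc, hc, mul_zero]
    obtain ⟨m, hm⟩ := exists_pow_mul_eq_zero hV _ hW _ h1
    rw [← mul_assoc, h.mul_eq_zero_iff] at hm
    have h2 := congr(resO (i.preimage_mono hWV) $hm)
    rw [map_zero, ← pb_resO i hWV, map_mul, map_pow, hc', ← mul_assoc, map_mul] at h2
    exact (((hu.pow m).mul (hu.pow n)).map (pb i W)).mul_right_eq_zero.mp h2

end

end RibbonCurve

/-! ### The charts of a ribbon and their restriction to the projective line. -/

namespace Ribbon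
open RibbonCurve Function
variable {k : Type u} [Field k] (C : Ribbon k)

/-- The support of the nilradical is the whole space, so the closed immersion is surjective. -/
theorem isThickening : IsThickening C.incl where
  isClosedImmersion := C.isClosedImmersion
  surjective := by
    have := C.isClosedImmersion
    have h := C.incl.support_ker
    rw [C.ker_eq_nilradical, Scheme.support_nilradical,
      C.incl.isClosedEmbedding.isClosed_range.closure_eq] at h
    exact Set.range_eq_univ.mp h.symm
  sq_zero W a b ha hb := by
    have := C.isClosedImmersion
    have haff : ∀ V : C.scheme.affineOpens, ∀ a b : Γ(C.scheme, V), pb C.incl V a = 0 →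
        pb C.incl V b = 0 → a * b = 0 := by
      intro V a b ha hb
      have h := congr(($(C.ker_sq)).ideal V)
      have h1 : C.incl.ker.ideal V ^ 2 = ⊥ := h
      rw [C.incl.ker_apply V] at h1
      rw [← Ideal.mem_bot, ← h1, pow_two]
      exact Ideal.mul_mem_mul ha hb
    -- The square-zero condition on an ideal sheaf is read on affine open sets; the sheaf property
    -- extends it to arbitrary ones.
    refine TopCat.Sheaf.eq_of_locally_eq' C.scheme.sheaf
      (fun V : {V : C.scheme.affineOpens // V.1 ≤ W} => V.1.1) W (fun V => homOfLE V.2) ?_ _ _ ?_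
    · intro x hx
      obtain ⟨_, ⟨V, hV, rfl⟩, hxV, hVW⟩ :=
        C.scheme.isBasis_affineOpens.exists_subset_of_mem_open hx W.2
      exact Opens.mem_iSup.mpr ⟨⟨⟨V, hV⟩, hVW⟩, hxV⟩
    · intro V
      change resO V.2 (a * b) = resO V.2 0
      rw [map_mul, map_zero]
      exact haff V.1 _ _ (by rw [pb_resO, ha, map_zero]) (by rw [pb_resO, hb, map_zero])

theorem preimage_chart (j : Fin 2) : C.incl ⁻¹ᵁ C.chart j = P1.chart k j := by
  have := C.isClosedImmersion
  have hinj := C.incl.isClosedEmbedding.injective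
  ext x
  change ¬ (C.incl x ∈ C.incl '' ((P1.chart k j : Set (P1 k))ᶜ)) ↔ _
  rw [hinj.mem_set_image]
  simp

theorem chart_sup : C.chart 0 ⊔ C.chart 1 = ⊤ := by
  rw [← C.isThickening.preimage_inj]
  change (C.incl ⁻¹ᵁ C.chart 0) ⊔ (C.incl ⁻¹ᵁ C.chart 1) = ⊤
  rw [preimage_chart, preimage_chart, P1.chart_sup]

theorem preimage_chart_inf : C.incl ⁻¹ᵁ (C.chart 0 ⊓ C.chart 1) = P1.chart k 0 ⊓ P1.chart k 1 := by
  rw [← C.preimage_chart, ← C.preimage_chart]; rfl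

instance (j : Fin 2) : IsDomain Γ(P1 k, C.incl ⁻¹ᵁ C.chart j) := by
  rw [preimage_chart]; infer_instance

instance (j : Fin 2) : IsPrincipalIdealRing Γ(P1 k, C.incl ⁻¹ᵁ C.chart j) := by
  rw [preimage_chart]; infer_instance

theorem isAffineOpen_preimage_chart (j : Fin 2) : IsAffineOpen (C.incl ⁻¹ᵁ C.chart j) := by
  rw [preimage_chart]; exact P1.isAffineOpen_chart k j

theorem isAffineOpen_chart (j : Fin 2) : IsAffineOpen (C.chart j) :=
  C.isThickening.isAffineOpen (C.isAffineOpen_preimage_chart j)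

/-- Restriction of functions on a chart to the projective line. -/
def toP1 (j : Fin 2) : Γ(C.scheme, C.chart j) →+* Γ(P1 k, P1.chart k j) :=
  (resO (C.preimage_chart j).ge).comp (pb C.incl (C.chart j))

/-- Restriction of functions on the overlap of the charts to the projective line. -/
def toP1Overlap : Γ(C.scheme, C.chart 0 ⊓ C.chart 1) →+* Γ(P1 k, P1.chart k 0 ⊓ P1.chart k 1) :=
  (resO C.preimage_chart_inf.ge).comp (pb C.incl (C.chart 0 ⊓ C.chart 1))

theorem resO_bijective_of_eq {X : Scheme.{u}} {V W : X.Opens} (h : V = W) :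
    Bijective (resO h.le) := by
  subst h
  convert! bijective_id using 1
  exact funext fun x => resO_self _ x

theorem toP1_surjective (j : Fin 2) : Surjective (C.toP1 j) :=
  (resO_bijective_of_eq (C.preimage_chart j).symm).2.comp
    (C.isThickening.pb_surjective (C.isAffineOpen_chart j))

theorem exists_isKerGen (j : Fin 2) : ∃ ε, IsKerGen (pb C.incl (C.chart j)) ε := by
  have := C.isClosedImmersion
  have := C.conormal_invertible ⟨C.chart j, C.isAffineOpen_chart j⟩
  refine exists_isKerGen_of_invertible_cotangent _
    (C.isThickening.pb_surjective (C.isAffineOpen_chart j)) (C.incl.ker.ideal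
      ⟨C.chart j, C.isAffineOpen_chart j⟩) (C.incl.ker_apply _) ?_
  exact congr(($(C.ker_sq)).ideal ⟨C.chart j, C.isAffineOpen_chart j⟩)

/-- Open sets of the ribbon are determined by their traces on `ℙ¹`, so any lift of the coordinate
cuts out the overlap. -/
theorem chart_inf_eq_basicOpen (j i : Fin 2) {a : Γ(C.scheme, C.chart j)}
    (ha : C.toP1 j a = P1.coordinate k j i) : C.chart j ⊓ C.chart i = C.scheme.basicOpen a := by
  rw [← C.isThickening.preimage_inj, preimage_basicOpen_pb]
  change (C.incl ⁻¹ᵁ C.chart j) ⊓ (C.incl ⁻¹ᵁ C.chart i) = _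
  have h1 := basicOpen_resO (C.preimage_chart j).ge (pb C.incl _ a)
  have h2 : (P1 k).basicOpen (resO (C.preimage_chart j).ge (pb C.incl _ a)) = _ :=
    congrArg (P1 k).basicOpen ha
  rw [P1.basicOpen_coordinate, h1] at h2
  have h3 : (C.incl ⁻¹ᵁ C.chart j) ⊓ (C.incl ⁻¹ᵁ C.chart i) = P1.chart k j ⊓ P1.chart k i := by
    rw [preimage_chart, preimage_chart]
  rw [h3, ← h2, inf_eq_right]
  exact ((P1 k).basicOpen_le _).trans (C.preimage_chart j).le

theorem toP1Overlap_left (a : Γ(C.scheme, C.chart 0)) :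
    C.toP1Overlap (resO inf_le_left a) = resO inf_le_left (C.toP1 0 a) := by
  simp only [toP1Overlap, toP1, RingHom.comp_apply, pb_resO C.incl inf_le_left, resO_resO]

theorem toP1Overlap_right (a : Γ(C.scheme, C.chart 1)) :
    C.toP1Overlap (resO inf_le_right a) = resO inf_le_right (C.toP1 1 a) := by
  simp only [toP1Overlap, toP1, RingHom.comp_apply, pb_resO C.incl inf_le_right, resO_resO]

theorem isAffineOpen_overlap : IsAffineOpen (C.chart 0 ⊓ C.chart 1) := by
  obtain ⟨a, ha⟩ := C.toP1_surjective 0 (P1.coordinate k 0 1)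
  rw [C.chart_inf_eq_basicOpen 0 1 ha]
  exact (C.isAffineOpen_chart 0).basicOpen a

theorem toP1Overlap_surjective : Surjective C.toP1Overlap :=
  (resO_bijective_of_eq C.preimage_chart_inf.symm).2.comp
    (C.isThickening.pb_surjective C.isAffineOpen_overlap)

theorem isKerGen_toP1 {j : Fin 2} {ε : Γ(C.scheme, C.chart j)}
    (h : IsKerGen (pb C.incl (C.chart j)) ε) : IsKerGen (C.toP1 j) ε :=
  h.comp_injective (resO_bijective_of_eq (C.preimage_chart j).symm).1

theorem isKerGen_left {ε : Γ(C.scheme, C.chart 0)} (h : IsKerGen (pb C.incl (C.chart 0)) ε) :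
    IsKerGen C.toP1Overlap (resO inf_le_left ε) := by
  obtain ⟨a, ha⟩ := C.toP1_surjective 0 (P1.coordinate k 0 1)
  exact (C.isThickening.isKerGen_res (C.isAffineOpen_chart 0) (C.isAffineOpen_preimage_chart 0) a
    (C.chart_inf_eq_basicOpen 0 1 ha) _ h).comp_injective
      (resO_bijective_of_eq C.preimage_chart_inf.symm).1

theorem isKerGen_right {ε : Γ(C.scheme, C.chart 1)} (h : IsKerGen (pb C.incl (C.chart 1)) ε) :
    IsKerGen C.toP1Overlap (resO inf_le_right ε) := by
  obtain ⟨a, ha⟩ := C.toP1_surjective 1 (P1.coordinate k 1 0)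
  exact (C.isThickening.isKerGen_res (C.isAffineOpen_chart 1) (C.isAffineOpen_preimage_chart 1) a
    ((inf_comm _ _).trans (C.chart_inf_eq_basicOpen 1 0 ha)) _ h).comp_injective
      (resO_bijective_of_eq C.preimage_chart_inf.symm).1

theorem pb_scalars {X Z : Scheme.{u}} {i : Z ⟶ X} {p : X ⟶ Spec (.of k)} {q : Z ⟶ Spec (.of k)}
    (h : i ≫ p = q) (W : X.Opens) (c : k) : pb i W (scalars p W c) = scalars q (i ⁻¹ᵁ W) c := by
  subst h
  change pb i W (resO le_top _) = _
  rw [pb_resO i le_top]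
  rfl

theorem toP1_scalars (j : Fin 2) (c : k) :
    C.toP1 j (scalars C.toSpec _ c) = scalars (P1.toSpec k) _ c := by
  rw [toP1, RingHom.comp_apply, pb_scalars C.incl_toSpec, P1.resO_scalars]

theorem toP1Overlap_scalars (c : k) :
    C.toP1Overlap (scalars C.toSpec _ c) = scalars (P1.toSpec k) _ c := by
  rw [toP1Overlap, RingHom.comp_apply, pb_scalars C.incl_toSpec, P1.resO_scalars]

end Ribbon

/-! ### Functions as `k`-algebras, free thickenings, and units of Laurent polynomials. -/

namespace RibbonCurve
open Function
variable {k : Type u} [Field k]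

/-- The functions on an open subset of a scheme over `k`, as a `k`-algebra. -/
def Functions {X : Scheme.{u}} (_p : X ⟶ Spec (.of k)) (U : X.Opens) : Type u :=
  Γ(X, U)

instance {X : Scheme.{u}} (p : X ⟶ Spec (.of k)) (U : X.Opens) : CommRing (Functions p U) :=
  inferInstanceAs (CommRing Γ(X, U))

instance {X : Scheme.{u}} (p : X ⟶ Spec (.of k)) (U : X.Opens) : Algebra k (Functions p U) :=
  (scalars p U).toAlgebra

/-- Restriction of functions as an algebra homomorphism. -/
def Functions.res {X : Scheme.{u}} (p : X ⟶ Spec (.of k)) {U V : X.Opens}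
    (h : U ≤ V) : Functions p V →ₐ[k] Functions p U where
  toRingHom := resO h
  commutes' := P1.resO_scalars k p h

/-- A free thickening from a generator of the kernel. -/
def FreeThickening.ofIsKerGen {A B : Type*} [CommRing A] [CommRing B]
    [Algebra k A] [Algebra k B] (ρ : A →ₐ[k] B) (hρ : Surjective ρ) {ε : A}
    (h : IsKerGen (ρ : A →+* B) ε) : FreeThickening k A B where
  ρ := ρ
  -- The chosen lift of `p` is neither additive nor linear, but its product with `ε` depends only on
  -- `p`.
  ν :=
    { toFun := fun p => surjInv hρ p * ε
      map_add' := fun p q => by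
        rw [← add_mul]
        refine h.mul_eq_mul_iff.mpr ?_
        simp [surjInv_eq hρ]
      map_smul' := fun c p => by
        rw [RingHom.id_apply, ← smul_mul_assoc]
        refine h.mul_eq_mul_iff.mpr ?_
        simp [surjInv_eq hρ] }
  surjective := hρ
  injective p q hpq := by
    have := h.mul_eq_mul_iff.mp hpq
    simpa [surjInv_eq hρ] using this
  exact a := by
    refine ⟨fun ha => ?_, ?_⟩
    · obtain ⟨c, rfl⟩ := h.exists_eq_mul a ha
      refine ⟨ρ c, h.mul_eq_mul_iff.mpr ?_⟩
      simp [surjInv_eq hρ]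
    · rintro ⟨p, rfl⟩
      have : ρ ε = 0 := h.map_eq_zero
      simp [this]
  mul_ν a p := by
    change a * (surjInv hρ p * ε) = surjInv hρ (ρ a * p) * ε
    rw [← mul_assoc]
    refine h.mul_eq_mul_iff.mpr ?_
    simp [surjInv_eq hρ]

theorem FreeThickening.ofIsKerGen_ν {A B : Type*} [CommRing A] [CommRing B]
    [Algebra k A] [Algebra k B] (ρ : A →ₐ[k] B) (hρ : Surjective ρ) {ε : A}
    (h : IsKerGen (ρ : A →+* B) ε) (a : A) :
    (FreeThickening.ofIsKerGen ρ hρ h).ν (ρ a) = a * ε := by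
  refine h.mul_eq_mul_iff.mpr ?_
  simp [surjInv_eq hρ]

open LaurentPolynomial in
-- After clearing denominators, `f` and its inverse become polynomials with product a power of the
-- prime `X`, so each is a unit times a power of `X`.
theorem exists_eq_C_mul_T_of_isUnit {f : k[T;T⁻¹]} (hf : IsUnit f) :
    ∃ (c : k) (n : ℤ), c ≠ 0 ∧ f = LaurentPolynomial.C c * T n := by
  obtain ⟨g, hg⟩ := hf.exists_right_inv
  obtain ⟨a, p, hp⟩ := f.exists_T_pow
  obtain ⟨b, q, hq⟩ := g.exists_T_pow
  have hpq : p * q = Polynomial.X ^ (a + b) := by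
    apply Polynomial.toLaurent_injective
    rw [map_mul, hp, hq, Polynomial.toLaurent_X_pow, Nat.cast_add, T_add]
    linear_combination (T a * T b) * hg
  obtain ⟨m, -, hm⟩ := (dvd_prime_pow Polynomial.prime_X _).mp ⟨q, hpq.symm⟩
  obtain ⟨v, hv⟩ := hm.symm
  obtain ⟨c, hc, hc'⟩ := Polynomial.isUnit_iff.mp v.isUnit
  refine ⟨c, m - a, hc.ne_zero, ?_⟩
  have h1 : f = Polynomial.toLaurent p * T (-a) := by
    rw [hp, mul_assoc, ← T_add]; simp
  rw [h1, ← hv, ← hc', map_mul, Polynomial.toLaurent_X_pow, Polynomial.toLaurent_C, sub_eq_add_neg,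
    T_add]
  ring

end RibbonCurve

namespace Ribbon
open RibbonCurve Function Polynomial LaurentPolynomial
variable {k : Type u} [Field k] (C : Ribbon k)

/-! ### The algebra of a ribbon -/

/-- Functions on the first chart of the projective line are polynomials. -/
def polyEquiv₀ (k : Type u) [Field k] : k[X] ≃+* Γ(P1 k, P1.chart k 0) :=
  RingEquiv.ofBijective (P1.chartPoly k 0 1) (P1.chartPoly_bijective k (by decide))

/-- Functions on the second chart of the projective line are polynomials. -/
def polyEquiv₁ (k : Type u) [Field k] : k[X] ≃+* Γ(P1 k, P1.chart k 1) :=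
  RingEquiv.ofBijective (P1.chartPoly k 1 0) (P1.chartPoly_bijective k (by decide))

/-- Functions on the overlap of the charts of the projective line are Laurent polynomials. -/
def laurentEquiv (k : Type u) [Field k] : k[T;T⁻¹] ≃+* Γ(P1 k, P1.chart k 0 ⊓ P1.chart k 1) :=
  RingEquiv.ofBijective (P1.overlapLaurent k) (P1.overlapLaurent_bijective k)

/-- Restriction to the projective line of functions on the first chart. -/
def ρ₀ : Functions C.toSpec (C.chart 0) →ₐ[k] k[X] where
  toRingHom := (polyEquiv₀ k).symm.toRingHom.comp (C.toP1 0)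
  commutes' c := by
    change (polyEquiv₀ k).symm (C.toP1 0 (scalars C.toSpec _ c)) = _
    rw [RingEquiv.symm_apply_eq, toP1_scalars]
    exact (P1.chartPoly_C k 0 1 c).symm

/-- Restriction to the projective line of functions on the second chart. -/
def ρ₁ : Functions C.toSpec (C.chart 1) →ₐ[k] k[X] where
  toRingHom := (polyEquiv₁ k).symm.toRingHom.comp (C.toP1 1)
  commutes' c := by
    change (polyEquiv₁ k).symm (C.toP1 1 (scalars C.toSpec _ c)) = _
    rw [RingEquiv.symm_apply_eq, toP1_scalars]
    exact (P1.chartPoly_C k 1 0 c).symm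

/-- Restriction to the projective line of functions on the overlap of the charts. -/
def ρ : Functions C.toSpec (C.chart 0 ⊓ C.chart 1) →ₐ[k] k[T;T⁻¹] where
  toRingHom := (laurentEquiv k).symm.toRingHom.comp
    C.toP1Overlap
  commutes' c := by
    change (laurentEquiv k).symm (C.toP1Overlap (scalars C.toSpec _ c)) = _
    rw [RingEquiv.symm_apply_eq, toP1Overlap_scalars]
    exact (P1.overlapLaurent_C k c).symm

theorem chartPoly_ρ₀ (a : Functions C.toSpec (C.chart 0)) :
    P1.chartPoly k 0 1 (C.ρ₀ a) = C.toP1 0 a :=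
  (polyEquiv₀ k).apply_symm_apply _

theorem chartPoly_ρ₁ (a : Functions C.toSpec (C.chart 1)) :
    P1.chartPoly k 1 0 (C.ρ₁ a) = C.toP1 1 a :=
  (polyEquiv₁ k).apply_symm_apply _

theorem overlapLaurent_ρ (a : Functions C.toSpec (C.chart 0 ⊓ C.chart 1)) :
    P1.overlapLaurent k (C.ρ a) = C.toP1Overlap a :=
  (laurentEquiv k).apply_symm_apply _

theorem ρ₀_surjective : Surjective C.ρ₀ :=
  (polyEquiv₀ k).symm.surjective.comp (C.toP1_surjective 0)

theorem ρ₁_surjective : Surjective C.ρ₁ :=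
  (polyEquiv₁ k).symm.surjective.comp (C.toP1_surjective 1)

theorem ρ_surjective : Surjective C.ρ :=
  (laurentEquiv k).symm.surjective.comp C.toP1Overlap_surjective

/-- Restriction of functions from the first chart to the overlap. -/
def r₀ : Functions C.toSpec (C.chart 0) →ₐ[k] Functions C.toSpec (C.chart 0 ⊓ C.chart 1) :=
  Functions.res C.toSpec inf_le_left

/-- Restriction of functions from the second chart to the overlap. -/
def r₁ : Functions C.toSpec (C.chart 1) →ₐ[k] Functions C.toSpec (C.chart 0 ⊓ C.chart 1) :=
  Functions.res C.toSpec inf_le_right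

theorem ρ_r₀ (a) : C.ρ (C.r₀ a) = toLaurent (C.ρ₀ a) := by
  apply (P1.overlapLaurent_bijective k).1
  rw [overlapLaurent_ρ, P1.overlapLaurent_toLaurent, chartPoly_ρ₀]
  exact C.toP1Overlap_left a

theorem ρ_r₁ (a) : C.ρ (C.r₁ a) = invert (toLaurent (C.ρ₁ a)) := by
  apply (P1.overlapLaurent_bijective k).1
  rw [overlapLaurent_ρ, P1.overlapLaurent_invert, chartPoly_ρ₁]
  exact C.toP1Overlap_right a

/-- The generators of the ideal on the two charts differ on the overlap by a function reducing to a
unit `c T ^ e`. The scalar is absorbed into the second generator, and the exponent is the degree of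
the conormal bundle. -/
theorem exists_generators : ∃ (e : ℤ) (ε₀ : Functions C.toSpec (C.chart 0))
    (ε₁ : Functions C.toSpec (C.chart 1)) (w : Functions C.toSpec (C.chart 0 ⊓ C.chart 1)),
    IsKerGen (C.ρ₀ : _ →+* k[X]) ε₀ ∧ IsKerGen (C.ρ₁ : _ →+* k[X]) ε₁ ∧
    IsKerGen (C.ρ : _ →+* k[T;T⁻¹]) (C.r₀ ε₀) ∧ C.r₁ ε₁ = w * C.r₀ ε₀ ∧ C.ρ w = T e := by
  obtain ⟨(ε₀ : Functions C.toSpec (C.chart 0)), h₀⟩ := C.exists_isKerGen 0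
  obtain ⟨(ε₁ : Functions C.toSpec (C.chart 1)), h₁⟩ := C.exists_isKerGen 1
  have g₀ : IsKerGen (C.ρ : _ →+* k[T;T⁻¹]) (C.r₀ ε₀) :=
    (C.isKerGen_left h₀).comp_injective (ψ := (laurentEquiv k).symm.toRingHom)
      (laurentEquiv k).symm.injective
  have g₁ : IsKerGen (C.ρ : _ →+* k[T;T⁻¹]) (C.r₁ ε₁) :=
    (C.isKerGen_right h₁).comp_injective (ψ := (laurentEquiv k).symm.toRingHom)
      (laurentEquiv k).symm.injective
  obtain ⟨w, hw, hu⟩ := g₀.exists_mul_eq g₁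
  obtain ⟨c, e, hc, he⟩ := exists_eq_C_mul_T_of_isUnit hu
  have he' : C.ρ w = LaurentPolynomial.C c * T e := he
  refine ⟨e, ε₀, algebraMap k _ c⁻¹ * ε₁, algebraMap k _ c⁻¹ * w,
    (C.isKerGen_toP1 h₀).comp_injective (ψ := (polyEquiv₀ k).symm.toRingHom)
      (polyEquiv₀ k).symm.injective,
    ((C.isKerGen_toP1 h₁).comp_injective (ψ := (polyEquiv₁ k).symm.toRingHom)
      (polyEquiv₁ k).symm.injective).unit_mul
      ((IsUnit.mk0 _ (inv_ne_zero hc)).map _), g₀, ?_, ?_⟩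
  · rw [map_mul, hw, AlgHom.commutes, mul_assoc]
  · rw [map_mul, he', AlgHom.commutes, LaurentPolynomial.algebraMap_apply, ← mul_assoc, ← map_mul]
    simp [hc]

theorem exists_ribbonAlgebra : ∃ D : RibbonAlgebra k (Functions C.toSpec (C.chart 0))
    (Functions C.toSpec (C.chart 1)) (Functions C.toSpec (C.chart 0 ⊓ C.chart 1)),
    D.F₀.ρ = C.ρ₀ ∧ D.F₁.ρ = C.ρ₁ ∧ D.F.ρ = C.ρ ∧ D.r₀ = C.r₀ ∧ D.r₁ = C.r₁ := by
  obtain ⟨e, ε₀, ε₁, w, h₀, h₁, h, hw, he⟩ := C.exists_generators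
  refine ⟨{ F₀ := .ofIsKerGen C.ρ₀ C.ρ₀_surjective h₀
            F₁ := .ofIsKerGen C.ρ₁ C.ρ₁_surjective h₁
            F := .ofIsKerGen C.ρ C.ρ_surjective h
            r₀ := C.r₀
            r₁ := C.r₁
            e := e
            ρ_r₀ := C.ρ_r₀
            ρ_r₁ := C.ρ_r₁
            r₀_ν := fun p => ?_
            r₁_ν := fun p => ?_ }, rfl, rfl, rfl, rfl, rfl⟩
  · obtain ⟨a, rfl⟩ := C.ρ₀_surjective p
    rw [FreeThickening.ofIsKerGen_ν, ← C.ρ_r₀, FreeThickening.ofIsKerGen_ν, map_mul]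
  · obtain ⟨a, rfl⟩ := C.ρ₁_surjective p
    rw [FreeThickening.ofIsKerGen_ν, ← C.ρ_r₁, ← he, ← map_mul, FreeThickening.ofIsKerGen_ν, map_mul,
      hw]
    ring

/-- The algebra of a ribbon. -/
def algebra : RibbonAlgebra k (Functions C.toSpec (C.chart 0))
    (Functions C.toSpec (C.chart 1)) (Functions C.toSpec (C.chart 0 ⊓ C.chart 1)) :=
  C.exists_ribbonAlgebra.choose

theorem algebra_ρ₀ : C.algebra.F₀.ρ = C.ρ₀ := C.exists_ribbonAlgebra.choose_spec.1
theorem algebra_ρ₁ : C.algebra.F₁.ρ = C.ρ₁ := C.exists_ribbonAlgebra.choose_spec.2.1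
theorem algebra_ρ : C.algebra.F.ρ = C.ρ := C.exists_ribbonAlgebra.choose_spec.2.2.1
theorem algebra_r₀ : C.algebra.r₀ = C.r₀ := C.exists_ribbonAlgebra.choose_spec.2.2.2.1
theorem algebra_r₁ : C.algebra.r₁ = C.r₁ := C.exists_ribbonAlgebra.choose_spec.2.2.2.2

end Ribbon

namespace RibbonCurve
open Function

/-! ### Cohomology from generators -/

section
variable {k A A' B B' : Type*} [Field k] [AddCommGroup A] [Module k A] [AddCommGroup A']
  [Module k A'] [AddCommGroup B] [Module k B] [AddCommGroup B'] [Module k B']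

/-- Isomorphic linear maps have isomorphic kernels. -/
def kerEquiv (d : A →ₗ[k] B) (d' : A' →ₗ[k] B') (E : A ≃ₗ[k] A') (F : B ≃ₗ[k] B')
    (h : ∀ a, d' (E a) = F (d a)) : LinearMap.ker d ≃ₗ[k] LinearMap.ker d' :=
  E.ofSubmodules _ _ (by
    ext x
    obtain ⟨a, rfl⟩ := E.surjective x
    simp [h])

/-- Isomorphic linear maps have isomorphic cokernels. -/
def cokerEquiv (d : A →ₗ[k] B) (d' : A' →ₗ[k] B') (E : A ≃ₗ[k] A') (F : B ≃ₗ[k] B')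
    (h : ∀ a, d' (E a) = F (d a)) : (B ⧸ LinearMap.range d) ≃ₗ[k] (B' ⧸ LinearMap.range d') :=
  Submodule.Quotient.equiv _ _ F (by
    ext x
    constructor
    · rintro ⟨_, ⟨a, rfl⟩, rfl⟩
      exact ⟨E a, h a⟩
    · rintro ⟨a', rfl⟩
      obtain ⟨a, rfl⟩ := E.surjective a'
      exact ⟨d a, ⟨a, rfl⟩, (h a).symm⟩)

end

variable {k : Type u} [Field k] {X : Scheme.{u}} (p : X ⟶ Spec (.of k)) (M : X.Modules)

/-- Global sections are pairs of sections over two covering open sets which agree. -/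
def H0Equiv {U V : X.Opens} (hUV : U ⊔ V = ⊤) : H0 p M ≃ₗ[k] LinearMap.ker (cechDiff p M U V) :=
  LinearEquiv.ofBijective
    (((Sections.res p M le_top).prod (Sections.res p M le_top)).codRestrict _ fun s => by
      rw [LinearMap.mem_ker]
      change resM M inf_le_left (resM M le_top s) - resM M inf_le_right (resM M le_top s) = 0
      rw [sub_eq_zero]
      exact (resM_resM M _ _ _).trans (resM_resM M _ _ _).symm) (by
    constructor
    · intro s t hst
      have h1 := congr(($hst).1.1)
      have h2 := congr(($hst).1.2)
      exact resM_eq_of_sup M le_top le_top hUV.ge h1 h2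
    · rintro ⟨⟨x, y⟩, hxy⟩
      have hxy' : resM M inf_le_left x - resM M inf_le_right y = 0 := hxy
      obtain ⟨s, hs, hs'⟩ := exists_resM_of_sup M le_top le_top hUV.ge (sub_eq_zero.mp hxy')
      exact ⟨s, Subtype.ext (Prod.ext hs hs')⟩)

variable {M}

/-- A function as an element of the `k`-algebra of functions. -/
def Functions.mk {p : X ⟶ Spec (.of k)} {U : X.Opens} (a : Γ(X, U)) : Functions p U := a

/-- Multiples of a section, as a linear map. -/
def smulSection {U W : X.Opens} (e : Γ(M, U)) (h : W ≤ U) : Functions p W →ₗ[k] Sections p M W where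
  toFun a := HSMul.hSMul (α := Γ(X, W)) (β := Γ(M, W)) (γ := Γ(M, W)) a (resM M h e)
  map_add' a b := add_smul (R := Γ(X, W)) (M := Γ(M, W)) a b (resM M h e)
  map_smul' c a := mul_smul (α := Γ(X, W)) (β := Γ(M, W)) (scalars p W c) a (resM M h e)

/-- A generator identifies functions and sections. -/
def IsGen.equiv {U W : X.Opens} {e : Γ(M, U)} (he : IsGen M e) (h : W ≤ U) :
    Functions p W ≃ₗ[k] Sections p M W :=
  LinearEquiv.ofBijective (smulSection p e h) (he W h)

end RibbonCurve

/-! ### The Čech complex, degree and genus in terms of the ribbon algebra. -/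

namespace Ribbon
open RibbonCurve Function Polynomial LaurentPolynomial
variable {k : Type u} [Field k] (C : Ribbon k)

theorem cechDiff_eq {M : C.scheme.Modules} {e₀ : Γ(M, C.chart 0)} {e₁ : Γ(M, C.chart 1)}
    (h₀ : IsGen M e₀) (h₁ : IsGen M e₁) {u : Γ(C.scheme, C.chart 0 ⊓ C.chart 1)}
    (hu : resM M inf_le_right e₁ = u • resM M inf_le_left e₀)
    (x : Functions C.toSpec (C.chart 0) × Functions C.toSpec (C.chart 1)) :
    cechDiff C.toSpec M (C.chart 0) (C.chart 1)
      (((h₀.equiv C.toSpec le_rfl).prodCongr (h₁.equiv C.toSpec le_rfl)) x) =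
    h₀.equiv C.toSpec inf_le_left (C.algebra.diff (.mk u) x) := by
  rw [← Prod.mk.eta (p := x), RibbonAlgebra.diff_apply, algebra_r₀, algebra_r₁]
  let a : Γ(C.scheme, C.chart 0) := x.1
  let b : Γ(C.scheme, C.chart 1) := x.2
  change resM M inf_le_left (a • resM M le_rfl e₀) - resM M inf_le_right (b • resM M le_rfl e₁) =
    (resO inf_le_left a - u * resO inf_le_right b) • resM M inf_le_left e₀
  rw [resM_smul, resM_smul, resM_resM, resM_resM, hu, sub_smul, mul_comm, mul_smul]

/-- Global sections in terms of generators. -/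
def H0EquivKer {M : C.scheme.Modules} {e₀ : Γ(M, C.chart 0)} {e₁ : Γ(M, C.chart 1)}
    (h₀ : IsGen M e₀) (h₁ : IsGen M e₁) {u : Γ(C.scheme, C.chart 0 ⊓ C.chart 1)}
    (hu : resM M inf_le_right e₁ = u •
      resM M inf_le_left e₀) : C.H0 M ≃ₗ[k] LinearMap.ker (C.algebra.diff (.mk u)) :=
  (H0Equiv C.toSpec M C.chart_sup).trans
    (kerEquiv _ _ _ _ (C.cechDiff_eq h₀ h₁ hu)).symm

theorem chi_eq_index {M : C.scheme.Modules} {e₀ : Γ(M, C.chart 0)} {e₁ : Γ(M, C.chart 1)}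
    (h₀ : IsGen M e₀) (h₁ : IsGen M e₁) {u : Γ(C.scheme, C.chart 0 ⊓ C.chart 1)}
    (hu : resM M inf_le_right e₁ = u •
      resM M inf_le_left e₀) : C.chi M = index (C.algebra.diff (.mk u)) := by
  have h1 := (C.H0EquivKer h₀ h₁ hu).finrank_eq
  have h2 := (cokerEquiv _ _ _ _ (C.cechDiff_eq h₀ h₁ hu)).finrank_eq
  rw [chi, eulerChar, h1, ← h2]
  rfl

theorem isGen_one {X : Scheme.{u}} (U : X.Opens) : IsGen (unitModule X) (toUnit (1 : Γ(X, U))) := by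
  intro W hW
  have : (fun a : Γ(X, W) => a • resM (unitModule X) hW (toUnit (1 : Γ(X, U)))) = toUnit := by
    funext a
    rw [resM_toUnit, smul_toUnit, map_one, mul_one]
  rw [this]
  exact bijective_id

theorem chi_structureModule : C.chi C.structureModule = (C.algebra.e + 1) + 1 := by
  have := C.chi_eq_index (M := unitModule C.scheme) (isGen_one (C.chart 0)) (isGen_one (C.chart 1))
    (u := 1) (by
      rw [one_smul, resM_toUnit, resM_toUnit, map_one, map_one])
  refine this.trans ((C.algebra.index_diff (u := .mk 1) (d := 0) ?_).2.trans (by ring))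
  rw [T_zero]
  exact map_one C.algebra.F.ρ

theorem genus_eq : C.genus = -1 - C.algebra.e := by
  rw [genus, chi_structureModule]; ring

/-- Line bundles are free on the charts and the transition function reduces to a unit `c T ^ d`;
rescaling the second generator removes `c`. -/
theorem exists_generators_of_isLineBundle {L : C.scheme.Modules} (hL : IsLineBundle L) :
    ∃ (e₀ : Γ(L, C.chart 0)) (e₁ : Γ(L, C.chart 1))
      (u : Γ(C.scheme, C.chart 0 ⊓ C.chart 1)) (d : ℤ), IsGen L e₀ ∧ IsGen L e₁ ∧
      resM L inf_le_right e₁ = u • resM L inf_le_left e₀ ∧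
      C.algebra.F.ρ (.mk u) = T d := by
  obtain ⟨e₀, h₀⟩ := C.isThickening.exists_isGen hL (C.isAffineOpen_preimage_chart 0)
  obtain ⟨e₁, h₁⟩ := C.isThickening.exists_isGen hL (C.isAffineOpen_preimage_chart 1)
  obtain ⟨v, hv⟩ := (h₀.res (inf_le_left : C.chart 0 ⊓ C.chart 1 ≤ _)).exists_unit
    (h₁.res inf_le_right)
  have hv' : IsUnit (C.ρ (v : Γ(C.scheme, C.chart 0 ⊓ C.chart 1))) :=
    IsUnit.map (M := Functions C.toSpec (C.chart 0 ⊓ C.chart 1)) C.ρ v.isUnit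
  obtain ⟨c, d, hc, hd⟩ := exists_eq_C_mul_T_of_isUnit hv'
  refine ⟨e₀, scalars C.toSpec _ c⁻¹ • e₁,
    scalars C.toSpec _ c⁻¹ * v.val, d, h₀,
    h₁.smul ((IsUnit.mk0 _ (inv_ne_zero hc)).map _), ?_, ?_⟩
  · rw [resM_smul, hv, P1.resO_scalars]
    exact (mul_smul _ _ _).symm
  · rw [algebra_ρ]
    refine (map_mul C.ρ _ _).trans ?_
    refine (congrArg₂ (· * ·) (C.ρ.commutes c⁻¹) hd).trans ?_
    rw [LaurentPolynomial.algebraMap_apply]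
    rw [← mul_assoc, ← map_mul]
    simp [hc]

end Ribbon

namespace RibbonCurve
open Function

/-! ### The universal property of glued modules -/

section Glued

variable {X : Scheme.{u}} {U V : X.Opens} {t : Γ(X, U ⊓ V)}

/-- A glued section as a section of the glued module. -/
def toGlued {W : X.Opens} (s : gluedSections U V t W) : Γ(gluedModule U V t, W) := s

/-- A section of the glued module as a glued section. -/
def ofGlued {W : X.Opens} (s : Γ(gluedModule U V t, W)) : gluedSections U V t W := s

variable {M : X.Modules} {x : Γ(M, U)} {y : Γ(M, V)}

theorem exists_section (hUV : U ⊔ V = ⊤) (h : resM M inf_le_right y = t • resM M inf_le_left x)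
    {W : X.Opens} (s : gluedSections U V t W) : ∃ m : Γ(M, W),
    resM M inf_le_left m = s.1.1 • resM M (inf_le_right : W ⊓ U ≤ U) x ∧
    resM M inf_le_left m = s.1.2 • resM M (inf_le_right : W ⊓ V ≤ V) y := by
  refine exists_resM_of_sup M inf_le_left inf_le_left
    (by rw [← inf_sup_left, hUV, inf_top_eq]) ?_
  have hs := mem_gluedSections.mp s.2
  have hle : (W ⊓ U) ⊓ (W ⊓ V) ≤ W ⊓ (U ⊓ V) :=
    le_inf (inf_le_left.trans inf_le_left) (inf_le_inf inf_le_right inf_le_right)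
  have h1 := congr(resO hle $hs)
  have h2 := congr(resM M (hle.trans inf_le_right) $h)
  simp only [resM_resM, resM_smul, map_mul, resO_resO] at h1 h2 ⊢
  rw [h1, h2, mul_comm, mul_smul]

theorem section_ext (hUV : U ⊔ V = ⊤) {W : X.Opens} {m m' : Γ(M, W)}
    (h₁ : resM M (inf_le_left : W ⊓ U ≤ W) m = resM M inf_le_left m')
    (h₂ : resM M (inf_le_left : W ⊓ V ≤ W) m = resM M inf_le_left m') : m = m' :=
  resM_eq_of_sup M inf_le_left inf_le_left (by rw [← inf_sup_left, hUV, inf_top_eq]) h₁ h₂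

/-- The section of `M` with given coordinates with respect to `x` and `y`. -/
def gluedMap (hUV : U ⊔ V = ⊤) (h : resM M inf_le_right y = t • resM M inf_le_left x)
    {W : X.Opens} (s : gluedSections U V t W) : Γ(M, W) :=
  (exists_section hUV h s).choose

variable (hUV : U ⊔ V = ⊤) (h : resM M inf_le_right y = t • resM M inf_le_left x)

theorem gluedMap_left {W : X.Opens} (s : gluedSections U V t W) :
    resM M inf_le_left (gluedMap hUV h s) = s.1.1 • resM M (inf_le_right : W ⊓ U ≤ U) x :=
  (exists_section hUV h s).choose_spec.1

theorem gluedMap_right {W : X.Opens} (s : gluedSections U V t W) :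
    resM M inf_le_left (gluedMap hUV h s) = s.1.2 • resM M (inf_le_right : W ⊓ V ≤ V) y :=
  (exists_section hUV h s).choose_spec.2

theorem gluedMap_eq {W : X.Opens} {s : gluedSections U V t W} {m : Γ(M, W)}
    (h₁ : resM M inf_le_left m = s.1.1 • resM M (inf_le_right : W ⊓ U ≤ U) x)
    (h₂ : resM M inf_le_left m = s.1.2 • resM M (inf_le_right : W ⊓ V ≤ V) y) :
    gluedMap hUV h s = m :=
  section_ext hUV ((gluedMap_left hUV h s).trans h₁.symm) ((gluedMap_right hUV h s).trans h₂.symm)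

theorem gluedMap_add {W : X.Opens} (s s' : gluedSections U V t W) :
    gluedMap hUV h (s + s') = gluedMap hUV h s + gluedMap hUV h s' := by
  refine gluedMap_eq hUV h ?_ ?_
  · rw [map_add, gluedMap_left, gluedMap_left, ← add_smul]; rfl
  · rw [map_add, gluedMap_right, gluedMap_right, ← add_smul]; rfl

theorem gluedMap_zero {W : X.Opens} : gluedMap hUV h (0 : gluedSections U V t W) = 0 := by
  have := gluedMap_add hUV h (W := W) 0 0
  rwa [add_zero, left_eq_add] at this

theorem gluedMap_smul {W : X.Opens} (r : Γ(X, W)) (s : gluedSections U V t W) :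
    gluedMap hUV h (r • s) = r • gluedMap hUV h s := by
  refine gluedMap_eq hUV h ?_ ?_
  · rw [resM_smul, gluedMap_left, ← mul_smul]; rfl
  · rw [resM_smul, gluedMap_right, ← mul_smul]; rfl

theorem gluedMap_res {W W' : X.Opens} (hW : W' ≤ W) (s : gluedSections U V t W) :
    gluedMap hUV h (gluedRes U V t hW s) = resM M hW (gluedMap hUV h s) := by
  refine gluedMap_eq hUV h ?_ ?_
  · have := congr(resM M (inf_le_inf_right U hW) $(gluedMap_left hUV h s))
    rw [resM_smul, resM_resM, resM_resM] at this
    rw [resM_resM, this]; rfl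
  · have := congr(resM M (inf_le_inf_right V hW) $(gluedMap_right hUV h s))
    rw [resM_smul, resM_resM, resM_resM] at this
    rw [resM_resM, this]; rfl

/-- The morphism from a glued module given by two sections which match. -/
def gluedHom : gluedModule U V t ⟶ M :=
  SheafOfModules.Hom.mk (PresheafOfModules.homMk
    { app := fun W => AddCommGrpCat.ofHom
        { toFun := fun s => gluedMap hUV h (W := W.unop) s
          map_zero' := gluedMap_zero hUV h
          map_add' := gluedMap_add hUV h }
      naturality := fun W W' f => by
        ext s
        exact gluedMap_res hUV h f.unop.le s }
    (fun W r s => gluedMap_smul hUV h (W := W.unop) r s))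

/-- A line bundle with matching generators is isomorphic to the glued module. -/
theorem isIso_gluedHom (hx : IsGen M x) (hy : IsGen M y) : IsIso (gluedHom hUV h) := by
  rw [Scheme.Modules.Hom.isIso_iff_isIso_app]
  intro W
  rw [ConcreteCategory.isIso_iff_bijective]
  constructor
  · intro s s' hss
    have hss' : gluedMap hUV h (ofGlued s) = gluedMap hUV h (ofGlued s') := hss
    refine Subtype.ext (Prod.ext ((hx _ inf_le_right).1 ?_) ((hy _ inf_le_right).1 ?_))
    · exact (gluedMap_left hUV h (ofGlued s)).symm.trans
        ((congrArg _ hss').trans (gluedMap_left hUV h (ofGlued s')))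
    · exact (gluedMap_right hUV h (ofGlued s)).symm.trans
        ((congrArg _ hss').trans (gluedMap_right hUV h (ofGlued s')))
  · intro m
    obtain ⟨a, ha⟩ := (hx (W ⊓ U) inf_le_right).2 (resM M inf_le_left m)
    obtain ⟨b, hb⟩ := (hy (W ⊓ V) inf_le_right).2 (resM M inf_le_left m)
    simp only at ha hb
    refine ⟨toGlued ⟨(a, b), ?_⟩, gluedMap_eq hUV h ha.symm hb.symm⟩
    rw [mem_gluedSections]
    refine (hx (W ⊓ (U ⊓ V)) (inf_le_right.trans inf_le_left)).1 ?_
    have h1 := congr(resM M (inf_le_inf_left W inf_le_left : W ⊓ (U ⊓ V) ≤ W ⊓ U) $ha)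
    have h2 := congr(resM M (inf_le_inf_left W inf_le_right : W ⊓ (U ⊓ V) ≤ W ⊓ V) $hb)
    have h3 := congr(resM M (inf_le_right : W ⊓ (U ⊓ V) ≤ U ⊓ V) $h)
    simp only [resM_smul, resM_resM] at h1 h2 h3 ⊢
    rw [h1, ← h2, h3, ← mul_smul, mul_comm]

variable {t' : Γ(X, U ⊓ V)} (ht : t * t' = 1)

/-- The generator of a glued module on the first open set. -/
def gluedGenLeft : Γ(gluedModule U V t, U) :=
  -- Compatibility requires `1 = t b`, which forces the second component to be the inverse of `t`.
  toGlued ⟨(1, t'), by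
    rw [mem_gluedSections]
    have := congr(resO (inf_le_right : U ⊓ (U ⊓ V) ≤ U ⊓ V) $ht)
    rw [map_mul, map_one] at this
    exact (map_one _).trans this.symm⟩

variable (U V t) in
/-- The generator of a glued module on the second open set. -/
def gluedGenRight : Γ(gluedModule U V t, V) :=
  toGlued ⟨(resO (inf_comm V U).le t, 1), by
    rw [mem_gluedSections, map_one, mul_one, resO_resO]⟩

theorem gluedGen_rel : resM _ inf_le_right (gluedGenRight U V t) =
    t • resM _ inf_le_left (gluedGenLeft ht) := by
  refine Subtype.ext (Prod.ext ?_ ?_)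
  · change resO _ (resO _ t) = resO _ t * resO _ 1
    rw [map_one, mul_one, resO_resO]
  · change resO _ 1 = resO _ t * resO _ t'
    have := congr(resO (inf_le_left : (U ⊓ V) ⊓ V ≤ U ⊓ V) $ht)
    rw [map_mul, map_one] at this
    rw [map_one, ← this]

theorem resM_eq_smul_left {W : X.Opens} (s : Γ(gluedModule U V t, W)) :
    resM _ inf_le_left s =
      (ofGlued s).1.1 • resM _ (inf_le_right : W ⊓ U ≤ U) (gluedGenLeft ht) := by
  refine Subtype.ext (Prod.ext ?_ ?_)
  · change resO _ (ofGlued s).1.1 = resO _ (ofGlued s).1.1 * resO _ 1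
    rw [map_one, mul_one]
  · change resO _ (ofGlued s).1.2 = resO _ (ofGlued s).1.1 * resO _ t'
    have hs := mem_gluedSections.mp (ofGlued s).2
    have hle : W ⊓ U ⊓ V ≤ W ⊓ (U ⊓ V) := (inf_assoc W U V).le
    have h1 := congr(resO hle $hs)
    have h2 := congr(resO (hle.trans inf_le_right) $ht)
    simp only [map_mul, map_one, resO_resO] at h1 h2 ⊢
    rw [h1]
    linear_combination (-resO (hle.trans (inf_le_inf_left W inf_le_right)) (ofGlued s).1.2) * h2

theorem resM_eq_smul_right {W : X.Opens} (s : Γ(gluedModule U V t, W)) :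
    resM _ inf_le_left s =
      (ofGlued s).1.2 • resM _ (inf_le_right : W ⊓ V ≤ V) (gluedGenRight U V t) := by
  refine Subtype.ext (Prod.ext ?_ ?_)
  · change resO _ (ofGlued s).1.1 = resO _ (ofGlued s).1.2 * resO _ (resO _ t)
    have hs := mem_gluedSections.mp (ofGlued s).2
    have hle : W ⊓ V ⊓ U ≤ W ⊓ (U ⊓ V) := by rw [inf_assoc, inf_comm V U]
    have h1 := congr(resO hle $hs)
    simp only [map_mul, resO_resO] at h1 ⊢
    rw [h1, mul_comm]
  · change resO _ (ofGlued s).1.2 = resO _ (ofGlued s).1.2 * resO _ 1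
    rw [map_one, mul_one]

theorem gluedHom_left : (gluedHom hUV h).app U (gluedGenLeft ht) = x := by
  refine gluedMap_eq hUV h ?_ ?_
  · exact (one_smul Γ(X, U ⊓ U) _).symm
  · have := congr(t' • $h)
    rw [← mul_smul, mul_comm, ht, one_smul] at this
    exact this.symm

theorem gluedHom_right : (gluedHom hUV h).app V (gluedGenRight U V t) = y := by
  refine gluedMap_eq hUV h ?_ ?_
  · have := congr(resM M (inf_comm V U).le $h)
    rw [resM_smul, resM_resM, resM_resM] at this
    exact this
  · exact (one_smul Γ(X, V ⊓ V) _).symm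

/-- Over `W ⊓ U` and `W ⊓ V` every section is a multiple of one of the two generators, so linearity
and locality determine a morphism. -/
theorem gluedModule_hom_ext (hUV : U ⊔ V = ⊤) {ψ ψ' : gluedModule U V t ⟶ M}
    (h₁ : ψ.app U (gluedGenLeft ht) = ψ'.app U (gluedGenLeft ht))
    (h₂ : ψ.app V (gluedGenRight U V t) = ψ'.app V (gluedGenRight U V t)) : ψ = ψ' := by
  refine Scheme.Modules.hom_ext _ _ fun W => ?_
  ext s
  refine section_ext hUV ?_ ?_
  · rw [← app_resM, ← app_resM, resM_eq_smul_left ht, Scheme.Modules.Hom.app_smul,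
      Scheme.Modules.Hom.app_smul, app_resM, app_resM, h₁]
  · rw [← app_resM, ← app_resM, resM_eq_smul_right, Scheme.Modules.Hom.app_smul,
      Scheme.Modules.Hom.app_smul, app_resM, app_resM, h₂]

end Glued
end RibbonCurve

namespace RibbonCurve
open Function

/-! ### Pullback of glued modules -/

section Pullback

variable {X Y : Scheme.{u}} (f : X ⟶ Y) {U V : Y.Opens} {t t' : Γ(Y, U ⊓ V)}

/-- A section of the pushforward. -/
def toPush {M : X.Modules} {W : Y.Opens} (m : Γ(M, f ⁻¹ᵁ W)) :
    Γ((Scheme.Modules.pushforward f).obj M, W) := m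

theorem resM_toPush {M : X.Modules} {W W' : Y.Opens} (h : W' ≤ W) (m : Γ(M, f ⁻¹ᵁ W)) :
    resM _ h (toPush f m) = toPush f (resM M (f.preimage_mono h) m) := rfl

theorem smul_toPush {M : X.Modules} {W : Y.Opens} (r : Γ(Y, W)) (m : Γ(M, f ⁻¹ᵁ W)) :
    r • toPush f m = toPush f (pb f W r • m) := rfl

/-- The pullback of a function on the intersection of two open sets. -/
def pbInf (t : Γ(Y, U ⊓ V)) : Γ(X, f ⁻¹ᵁ U ⊓ f ⁻¹ᵁ V) := pb f (U ⊓ V) t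

theorem pb_mul_eq_one (ht : t * t' = 1) : pbInf f t * pbInf f t' = 1 := by
  change pb f (U ⊓ V) t * pb f (U ⊓ V) t' = 1
  rw [← map_mul, ht, map_one]

theorem preimage_sup_eq_top (hUV : U ⊔ V = ⊤) : f ⁻¹ᵁ U ⊔ f ⁻¹ᵁ V = ⊤ := congrArg (f ⁻¹ᵁ ·) hUV

/-- The pullback of the glued module. -/
abbrev pulledGlued (U V : Y.Opens) (t : Γ(Y, U ⊓ V)) : X.Modules :=
  gluedModule (f ⁻¹ᵁ U) (f ⁻¹ᵁ V) (pbInf f t)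

/-- The comparison map from a glued module to a pushforward. -/
def gluedToPush (ht : t * t' = 1) (hUV : U ⊔ V = ⊤) :
    gluedModule U V t ⟶
      (Scheme.Modules.pushforward f).obj (pulledGlued f U V t) :=
  gluedHom hUV (x := toPush f (gluedGenLeft (pb_mul_eq_one f ht)))
    (y := toPush f (gluedGenRight _ _ _)) (by
      rw [resM_toPush, resM_toPush, smul_toPush]
      exact congrArg _ (gluedGen_rel (pb_mul_eq_one f ht)))

/-- The unit of the adjunction, on sections. -/
abbrev unitApp (M : Y.Modules) : M ⟶
    (Scheme.Modules.pushforward f).obj ((Scheme.Modules.pullback f).obj M) :=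
  (Scheme.Modules.pullbackPushforwardAdjunction f).unit.app M

/-- The pullback of a glued module is glued by the pullback of the transition function. -/
def pullbackGluedHom (ht : t * t' = 1) (hUV : U ⊔ V = ⊤) :
    (Scheme.Modules.pullback f).obj (gluedModule U V t) ⟶ pulledGlued f U V t :=
  ((Scheme.Modules.pullbackPushforwardAdjunction f).homEquiv _ _).symm (gluedToPush f ht hUV)

/-- The pullback of a section. -/
def pullSection {M : Y.Modules} {W : Y.Opens} (m : Γ(M, W)) :
    Γ((Scheme.Modules.pullback f).obj M, f ⁻¹ᵁ W) := (unitApp f M).app W m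

theorem pullSection_rel (ht : t * t' = 1) :
    resM _ inf_le_right (pullSection f (gluedGenRight U V t)) =
      pbInf f t • resM _ inf_le_left (pullSection f (gluedGenLeft ht)) := by
  have := congr((unitApp f (gluedModule U V t)).app (U ⊓ V) $(gluedGen_rel ht))
  rw [Scheme.Modules.Hom.app_smul, app_resM, app_resM] at this
  exact this

/-- The inverse of the comparison map for pullbacks of glued modules. -/
def pullbackGluedInv (ht : t * t' = 1) (hUV : U ⊔ V = ⊤) :
    pulledGlued f U V t ⟶ (Scheme.Modules.pullback f).obj (gluedModule U V t) :=
  gluedHom (preimage_sup_eq_top f hUV) (pullSection_rel f ht)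

theorem unit_comp_hom (ht : t * t' = 1) (hUV : U ⊔ V = ⊤) :
    unitApp f _ ≫ (Scheme.Modules.pushforward f).map (pullbackGluedHom f ht hUV) =
      gluedToPush f ht hUV := by
  have := ((Scheme.Modules.pullbackPushforwardAdjunction f).homEquiv _ _).apply_symm_apply
    (gluedToPush f ht hUV)
  rwa [Adjunction.homEquiv_unit] at this

/-- It suffices to follow the two generators. The inverse sends them to pulled-back sections, and
the adjunction identity `unit_comp_hom` sends these back. -/
theorem pullbackGluedInv_hom (ht : t * t' = 1) (hUV : U ⊔ V = ⊤) :
    pullbackGluedInv f ht hUV ≫ pullbackGluedHom f ht hUV = 𝟙 _ := by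
  refine gluedModule_hom_ext (pb_mul_eq_one f ht) (preimage_sup_eq_top f hUV) ?_ ?_
  · refine (congrArg ((pullbackGluedHom f ht hUV).app (f ⁻¹ᵁ U))
      (gluedHom_left (preimage_sup_eq_top f hUV) (pullSection_rel f ht) (pb_mul_eq_one f ht))).trans ?_
    exact congr(($(unit_comp_hom f ht hUV)).app U (gluedGenLeft ht)).trans
      (gluedHom_left hUV _ ht)
  · refine (congrArg ((pullbackGluedHom f ht hUV).app (f ⁻¹ᵁ V))
      (gluedHom_right (preimage_sup_eq_top f hUV) (pullSection_rel f ht))).trans ?_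
    exact congr(($(unit_comp_hom f ht hUV)).app V (gluedGenRight U V t)).trans
      (gluedHom_right hUV _)

theorem gluedToPush_comp (ht : t * t' = 1) (hUV : U ⊔ V = ⊤) :
    gluedToPush f ht hUV ≫ (Scheme.Modules.pushforward f).map (pullbackGluedInv f ht hUV) =
      unitApp f _ := by
  refine gluedModule_hom_ext ht hUV ?_ ?_
  · rw [Scheme.Modules.Hom.comp_app, ConcreteCategory.comp_apply, gluedToPush, gluedHom_left]
    exact gluedHom_left (preimage_sup_eq_top f hUV) (pullSection_rel f ht) (pb_mul_eq_one f ht)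
  · rw [Scheme.Modules.Hom.comp_app, ConcreteCategory.comp_apply, gluedToPush, gluedHom_right]
    exact gluedHom_right (preimage_sup_eq_top f hUV) (pullSection_rel f ht)

/-- Morphisms out of a pullback are compared after transposition, which turns the claim into an
identity of maps out of a glued module. -/
theorem pullbackGluedHom_inv (ht : t * t' = 1) (hUV : U ⊔ V = ⊤) :
    pullbackGluedHom f ht hUV ≫ pullbackGluedInv f ht hUV = 𝟙 _ := by
  apply ((Scheme.Modules.pullbackPushforwardAdjunction f).homEquiv _ _).injective
  rw [Adjunction.homEquiv_unit, Adjunction.homEquiv_unit, Functor.map_comp,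
    reassoc_of% unit_comp_hom f ht hUV, gluedToPush_comp, CategoryTheory.Functor.map_id]
  exact (Category.comp_id _).symm

/-- The pullback of a glued module is glued by the pullback of the transition function. -/
def pullbackGluedIso (ht : t * t' = 1) (hUV : U ⊔ V = ⊤) :
    (Scheme.Modules.pullback f).obj (gluedModule U V t) ≅ pulledGlued f U V t where
  hom := pullbackGluedHom f ht hUV
  inv := pullbackGluedInv f ht hUV
  hom_inv_id := pullbackGluedHom_inv f ht hUV
  inv_hom_id := pullbackGluedInv_hom f ht hUV

end Pullback
end RibbonCurve

namespace RibbonCurve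
open Function

/-! ### Gluing morphisms -/

section Gluing

variable {X Y : Scheme.{u}}

/-- Two open sets which cover a scheme, as an open cover. -/
def coverOfSup (U : Fin 2 → X.Opens) (hU : U 0 ⊔ U 1 = ⊤) : X.OpenCover :=
  X.openCoverOfIsOpenCover U (by
    change iSup U = ⊤
    rw [← hU]
    exact le_antisymm (iSup_le fun j => by fin_cases j; exacts [le_sup_left, le_sup_right])
      (sup_le (le_iSup U 0) (le_iSup U 1)))

theorem hom_ext_of_sup (U : Fin 2 → X.Opens) (hU : U 0 ⊔ U 1 = ⊤) {f g : X ⟶ Y}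
    (h : ∀ j, (U j).ι ≫ f = (U j).ι ≫ g) : f = g :=
  (coverOfSup U hU).hom_ext _ _ h

theorem exists_glue (U : Fin 2 → X.Opens) (hU : U 0 ⊔ U 1 = ⊤) (f : ∀ j, (U j : Scheme.{u}) ⟶ Y)
    (h : X.homOfLE (inf_le_left : U 0 ⊓ U 1 ≤ U 0) ≫ f 0 =
      X.homOfLE (inf_le_right : U 0 ⊓ U 1 ≤ U 1) ≫ f 1) :
    ∃ g : X ⟶ Y, ∀ j, (U j).ι ≫ g = f j := by
  refine ⟨(coverOfSup U hU).glueMorphisms f ?_, fun j => (coverOfSup U hU).ι_glueMorphisms f _ j⟩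
  intro i j
  have key (i j : Fin 2) (h : X.homOfLE (inf_le_left : U i ⊓ U j ≤ U i) ≫ f i =
      X.homOfLE (inf_le_right : U i ⊓ U j ≤ U j) ≫ f j) :
      Limits.pullback.fst (U i).ι (U j).ι ≫ f i = Limits.pullback.snd (U i).ι (U j).ι ≫ f j := by
    rw [← cancel_epi (isPullback_opens_inf (U i) (U j)).isoPullback.hom]
    simpa using h
  refine key i j ?_
  change Fin 2 at i j
  fin_cases i <;> fin_cases j
  · rfl
  · exact h
  · have := congr(X.homOfLE (inf_comm (U 1) (U 0)).le ≫ $h)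
    simp only [Scheme.homOfLE_homOfLE_assoc] at this
    exact this.symm
  · rfl

theorem comp_eq_of_fromSpec {U : X.Opens} (hU : IsAffineOpen U) {f g : X ⟶ Y}
    (h : hU.fromSpec ≫ f = hU.fromSpec ≫ g) : U.ι ≫ f = U.ι ≫ g := by
  rw [← hU.toSpecΓ_fromSpec, Category.assoc, Category.assoc, h]

/-- Ring homomorphisms between functions on affine open sets glue to a morphism of schemes. -/
theorem exists_glue_of_ringHom (U : Fin 2 → X.Opens) (hU : U 0 ⊔ U 1 = ⊤)
    (hU' : ∀ j, IsAffineOpen (U j)) (V : Fin 2 → Y.Opens) (hV : ∀ j, IsAffineOpen (V j))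
    (hV' : IsAffineOpen (V 0 ⊓ V 1)) (φ : ∀ j, Γ(Y, V j) →+* Γ(X, U j))
    (ψ : Γ(Y, V 0 ⊓ V 1) →+* Γ(X, U 0 ⊓ U 1))
    (h₀ : ∀ a, ψ (resO inf_le_left a) = resO inf_le_left (φ 0 a))
    (h₁ : ∀ a, ψ (resO inf_le_right a) = resO inf_le_right (φ 1 a)) :
    ∃ g : X ⟶ Y, ∀ j, (hU' j).fromSpec ≫ g =
      Spec.map (CommRingCat.ofHom (φ j)) ≫ (hV j).fromSpec := by
  obtain ⟨g, hg⟩ := exists_glue U hU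
    (fun j => (U j).toSpecΓ ≫ Spec.map (CommRingCat.ofHom (φ j)) ≫ (hV j).fromSpec) (by
      rw [← Scheme.Opens.toSpecΓ_SpecMap_presheaf_map_assoc,
        ← Scheme.Opens.toSpecΓ_SpecMap_presheaf_map_assoc, ← Spec.map_comp_assoc,
        ← Spec.map_comp_assoc]
      have e₀ : CommRingCat.ofHom (φ 0) ≫ X.presheaf.map (homOfLE inf_le_left).op =
          Y.presheaf.map (homOfLE inf_le_left).op ≫ CommRingCat.ofHom ψ := by
        ext a
        exact (h₀ a).symm
      have e₁ : CommRingCat.ofHom (φ 1) ≫ X.presheaf.map (homOfLE inf_le_right).op =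
          Y.presheaf.map (homOfLE inf_le_right).op ≫ CommRingCat.ofHom ψ := by
        ext a
        exact (h₁ a).symm
      rw [e₀, e₁, Spec.map_comp_assoc, Spec.map_comp_assoc, (hV 0).map_fromSpec hV',
        (hV 1).map_fromSpec hV'])
  refine ⟨g, fun j => ?_⟩
  rw [← cancel_epi (hU' j).isoSpec.hom, (hU' j).isoSpec_hom, (hU' j).toSpecΓ_fromSpec_assoc, hg]

/-- The morphism glued from ring homomorphisms induces these ring homomorphisms. -/
theorem resO_pb_of_fromSpec {U : X.Opens} {V : Y.Opens} (hU : IsAffineOpen U)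
    (hV : IsAffineOpen V) {g : X ⟶ Y} {φ : Γ(Y, V) →+* Γ(X, U)}
    (h : hU.fromSpec ≫ g = Spec.map (CommRingCat.ofHom φ) ≫ hV.fromSpec) (hle : U ≤ g ⁻¹ᵁ V)
    (a : Γ(Y, V)) : resO hle (pb g V a) = φ a := by
  rw [← hV.SpecMap_appLE_fromSpec g hU hle, cancel_mono] at h
  exact congr($(Spec.map_injective h) a)

theorem fromSpec_comp {k : Type u} [Field k] (p : X ⟶ Spec (.of k)) {U : X.Opens}
    (hU : IsAffineOpen U) :
    hU.fromSpec ≫ p = Spec.map (CommRingCat.ofHom (scalars p U)) := by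
  have h := Scheme.toSpecΓ_naturality p
  have h1 : (Spec (.of k)).toSpecΓ ≫ Spec.map (Scheme.ΓSpecIso (.of k)).inv = 𝟙 _ := by
    simp
  have h2 : p = X.toSpecΓ ≫ Spec.map p.appTop ≫ Spec.map (Scheme.ΓSpecIso (.of k)).inv := by
    rw [← reassoc_of% h, h1, Category.comp_id]
  conv_lhs => rw [h2]
  rw [hU.fromSpec_toSpecΓ_assoc, ← Spec.map_comp, ← Spec.map_comp]
  rfl

end Gluing
end RibbonCurve

namespace Ribbon
open RibbonCurve Function
variable {k : Type u} [Field k] (C : Ribbon k)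

/-! ### Splittings from lifts of the coordinates -/

section Splitting

/-- The homomorphism from functions on a chart of the line which takes the coordinate to `t`. -/
def liftChart (j : Fin 2) (t : Γ(C.scheme, C.chart j)) :
    Γ(P1 k, P1.chart k j) →+* Γ(C.scheme, C.chart j) :=
  (Polynomial.eval₂RingHom (scalars C.toSpec _) t).comp (P1.chartEquiv k j).symm.toRingHom

theorem liftChart_chartPoly (j : Fin 2) (t : Γ(C.scheme, C.chart j)) (p : Polynomial k) :
    C.liftChart j t (P1.chartPoly k j (1 - j) p) = Polynomial.eval₂ (scalars C.toSpec _) t p :=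
  congrArg (Polynomial.eval₂ (scalars C.toSpec _) t) ((P1.chartEquiv k j).symm_apply_apply p)

theorem exists_chartPoly_eq (j : Fin 2) (a : Γ(P1 k, P1.chart k j)) :
    ∃ p, P1.chartPoly k j (1 - j) p = a :=
  (P1.chartEquiv k j).surjective a

theorem liftChart_scalars (j : Fin 2) (t : Γ(C.scheme, C.chart j)) (c : k) :
    C.liftChart j t (scalars (P1.toSpec k) _ c) = scalars C.toSpec _ c := by
  rw [← P1.chartPoly_C k j (1 - j), liftChart_chartPoly, Polynomial.eval₂_C]

theorem liftChart_coordinate (j : Fin 2) (t : Γ(C.scheme, C.chart j)) :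
    C.liftChart j t (P1.coordinate k j (1 - j)) = t := by
  rw [← P1.chartPoly_X k j (1 - j), liftChart_chartPoly, Polynomial.eval₂_X]

theorem toP1_liftChart {j : Fin 2} {t : Γ(C.scheme, C.chart j)}
    (ht : C.toP1 j t = P1.coordinate k j (1 - j)) (a : Γ(P1 k, P1.chart k j)) :
    C.toP1 j (C.liftChart j t a) = a := by
  obtain ⟨p, rfl⟩ := exists_chartPoly_eq j a
  rw [liftChart_chartPoly, Polynomial.hom_eval₂, ht]
  have : (C.toP1 j).comp (scalars C.toSpec _) = scalars (P1.toSpec k) _ :=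
    RingHom.ext (C.toP1_scalars j)
  rw [this]
  rfl

/-- The homomorphism from functions on the overlap which takes the coordinate to a unit. -/
def liftOverlap (v : Γ(C.scheme, C.chart 0 ⊓ C.chart 1)ˣ) :
    Γ(P1 k, P1.chart k 0 ⊓ P1.chart k 1) →+* Γ(C.scheme, C.chart 0 ⊓ C.chart 1) :=
  (LaurentPolynomial.eval₂ (scalars C.toSpec _) v).comp (laurentEquiv k).symm.toRingHom

theorem liftOverlap_overlapLaurent (v : Γ(C.scheme, C.chart 0 ⊓ C.chart 1)ˣ)
    (f : LaurentPolynomial k) : C.liftOverlap v (P1.overlapLaurent k f) =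
      LaurentPolynomial.eval₂ (scalars C.toSpec _) v f :=
  congrArg (LaurentPolynomial.eval₂ (scalars C.toSpec _) v) ((laurentEquiv k).symm_apply_apply f)

variable {C} {t : ∀ j, Γ(C.scheme, C.chart j)}

theorem liftOverlap_left {v : Γ(C.scheme, C.chart 0 ⊓ C.chart 1)ˣ}
    (hv : v.val = resO inf_le_left (t 0)) (a : Γ(P1 k, P1.chart k 0)) :
    C.liftOverlap v (resO inf_le_left a) = resO inf_le_left (C.liftChart 0 (t 0) a) := by
  obtain ⟨p, rfl⟩ := exists_chartPoly_eq 0 a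
  rw [liftChart_chartPoly, Polynomial.hom_eval₂, ← hv]
  change C.liftOverlap v (resO _ (P1.chartPoly k 0 1 p)) = _
  rw [← P1.overlapLaurent_toLaurent, liftOverlap_overlapLaurent, LaurentPolynomial.eval₂_toLaurent]
  congr 1
  exact (RingHom.ext (P1.resO_scalars k C.toSpec _)).symm

theorem liftOverlap_right {v : Γ(C.scheme, C.chart 0 ⊓ C.chart 1)ˣ}
    (hv : v⁻¹.val = resO inf_le_right (t 1)) (a : Γ(P1 k, P1.chart k 1)) :
    C.liftOverlap v (resO inf_le_right a) = resO inf_le_right (C.liftChart 1 (t 1) a) := by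
  obtain ⟨p, rfl⟩ := exists_chartPoly_eq 1 a
  rw [liftChart_chartPoly, Polynomial.hom_eval₂, ← hv]
  change C.liftOverlap v (resO _ (P1.chartPoly k 1 0 p)) = _
  rw [← P1.overlapLaurent_invert, liftOverlap_overlapLaurent]
  have h1 : (resO inf_le_right).comp (scalars C.toSpec (C.chart 1)) =
      scalars C.toSpec (C.chart 0 ⊓ C.chart 1) := RingHom.ext (P1.resO_scalars k C.toSpec _)
  rw [h1]
  have : ((LaurentPolynomial.eval₂ (scalars C.toSpec (C.chart 0 ⊓ C.chart 1)) v).comp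
      (LaurentPolynomial.invert (R := k)).toRingHom).comp Polynomial.toLaurent =
      Polynomial.eval₂RingHom (scalars C.toSpec (C.chart 0 ⊓ C.chart 1)) v⁻¹.val := by
    refine Polynomial.ringHom_ext (fun c => ?_) ?_
    · simp
    · simp
  exact congr($this p)

/-- Lifts of the two coordinates which are inverse to each other define a splitting. -/
theorem exists_isSplitting (ht : ∀ j, C.toP1 j (t j) = P1.coordinate k j (1 - j))
    (h : resO (inf_le_left : C.chart 0 ⊓ C.chart 1 ≤ _) (t 0) *
      resO (inf_le_right : C.chart 0 ⊓ C.chart 1 ≤ _) (t 1) = 1) :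
    ∃ π : C.scheme ⟶ P1 k, C.IsSplitting π ∧ ∀ j (hle : C.chart j ≤ π ⁻¹ᵁ P1.chart k j),
      resO hle (pb π _ (P1.coordinate k j (1 - j))) = t j := by
  let v : Γ(C.scheme, C.chart 0 ⊓ C.chart 1)ˣ :=
    ⟨resO inf_le_left (t 0), resO inf_le_right (t 1), h, (mul_comm _ _).trans h⟩
  have haff : IsAffineOpen (P1.chart k 0 ⊓ P1.chart k 1) := by
    rw [← P1.basicOpen_coordinate]
    exact (P1.isAffineOpen_chart k 0).basicOpen _
  -- The relation between `t 0` and `t 1` makes the common lift `v` invertible, so the homomorphisms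
  -- on the charts both extend to `liftOverlap v`.
  obtain ⟨π, hπ⟩ := exists_glue_of_ringHom C.chart C.chart_sup C.isAffineOpen_chart (P1.chart k)
    (P1.isAffineOpen_chart k) haff (fun j => C.liftChart j (t j)) (C.liftOverlap v)
    (liftOverlap_left rfl) (liftOverlap_right rfl)
  refine ⟨π, ⟨?_, ?_⟩, fun j hle => ?_⟩
  · refine hom_ext_of_sup (P1.chart k) (P1.chart_sup k) fun j => ?_
    refine comp_eq_of_fromSpec (P1.isAffineOpen_chart k j) ?_
    rw [← (C.isAffineOpen_chart j).SpecMap_appLE_fromSpec_assoc C.incl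
      (P1.isAffineOpen_chart k j) (C.preimage_chart j).ge, hπ, ← Spec.map_comp_assoc]
    have : CommRingCat.ofHom (C.liftChart j (t j)) ≫
        C.incl.appLE (C.chart j) (P1.chart k j) (C.preimage_chart j).ge = 𝟙 _ := by
      ext a
      exact C.toP1_liftChart (ht j) a
    rw [this, Spec.map_id]; exact (Category.id_comp _).trans (Category.comp_id _).symm
  · refine hom_ext_of_sup C.chart C.chart_sup fun j => ?_
    refine comp_eq_of_fromSpec (C.isAffineOpen_chart j) ?_
    rw [reassoc_of% hπ, fromSpec_comp, fromSpec_comp, ← Spec.map_comp]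
    congr 1
    ext c
    exact C.liftChart_scalars j (t j) c
  · rw [resO_pb_of_fromSpec (C.isAffineOpen_chart j) (P1.isAffineOpen_chart k j) (hπ j),
      liftChart_coordinate]

end Splitting

variable {C} in
theorem IsSplitting.preimage_chart {π : C.scheme ⟶ P1 k} (h : C.IsSplitting π) (j : Fin 2) :
    π ⁻¹ᵁ P1.chart k j = C.chart j := by
  rw [← C.isThickening.preimage_inj, C.preimage_chart, ← Scheme.Hom.comp_preimage, h.incl_comp]
  rfl

end Ribbon

/-! ### Pulling back sections of `𝒪(n)` along a splitting. -/

namespace RibbonCurve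
open Function Polynomial LaurentPolynomial

theorem pb_injective_of_comp_eq_id {X Y : Scheme.{u}} {i : Y ⟶ X} {π : X ⟶ Y} (h : i ≫ π = 𝟙 Y)
    (U : Y.Opens) : Injective (pb π U) := by
  -- The target of `pb` depends on the morphism, so the morphism is generalized before being
  -- replaced by the identity.
  have key : ∀ φ : Y ⟶ Y, φ = 𝟙 Y → Injective (pb φ U) := by
    rintro _ rfl
    have : (pb (𝟙 Y) U : Γ(Y, U) → _) = id := by
      funext a
      change (𝟙 Y : Y ⟶ Y).app U a = a
      rw [Scheme.Hom.id_app]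
      rfl
    rw [this]
    exact injective_id
  have h1 := key _ h
  have h2 : (pb (i ≫ π) U : Γ(Y, U) → _) = pb i (π ⁻¹ᵁ U) ∘ pb π U := by
    funext a
    change (i ≫ π).app U a = _
    rw [Scheme.Hom.comp_app]
    rfl
  rw [h2] at h1
  exact h1.of_comp

namespace P1
variable (k : Type u) [Field k]

/-- The transition function of `𝒪(n)`. -/
abbrev twistUnit (n : ℕ) : Γ(P1 k, chart k 0 ⊓ chart k 1) := resO inf_le_left (coord k) ^ n

theorem twistUnit_mul (n : ℕ) :
    twistUnit k n * resO inf_le_right (coordinate k 1 0) ^ n = 1 := by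
  rw [← mul_pow]
  exact (congrArg (· ^ n) (coordinate_mul k 0 1)).trans (one_pow n)

theorem chartPoly_rel {n : ℕ} {p q : k[X]} (h : lineDiff k n (p, q) = 0) :
    resO (inf_le_left : chart k 0 ⊓ chart k 1 ≤ _) (chartPoly k 0 1 p) =
      twistUnit k n * resO inf_le_right (chartPoly k 1 0 q) := by
  rw [lineDiff_apply, sub_eq_zero] at h
  rw [← overlapLaurent_toLaurent, h, map_mul, overlapLaurent_invert, overlapLaurent_T, zpow_natCast,
    Units.val_pow_eq_pow_val]
  rfl

variable {k} {X : Scheme.{u}} {p : X ⟶ Spec (.of k)} (π : X ⟶ P1 k)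

/-- The pullback of a section of `𝒪(n)` given by polynomials on the charts. -/
def pullPair {n : ℕ} (f : LinearMap.ker (lineDiff k n)) :
    gluedSections (π ⁻¹ᵁ chart k 0) (π ⁻¹ᵁ chart k 1) (pbInf π (twistUnit k n)) ⊤ :=
  ⟨(resO inf_le_right (pb π _ (chartPoly k 0 1 f.1.1)),
    resO inf_le_right (pb π _ (chartPoly k 1 0 f.1.2))), by
    have h := congr(resO (inf_le_right : ⊤ ⊓ (π ⁻¹ᵁ chart k 0 ⊓ π ⁻¹ᵁ chart k 1) ≤ _)
      (pb π (chart k 0 ⊓ chart k 1) $(chartPoly_rel k f.2)))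
    rw [map_mul, pb_resO π inf_le_left, pb_resO π inf_le_right] at h
    rw [mem_gluedSections]
    refine (resO_resO _ _ _).trans (((resO_resO _ _ _).symm.trans h).trans ?_)
    refine (map_mul _ _ _).trans (congrArg₂ (· * ·) rfl ?_)
    exact (resO_resO _ _ _).trans (resO_resO _ _ _).symm⟩

/-- Pullback of sections of `𝒪(n)`. -/
def pullSections (hp : π ≫ P1.toSpec k = p) (n : ℕ) : LinearMap.ker (lineDiff k n) →ₗ[k]
    RibbonCurve.H0 p (pulledGlued π (chart k 0) (chart k 1) (twistUnit k n)) where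
  toFun f := toGlued (pullPair π f)
  map_add' f g := by
    refine Subtype.ext (Prod.ext ?_ ?_)
    · change resO _ (pb π _ (chartPoly k 0 1 (f.1.1 + g.1.1))) = resO _ _ + resO _ _
      rw [map_add, map_add, map_add]
    · change resO _ (pb π _ (chartPoly k 1 0 (f.1.2 + g.1.2))) = resO _ _ + resO _ _
      rw [map_add, map_add, map_add]
  map_smul' c f := by
    refine Subtype.ext (Prod.ext ?_ ?_)
    · change resO _ (pb π _ (chartPoly k 0 1 (c • f.1.1))) = resO _ (scalars p ⊤ c) * resO _ _
      rw [Polynomial.smul_eq_C_mul, map_mul, map_mul, map_mul, chartPoly_C,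
        Ribbon.pb_scalars hp, resO_scalars,
        resO_scalars]
    · change resO _ (pb π _ (chartPoly k 1 0 (c • f.1.2))) = resO _ (scalars p ⊤ c) * resO _ _
      rw [Polynomial.smul_eq_C_mul, map_mul, map_mul, map_mul, chartPoly_C,
        Ribbon.pb_scalars hp, resO_scalars,
        resO_scalars]

theorem pullSections_injective (hp : π ≫ P1.toSpec k = p) {i : P1 k ⟶ X} (h : i ≫ π = 𝟙 _)
    (n : ℕ) : Injective (pullSections π hp n) := by
  intro f g hfg
  have hres : ∀ U : X.Opens, Injective (resO (inf_le_right : ⊤ ⊓ U ≤ U)) := fun U =>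
    (Ribbon.resO_bijective_of_eq (top_inf_eq U)).1
  have h1 := congr((ofGlued $hfg).1.1)
  have h2 := congr((ofGlued $hfg).1.2)
  exact Subtype.ext (Prod.ext
    ((chartPoly_bijective k (by decide)).1 (pb_injective_of_comp_eq_id h _ (hres _ h1)))
    ((chartPoly_bijective k (by decide)).1 (pb_injective_of_comp_eq_id h _ (hres _ h2))))

end P1

variable {k : Type u} [Field k] {X : Scheme.{u}} (p : X ⟶ Spec (.of k))

/-- Isomorphic modules have isomorphic spaces of sections. -/
def H0Congr {M N : X.Modules} (φ : M ≅ N) : H0 p M ≃ₗ[k] H0 p N :=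
  LinearEquiv.ofLinearMap
    { toFun := φ.hom.app ⊤
      map_add' := map_add (φ.hom.app ⊤).hom
      map_smul' := fun c => φ.hom.app_smul (U := ⊤) (scalars p ⊤ c) }
    { toFun := φ.inv.app ⊤
      map_add' := map_add (φ.inv.app ⊤).hom
      map_smul' := fun c => φ.inv.app_smul (U := ⊤) (scalars p ⊤ c) }
    (LinearMap.ext fun x => congr(($(φ.inv_hom_id)).app ⊤ x))
    (LinearMap.ext fun x => congr(($(φ.hom_inv_id)).app ⊤ x))

end RibbonCurve

/-! ### Equality in the bound and pullbacks from the projective line. -/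

namespace Ribbon
open RibbonCurve Function Polynomial LaurentPolynomial
variable {k : Type u} [Field k] {C : Ribbon k}

/-- Restriction along `C.incl` undoes pullback along `π`, so the `n + 1` monomials stay independent
on the ribbon. -/
theorem IsSplitting.le_finrank {π : C.scheme ⟶ P1 k} (h : C.IsSplitting π) {L : C.scheme.Modules}
    {n : ℕ} [Module.Finite k (C.H0 L)] (e : L ≅ (Scheme.Modules.pullback π).obj (P1.twist k n)) :
    n + 1 ≤ Module.finrank k (C.H0 L) := by
  let φ : C.H0 L ≃ₗ[k] _ := H0Congr C.toSpec
    (e ≪≫ pullbackGluedIso π (P1.twistUnit_mul k n) (P1.chart_sup k))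
  rw [φ.finrank_eq]
  have := Module.Finite.equiv φ
  have h1 := LinearMap.finrank_le_finrank_of_injective
    (P1.pullSections_injective π h.comp_toSpec h.incl_comp n)
  rw [(finrank_ker_lineDiff (k := k) n).2] at h1
  exact h1.trans' (by omega)

/-- A line bundle whose transition function is a power of the coordinate, up to functions on the
charts, is a pullback from the projective line. -/
theorem IsSplitting.nonempty_iso {π : C.scheme ⟶ P1 k} (h : C.IsSplitting π)
    {L : C.scheme.Modules} {n : ℕ} {x : Γ(L, C.chart 0)} {y : Γ(L, C.chart 1)}
    (hx : IsGen L x) (hy : IsGen L y)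
    (hxy : resM L inf_le_right y = resO (inf_le_left : C.chart 0 ⊓ C.chart 1 ≤ _)
      (resO (h.preimage_chart 0).ge (pb π _ (P1.coord k))) ^ n • resM L inf_le_left x) :
    Nonempty (L ≅ (Scheme.Modules.pullback π).obj (P1.twist k n)) := by
  have h0 := (h.preimage_chart 0).le
  have h1 := (h.preimage_chart 1).le
  have hrel : resM L inf_le_right (resM L h1 y) = pbInf π (P1.twistUnit k n) •
      resM L inf_le_left (resM L h0 x) := by
    have := congr(resM L (inf_le_inf h0 h1) $hxy)
    rw [resM_resM, resM_smul, resM_resM, map_pow, resO_resO, resO_resO] at this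
    rw [resM_resM, resM_resM, this]
    congr 1
    refine .trans ?_ (map_pow (pb π (P1.chart k 0 ⊓ P1.chart k 1)) _ n).symm
    rw [pb_resO π inf_le_left]
    rfl
  have := isIso_gluedHom (preimage_sup_eq_top π (P1.chart_sup k)) hrel (hx.res h0) (hy.res h1)
  exact ⟨(asIso (gluedHom (preimage_sup_eq_top π (P1.chart_sup k)) hrel)).symm ≪≫
    (pullbackGluedIso π (P1.twistUnit_mul k n) (P1.chart_sup k)).symm⟩

variable {L : C.scheme.Modules} {e₀ : Γ(L, C.chart 0)} {e₁ : Γ(L, C.chart 1)}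
  {u : Γ(C.scheme, C.chart 0 ⊓ C.chart 1)}

/-- The lifts of the coordinates found by `RibbonAlgebra.exists_splitting` glue to `π`. For the
generators rescaled by `v₀` and `v₁`, the transition function is the `n`-th power of the pulled-back
coordinate. -/
theorem exists_isSplitting_of_finrank_eq (h₀ : IsGen L e₀) (h₁ : IsGen L e₁)
    (hu : resM L inf_le_right e₁ = u • resM L inf_le_left e₀) {n : ℕ} (hn : 1 ≤ n)
    (hρ : C.algebra.F.ρ (.mk u) = T (n : ℤ)) (he : n + C.algebra.e ≤ -3)
    (h : Module.finrank k (C.H0 L) = n + 1) : ∃ π : C.scheme ⟶ P1 k, C.IsSplitting π ∧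
      Nonempty (L ≅ (Scheme.Modules.pullback π).obj (P1.twist k n)) := by
  rw [(C.H0EquivKer h₀ h₁ hu).finrank_eq] at h
  obtain ⟨t, s, v₀, v₁, ht, hs, hts, huv⟩ := C.algebra.exists_splitting hn hρ he h
  rw [algebra_ρ₀] at ht
  rw [algebra_ρ₁] at hs
  rw [algebra_r₀, algebra_r₁] at hts huv
  let t₀ : Γ(C.scheme, C.chart 0) := t
  let t₁ : Γ(C.scheme, C.chart 1) := s
  let w₀ : Γ(C.scheme, C.chart 0)ˣ := v₀
  let w₁ : Γ(C.scheme, C.chart 1)ˣ := v₁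
  have ht₀ : C.toP1 0 t₀ = P1.coordinate k 0 1 := by
    rw [← C.chartPoly_ρ₀, ← P1.chartPoly_X, ← ht]
  have ht₁ : C.toP1 1 t₁ = P1.coordinate k 1 0 := by
    rw [← C.chartPoly_ρ₁, ← P1.chartPoly_X, ← hs]
  have hw : u * resO inf_le_right (w₁ : Γ(C.scheme, C.chart 1)) =
      resO inf_le_left t₀ ^ n * resO inf_le_left (w₀ : Γ(C.scheme, C.chart 0)) := huv
  obtain ⟨π, hπ, hc⟩ := exists_isSplitting (C := C) (t := Fin.cons t₀ (Fin.cons t₁ finZeroElim))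
    (by intro j; fin_cases j; exacts [ht₀, ht₁]) hts
  refine ⟨π, hπ, hπ.nonempty_iso (h₀.smul w₀.isUnit) (h₁.smul w₁.isUnit) ?_⟩
  have hc₀ : resO (hπ.preimage_chart 0).ge (pb π _ (P1.coord k)) = t₀ :=
    hc 0 (hπ.preimage_chart 0).ge
  rw [hc₀, resM_smul, resM_smul, hu, ← mul_smul, ← mul_smul, ← hw, mul_comm]

end Ribbon

end

/-! ### The theorem. -/

theorem mainTheorem2 {k : Type u} [Field k] [IsAlgClosed k] [CharZero k]
    (C : Ribbon k) (L : C.scheme.Modules) (hL : IsLineBundle L)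
    (n : ℕ) (hn : 1 ≤ n) (hg : (n : ℤ) ≤ C.genus - 2) (hdeg : C.degree L = 2 * (n : ℤ)) :
    Module.Finite k (C.H0 L) ∧
    Module.finrank k (C.H0 L) ≤ n + 1 ∧
    (Module.finrank k (C.H0 L) = n + 1 ↔
      C.IsHyperelliptic ∧ ∃ π : C.scheme ⟶ P1 k, C.IsSplitting π ∧
        Nonempty (L ≅ (Scheme.Modules.pullback π).obj (P1.twist k n))) := by
  obtain ⟨e₀, e₁, u, d, h₀, h₁, hu, hρ⟩ := C.exists_generators_of_isLineBundle hL
  rw [Ribbon.degree, C.chi_structureModule, C.chi_eq_index h₀ h₁ hu,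
    (C.algebra.index_diff hρ).2] at hdeg
  rw [C.genus_eq] at hg
  -- The contributions of `e` to the two Euler characteristics cancel, leaving degree `2 d`.
  obtain rfl : d = n := by omega
  have hfin : Module.Finite k (C.H0 L) := by
    have := (C.algebra.index_diff hρ).1.finite_ker
    exact Module.Finite.equiv (C.H0EquivKer h₀ h₁ hu).symm
  have hle : Module.finrank k (C.H0 L) ≤ n + 1 := by
    rw [(C.H0EquivKer h₀ h₁ hu).finrank_eq]
    exact C.algebra.finrank_ker_diff_le hρ (by omega)
  refine ⟨hfin, hle, fun h => ?_, fun ⟨_, π, hπ, ⟨e⟩⟩ => hle.antisymm (hπ.le_finrank e)⟩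
  -- As the genus is `-1 - e`, the bound `n ≤ g - 2` is precisely `n + e ≤ -3`; the dimension bound
  -- above only needed `n + e < 0`.
  obtain ⟨π, hπ, e⟩ := Ribbon.exists_isSplitting_of_finrank_eq h₀ h₁ hu hn hρ (by omega) h
  exact ⟨⟨π, hπ⟩, π, hπ, e⟩
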